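/- Let $n\geq 1$ and $0\leq p\leq n-1$. Let $M^{2n}$ be a connected Kaehler manifold of real dimension $2n$, that is, a connected smooth manifold with a smooth Riemannian metric $\langle\,,\rangle$ and a smooth almost complex structure $J$ that is orthogonal and parallel with respect to the Levi-Civita connection. Let $\mathbb{L}^{N+1}$ be $\mathbb{R}^{N+1}$ with the Lorentzian inner product $-x_0y_0+x_1y_1+\cdots+x_Ny_N$, let $\mathbb{H}^{N}_{c}=\{x\in\mathbb{L}^{N+1}:\langle x,x\rangle=1/c,\ x_0>0\}$ for $c<0$, and let $\mathbb{S}^2_c=\{x\in\mathbb{R}^3:\|x\|^2=1/c\}$ for $c>0$. Let $f\colon M^{2n}\to\mathbb{H}^{2n+p}_{-1}$ be a smooth isometric immersion. Assume that at some point $x_0\in M^{2n}$ there is a $J$-invariant vector subspace $V\subset T_{x_0}M$ of real dimension $2m$ with $m\geq p$ such that the sectional curvature of $M^{2n}$ satisfies $K(S,JS)>0$ for every $0\neq S\in V$. Then $p=n-1$, and there are real numbers $c_1<0$ and $c_2,\dots,c_n>0$ with $\sum_{j=1}^n 1/c_j=-1$ such that, up to an isometry of the ambient hyperbolic space, $f(M)$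 is an open subset of the extrinsic product $$\mathbb{H}^2_{c_1}\times\mathbb{S}^2_{c_2}\times\cdots\times\mathbb{S}^2_{c_n}\subset\mathbb{H}^{3n-1}_{-1}\subset\mathbb{L}^{3n}=\mathbb{L}^3\times\mathbb{R}^3\times\cdots\times\mathbb{R}^3 .$$ More precisely, there is a linear isometry $\Phi\colon\mathbb{L}^3\times\mathbb{R}^3\times\cdots\times\mathbb{R}^3\to\mathbb{L}^{3n}$ that maps the hyperbolic space $\mathbb{H}^{3n-1}_{-1}$ of the first space onto that of the second and is such that $f(M)$ is a relatively open subset of $\Phi(\mathbb{H}^2_{c_1}\times\mathbb{S}^2_{c_2}\times\cdots\times\mathbb{S}^2_{c_n})$. -/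

import Mathlib

open scoped Manifold ContDiff

noncomputable section

namespace KaehlerHyperbolic

/-! ### Riemannian geometry in charts

`M` is a smooth manifold of dimension `d`, `g` a smooth Riemannian metric on `M` and `e` a chart of
`M`. The quantities below are those of `g` in the coordinates `e`; vectors of `ℝ^d` stand for the
constant vector fields on `e.target`. -/

section Charts

variable {d : ℕ} {M : Type*} [TopologicalSpace M] [ChartedSpace (EuclideanSpace ℝ (Fin d)) M]
  [IsManifold (𝓡 d) ∞ M]

/-- A smooth Riemannian metric on `M`. -/
abbrev RiemMetric (d : ℕ) (M : Type*) [TopologicalSpace M]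
    [ChartedSpace (EuclideanSpace ℝ (Fin d)) M] [IsManifold (𝓡 d) ∞ M] :=
  Bundle.ContMDiffRiemannianMetric (𝓡 d) ∞ (EuclideanSpace ℝ (Fin d))
    (fun x : M => TangentSpace (𝓡 d) x)

/-- The tangent vector at `e.symm y` whose coordinate vector in the chart `e` is `u`. -/
def ofCoord (e : OpenPartialHomeomorph M (EuclideanSpace ℝ (Fin d)))
    (y u : EuclideanSpace ℝ (Fin d)) : TangentSpace (𝓡 d) (e.symm y) :=
  mfderiv (𝓡 d) (𝓡 d) e.symm y u

/-- The coordinate vector in the chart `e` of a tangent vector at `x`. -/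
def toCoord (e : OpenPartialHomeomorph M (EuclideanSpace ℝ (Fin d)))
    (x : M) (v : TangentSpace (𝓡 d) x) : EuclideanSpace ℝ (Fin d) :=
  mfderiv (𝓡 d) (𝓡 d) e x v

/-- The metric in the chart `e`: `g_y(u, v)`. -/
def coordMetric (g : RiemMetric d M) (e : OpenPartialHomeomorph M (EuclideanSpace ℝ (Fin d)))
    (y u v : EuclideanSpace ℝ (Fin d)) : ℝ :=
  g.inner (e.symm y) (ofCoord e y u) (ofCoord e y v)

/-- The Gram matrix `(g_{ij}(y))` of the metric in the chart `e`. -/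
def gram (g : RiemMetric d M) (e : OpenPartialHomeomorph M (EuclideanSpace ℝ (Fin d)))
    (y : EuclideanSpace ℝ (Fin d)) : Matrix (Fin d) (Fin d) ℝ :=
  Matrix.of fun i j =>
    coordMetric g e y (EuclideanSpace.single i (1 : ℝ)) (EuclideanSpace.single j (1 : ℝ))

/-- Christoffel symbols of the first kind: `⟨∇_u v, w⟩` for constant vector fields `u, v, w`, that is
`(∂_u g(v, w) + ∂_v g(u, w) - ∂_w g(u, v)) / 2`. -/
def christoffelLower (g : RiemMetric d M)
    (e : OpenPartialHomeomorph M (EuclideanSpace ℝ (Fin d)))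
    (y u v w : EuclideanSpace ℝ (Fin d)) : ℝ :=
  (fderiv ℝ (fun z => coordMetric g e z v w) y u + fderiv ℝ (fun z => coordMetric g e z u w) y v
    - fderiv ℝ (fun z => coordMetric g e z u v) y w) / 2

/-- The Levi-Civita connection in the chart `e`: `Γ_y(u, v) = (∇_u v)(y)` for constant vector fields
`u, v`, with components `Γ^k = ∑_l g^{kl} ⟨∇_u v, ∂_l⟩`. -/
def christoffel (g : RiemMetric d M) (e : OpenPartialHomeomorph M (EuclideanSpace ℝ (Fin d)))
    (y u v : EuclideanSpace ℝ (Fin d)) : EuclideanSpace ℝ (Fin d) :=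
  WithLp.toLp 2 fun k =>
    ∑ l, (gram g e y)⁻¹ k l * christoffelLower g e y u v (EuclideanSpace.single l (1 : ℝ))

/-- The curvature tensor in the chart `e`:
`R(u, v) w = ∇_u ∇_v w - ∇_v ∇_u w` for constant vector fields `u, v, w`. -/
def coordCurvature (g : RiemMetric d M)
    (e : OpenPartialHomeomorph M (EuclideanSpace ℝ (Fin d)))
    (y u v w : EuclideanSpace ℝ (Fin d)) : EuclideanSpace ℝ (Fin d) :=
  (fderiv ℝ (fun z => christoffel g e z v w) y u + christoffel g e y u (christoffel g e y v w))
    - (fderiv ℝ (fun z => christoffel g e z u w) y v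
      + christoffel g e y v (christoffel g e y u w))

/-- The curvature `⟨R(u, v) w, z⟩` at `x`, computed in the preferred chart at `x`. -/
def curvature (g : RiemMetric d M) (x : M) (u v w z : TangentSpace (𝓡 d) x) : ℝ :=
  let e := chartAt (EuclideanSpace ℝ (Fin d)) x
  coordMetric g e (e x)
    (coordCurvature g e (e x) (toCoord e x u) (toCoord e x v) (toCoord e x w)) (toCoord e x z)

/-- The sectional curvature of the plane spanned by `u` and `v`:
`K(u, v) = ⟨R(u, v) v, u⟩ / (|u|² |v|² - ⟨u, v⟩²)`. -/
def sectionalCurvature (g : RiemMetric d M) (x : M) (u v : TangentSpace (𝓡 d) x) : ℝ :=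
  curvature g x u v v u / (g.inner x u u * g.inner x v v - g.inner x u v ^ 2)

/-- A field of endomorphisms of the tangent spaces, in the chart `e`. -/
def coordEndo (J : ∀ x : M, TangentSpace (𝓡 d) x →L[ℝ] TangentSpace (𝓡 d) x)
    (e : OpenPartialHomeomorph M (EuclideanSpace ℝ (Fin d)))
    (y u : EuclideanSpace ℝ (Fin d)) : EuclideanSpace ℝ (Fin d) :=
  toCoord e (e.symm y) (J (e.symm y) (ofCoord e y u))

/-- The covariant derivative `(∇_u J) v = ∇_u (J v) - J (∇_u v)` in the chart `e`. -/
def coordCovDeriv (g : RiemMetric d M)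
    (J : ∀ x : M, TangentSpace (𝓡 d) x →L[ℝ] TangentSpace (𝓡 d) x)
    (e : OpenPartialHomeomorph M (EuclideanSpace ℝ (Fin d)))
    (y u v : EuclideanSpace ℝ (Fin d)) : EuclideanSpace ℝ (Fin d) :=
  (fderiv ℝ (fun z => coordEndo J e z v) y u + christoffel g e y u (coordEndo J e y v))
    - coordEndo J e y (christoffel g e y u v)

/-- A Kaehler structure on `M`: a Riemannian metric together with a smooth almost complex structure
`J` that is orthogonal and parallel with respect to the Levi-Civita connection. -/
structure KaehlerStructure (d : ℕ) (M : Type*) [TopologicalSpace M]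
    [ChartedSpace (EuclideanSpace ℝ (Fin d)) M] [IsManifold (𝓡 d) ∞ M] where
  metric : RiemMetric d M
  J : ∀ x : M, TangentSpace (𝓡 d) x →L[ℝ] TangentSpace (𝓡 d) x
  contMDiff_J : ContMDiff (𝓡 d)
    ((𝓡 d).prod 𝓘(ℝ, EuclideanSpace ℝ (Fin d) →L[ℝ] EuclideanSpace ℝ (Fin d))) ∞
    (fun x : M => Bundle.TotalSpace.mk'
      (EuclideanSpace ℝ (Fin d) →L[ℝ] EuclideanSpace ℝ (Fin d))
      (E := fun x : M => TangentSpace (𝓡 d) x →L[ℝ] TangentSpace (𝓡 d) x) x (J x))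
  J_J : ∀ (x : M) (v : TangentSpace (𝓡 d) x), J x (J x v) = -v
  inner_J_J : ∀ (x : M) (v w : TangentSpace (𝓡 d) x),
    metric.inner x (J x v) (J x w) = metric.inner x v w
  parallel_J : ∀ e ∈ IsManifold.maximalAtlas (𝓡 d) ∞ M, ∀ y ∈ e.target, ∀ u v,
    coordCovDeriv metric J e y u v = 0

end Charts

/-! ### Lorentzian space and hyperbolic space -/

section Lorentz

variable {ι : Type*} [Fintype ι] [DecidableEq ι]

/-- The Lorentzian inner product on `ℝ^ι` whose time coordinate is `o`. -/
def lorentz (o : ι) (x y : ι → ℝ) : ℝ :=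
  ∑ i, (if i = o then -1 else 1) * (x i * y i)

/-- The hyperbolic space of curvature `c < 0` in the Lorentzian space `ℝ^ι`: the sheet `x_o > 0` of
the hyperboloid `⟨x, x⟩ = 1 / c`. -/
def hyperboloid (o : ι) (c : ℝ) : Set (ι → ℝ) :=
  {x | lorentz o x x = 1 / c ∧ 0 < x o}

/-- The hyperbolic space `ℍ^N_{-1} ⊂ 𝕃^{N+1}`. -/
abbrev HyperbolicSpace (N : ℕ) := hyperboloid (0 : Fin (N + 1)) (-1)

/-- The umbilical surface `ℍ²_c ⊂ 𝕃³`. -/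
def hyperbolicPlane (c : ℝ) : Set (Fin 3 → ℝ) := hyperboloid 0 c

/-- The umbilical surface `𝕊²_c ⊂ ℝ³`, the round sphere of curvature `c > 0` centred at `0`. -/
def roundSphere (c : ℝ) : Set (Fin 3 → ℝ) := {x | ∑ i, x i ^ 2 = 1 / c}

/-- The extrinsic product `ℍ²_{c_0} × 𝕊²_{c_1} × ⋯ × 𝕊²_{c_k}` in
`𝕃^{3(k+1)} = 𝕃³ × ℝ³ × ⋯ × ℝ³`; the coordinates of `𝕃^{3(k+1)}` are indexed by
`Fin (k + 1) × Fin 3` and the time coordinate is `(0, 0)`. -/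
def extrinsicProduct (k : ℕ) (c : Fin (k + 1) → ℝ) : Set (Fin (k + 1) × Fin 3 → ℝ) :=
  {x | (fun i => x (0, i)) ∈ hyperbolicPlane (c 0) ∧
    ∀ j, j ≠ 0 → (fun i => x (j, i)) ∈ roundSphere (c j)}

end Lorentz

/-- `f : M → ℍ^N_{-1}` is a (smooth) isometric immersion. -/
structure IsIsometricImmersion {d N : ℕ} {M : Type*} [TopologicalSpace M]
    [ChartedSpace (EuclideanSpace ℝ (Fin d)) M] [IsManifold (𝓡 d) ∞ M]
    (g : RiemMetric d M) (f : M → HyperbolicSpace N) : Prop where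
  contMDiff : ContMDiff (𝓡 d) 𝓘(ℝ, Fin (N + 1) → ℝ) ∞ (fun x => (f x : Fin (N + 1) → ℝ))
  isometric : ∀ (x : M) (u v : TangentSpace (𝓡 d) x),
    lorentz (0 : Fin (N + 1))
      (mfderiv (𝓡 d) 𝓘(ℝ, Fin (N + 1) → ℝ) (fun x => (f x : Fin (N + 1) → ℝ)) x u)
      (mfderiv (𝓡 d) 𝓘(ℝ, Fin (N + 1) → ℝ) (fun x => (f x : Fin (N + 1) → ℝ)) x v)
      = g.inner x u v

end KaehlerHyperbolic

end

/-!
In a chart the immersion is a map `F` into Lorentz space. Let `α` be its second fundamental form as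
an immersion into Lorentz space, so that `⟨α, F⟩` is minus the metric, and let `h` and `a` be the
`(1, 1)`- and `(2, 0)`-parts of `α`. The Gauss equation and the Kaehler symmetries of the curvature
make `h` and `a` flat with respect to the complexified inner product of the normal space, which has
complex dimension `p + 1`.

At `x₀`, positivity of `K(S, JS)` on `V` provides a regular tangent vector `Z`, that is, one with
`h(·, Z)` injective. Hence `n = p + 1`, and the shape operators of `h` relative to `Z` commute.
Their common eigenvectors `X i` diagonalize `h`, and pairing with `F` shows `a = 0`. So Lorentz
space is the orthogonal sum of the three-dimensional spans of `F_* X i`, `F_* J X i` and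
`α(X i, X i)`.

Regularity is an open condition. Near a regular point, `a = 0` and the Codazzi equation imply that
`α` is parallel, and then the commutators of the projections `P i` to these three-dimensional
subspaces with the tangent projection, its derivative and `J` solve a linear system of differential
equations. They vanish at the point, hence nearby: the subspaces are constant and split the
immersion. The set of points where the immersion splits along the `P i` is closed; it is open
because the sum of tangent vectors generating the summands is again regular. On the connected
manifold all `⟨P i F, F⟩` are therefore constant, so the image lies in a product of quadrics; it is
open there because `F` and independent rescalings of its components `P i F` fill a neighborhood in
Lorentz space.
-/

noncomputable section

namespace KaehlerHyperbolic

/-! ### Flat Hermitian forms -/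

section FlatHermitian

open Module ComplexConjugate

/-- If no `A + t C` has larger rank than `A`, the perturbation `C` maps the kernel of `A` into its
range: otherwise, for small `t ≠ 0`, the images of lifts of a basis of the range together with
`C x = (A + t C) (t⁻¹ x)` would be too many independent vectors in the range of `A + t C`. -/
theorem map_ker_le_range_of_finrank_range_add_smul_le {𝕜 V W : Type*} [NontriviallyNormedField 𝕜]
    [CompleteSpace 𝕜] [AddCommGroup V] [Module 𝕜 V] [AddCommGroup W] [Module 𝕜 W]
    [FiniteDimensional 𝕜 W] {A C : V →ₗ[𝕜] W}
    (hmax : ∀ t : 𝕜, finrank 𝕜 (A + t • C).range ≤ finrank 𝕜 A.range) :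
    A.ker.map C ≤ A.range := by
  rintro _ ⟨x, hx, rfl⟩
  by_contra hCx
  let e := finBasis 𝕜 A.range
  choose a ha using fun i => (e i).2
  let w : 𝕜 → Fin (finrank 𝕜 A.range + 1) → W := fun t => Fin.cons (C x) fun i => (A + t • C) (a i)
  let coord := (finBasis 𝕜 W).equivFun
  have hcoord (v : Fin (finrank 𝕜 A.range + 1) → W) :
      LinearIndependent 𝕜 (coord ∘ v) ↔ LinearIndependent 𝕜 v :=
    LinearMap.linearIndependent_iff coord.toLinearMap coord.ker
  have hw₀ : LinearIndependent 𝕜 (w 0) := by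
    have he : LinearIndependent 𝕜 fun i => (e i : W) :=
      e.linearIndependent.map' A.range.subtype A.range.ker_subtype
    have hw : w 0 = Fin.cons (C x) fun i => (e i : W) := by simp [w, ha]
    rw [hw, linearIndependent_finCons]
    refine ⟨he, fun h => hCx (Submodule.span_le.2 ?_ h)⟩
    rintro _ ⟨i, rfl⟩
    exact (e i).2
  have hcont : Continuous fun t => coord ∘ w t := by
    refine continuous_pi fun i => ?_
    induction i using Fin.cases with
    | zero => exact continuous_const (y := coord (C x))
    | succ i =>
      simp only [Function.comp_apply, w, Fin.cons_succ, LinearMap.add_apply, LinearMap.smul_apply,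
        map_add, map_smul]
      fun_prop
  have hnear : ∀ᶠ t in nhdsWithin (0 : 𝕜) {0}ᶜ, LinearIndependent 𝕜 (coord ∘ w t) ∧ t ≠ 0 :=
    ((hcont.continuousAt.eventually
      (LinearIndependent.eventually ((hcoord _).2 hw₀))).filter_mono nhdsWithin_le_nhds).and
      self_mem_nhdsWithin
  obtain ⟨t, hwt, ht⟩ := hnear.exists
  have hmem (i) : w t i ∈ (A + t • C).range := by
    refine Fin.cases ⟨t⁻¹ • x, ?_⟩ (fun i => ⟨a i, rfl⟩) i
    simp [w, LinearMap.mem_ker.1 hx, inv_smul_smul₀ ht]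
  have hrank := Submodule.finrank_mono (Submodule.span_le.2 (Set.range_subset_iff.2 hmem))
  rw [finrank_span_eq_card ((hcoord _).1 hwt), Fintype.card_fin] at hrank
  exact absurd (hrank.trans (hmax t)) (by simp)

theorem exists_common_eigenvector {𝕜 T ι : Type*} [Field 𝕜] [IsAlgClosed 𝕜] [AddCommGroup T]
    [Module 𝕜 T] [FiniteDimensional 𝕜 T] {C : ι → End 𝕜 T} (hC : ∀ i j, Commute (C i) (C j))
    {S : Submodule 𝕜 T} (hS : S ≠ ⊥) (hCS : ∀ i, ∀ x ∈ S, C i x ∈ S) :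
    ∃ x ∈ S, x ≠ 0 ∧ ∀ i, ∃ μ : 𝕜, C i x = μ • x := by
  induction S using WellFoundedLT.induction with
  | _ S ih =>
  by_cases hscalar : ∀ i, ∃ μ : 𝕜, ∀ x ∈ S, C i x = μ • x
  · obtain ⟨x, hx, hx₀⟩ := S.ne_bot_iff.1 hS
    exact ⟨x, hx, hx₀, fun i => (hscalar i).imp fun μ hμ => hμ x hx⟩
  push Not at hscalar
  obtain ⟨i, hi⟩ := hscalar
  have : Nontrivial S := Submodule.nontrivial_iff_ne_bot.2 hS
  obtain ⟨μ, hμ⟩ := End.exists_eigenvalue ((C i).restrict (hCS i))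
  obtain ⟨v, hv⟩ := hμ.exists_hasEigenvector
  have hlt : S ⊓ (C i).eigenspace μ < S := by
    obtain ⟨x, hx, hx'⟩ := hi μ
    exact inf_le_left.lt_of_ne fun h => hx' (End.mem_eigenspace_iff.1 (h.symm.le hx).2)
  have hne : S ⊓ (C i).eigenspace μ ≠ ⊥ := (Submodule.ne_bot_iff _).2
    ⟨v, ⟨v.2, End.mem_eigenspace_iff.2 (congrArg Subtype.val hv.apply_eq_smul)⟩,
      fun h => hv.2 (Subtype.ext h)⟩
  obtain ⟨x, hx, hx₀, hxe⟩ := ih _ hlt hne fun j x hx =>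
    ⟨hCS j x hx.1, End.mem_eigenspace_iff.2 <| by rw [← End.mul_apply, (hC i j).eq, End.mul_apply,
      End.mem_eigenspace_iff.1 hx.2, map_smul]⟩
  exact ⟨x, hx.1, hx₀, hxe⟩

variable {T W : Type*} [AddCommGroup T] [Module ℂ T] [AddCommGroup W] [Module ℂ W]

/-- A definite flat Hermitian form `h` on `T` with values in a space `W` with a nondegenerate
symmetric bilinear form `B` and a conjugation `σ`. Flatness is the vanishing of the curvature that
the Gauss equation attaches to `h`. -/
structure IsFlatHermitian (B : LinearMap.BilinForm ℂ W) (σ : W →ₗ⋆[ℂ] W)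
    (h : T →ₗ⋆[ℂ] T →ₗ[ℂ] W) : Prop where
  symm : ∀ x y, B x y = B y x
  nondeg : B.Nondegenerate
  conj_eq : ∀ X Y, σ (h Y X) = h X Y
  flat : ∀ Y X Y' X', B (h Y X) (h Y' X') = B (h Y X') (h Y' X)
  self_ne_zero : ∀ X, X ≠ 0 → h X X ≠ 0

/-- A nonzero vector `X` is principal for `h` if every `h(Y, X)` is a multiple of `h(X, X)`. -/
def IsPrincipal (h : T →ₗ⋆[ℂ] T →ₗ[ℂ] W) (X : T) : Prop :=
  X ≠ 0 ∧ ∀ Y, ∃ c : ℂ, h Y X = c • h X X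

/-- A family of principal vectors that diagonalizes `h`. -/
structure IsPrincipalFamily {ι : Type*} (h : T →ₗ⋆[ℂ] T →ₗ[ℂ] W) (X : ι → T) : Prop where
  isPrincipal : ∀ i, IsPrincipal h (X i)
  apply_eq_zero : ∀ i j, i ≠ j → h (X i) (X j) = 0

variable {B : LinearMap.BilinForm ℂ W} {σ : W →ₗ⋆[ℂ] W} {h : T →ₗ⋆[ℂ] T →ₗ[ℂ] W}

namespace IsFlatHermitian

theorem exists_coeff (H : IsFlatHermitian B σ h) {X : T} (hX : IsPrincipal h X) :
    ∃ φ : T → ℂ, (∀ Y, h Y X = φ Y • h X X) ∧ (∀ Y, h X Y = conj (φ Y) • h X X) ∧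
      ∀ Y Y', B (h X X) (h Y Y') = conj (φ Y') * φ Y * B (h X X) (h X X) := by
  choose φ hφ using hX.2
  have hφ' (Y) : h X Y = conj (φ Y) • h X X := by
    rw [← H.conj_eq, hφ, σ.map_smulₛₗ, H.conj_eq]
  refine ⟨φ, hφ, hφ', fun Y Y' => ?_⟩
  rw [H.flat, hφ Y, hφ' Y', map_smul, map_smul, LinearMap.smul_apply, smul_eq_mul, smul_eq_mul]
  ring

theorem apply_mem_orthogonal (H : IsFlatHermitian B σ h) {Z X : T} (hZX : h Z X = 0)
    (V : Submodule ℂ T) (Y : T) : h Y X ∈ B.orthogonal (V.map (h Z)) := by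
  rintro _ ⟨A, -, rfl⟩
  rw [H.flat, hZX, map_zero, LinearMap.zero_apply]

section RegularVector

variable [FiniteDimensional ℂ W]

theorem exists_injOn (H : IsFlatHermitian B σ h) {V : Submodule ℂ T}
    (hV : ∀ S ∈ V, S ≠ 0 → B (h S S) (h S S) ≠ 0) :
    ∃ Z ∈ V, ∀ X ∈ V, h Z X = 0 → X = 0 := by
  let r : V → ℕ := fun Z => finrank ℂ ((h Z).domRestrict V).range
  have hr : (Set.range r).Finite := (Set.finite_le_nat (finrank ℂ W)).subset <| by
    rintro _ ⟨Z, rfl⟩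
    exact Submodule.finrank_le _
  obtain ⟨_, ⟨Z, rfl⟩, hmax⟩ := Set.exists_max_image _ id hr (Set.range_nonempty r)
  refine ⟨Z, Z.2, fun X hX hZX => by_contra fun hX₀ => ?_⟩
  have hrange := map_ker_le_range_of_finrank_range_add_smul_le
    (A := (h Z).domRestrict V) (C := (h X).domRestrict V) fun t => by
      have hadd : (h Z).domRestrict V + t • (h X).domRestrict V =
          (h (Z + conj t • ⟨X, hX⟩ : V)).domRestrict V := by
        ext Y
        simp
      rw [hadd]
      exact hmax _ ⟨_, rfl⟩
  obtain ⟨A, hA⟩ := hrange ⟨⟨X, hX⟩, hZX, rfl⟩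
  exact hV X hX hX₀ (H.apply_mem_orthogonal hZX V X _ ⟨A, A.2, hA⟩)

variable {V : Submodule ℂ T} {Z b : T}

theorem orthogonal_le_span (H : IsFlatHermitian B σ h) (hZ : ∀ X ∈ V, h Z X = 0 → X = 0)
    (hdim : finrank ℂ W ≤ finrank ℂ V + 1) (hZb : h Z b = 0) (hb : b ≠ 0) :
    B.orthogonal (V.map (h Z)) ≤ ℂ ∙ h b b := by
  have hinj : Function.Injective ((h Z).domRestrict V) :=
    (injective_iff_map_eq_zero _).2 fun X hX => Subtype.ext (hZ X X.2 hX)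
  have hrank : finrank ℂ (V.map (h Z)) = finrank ℂ V := by
    rw [← LinearMap.range_domRestrict, LinearMap.finrank_range_of_inj hinj]
  have hle : ℂ ∙ h b b ≤ B.orthogonal (V.map (h Z)) :=
    (Submodule.span_singleton_le_iff_mem _ _).2 (H.apply_mem_orthogonal hZb V b)
  refine (Submodule.eq_of_le_of_finrank_le hle ?_).ge
  rw [finrank_span_singleton (H.self_ne_zero b hb),
    LinearMap.BilinForm.finrank_orthogonal H.nondeg, hrank]
  omega

theorem apply_self_ne_zero_of_orthogonal_le_span (H : IsFlatHermitian B σ h)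
    (hV : ∀ S ∈ V, S ≠ 0 → B (h S S) (h S S) ≠ 0) (hb : IsPrincipal h b)
    (hperp : B.orthogonal (V.map (h Z)) ≤ ℂ ∙ h b b) : B (h b b) (h b b) ≠ 0 := by
  intro hnull
  have hmem : h b b ∈ V.map (h Z) := by
    rw [← LinearMap.BilinForm.orthogonal_orthogonal H.nondeg
      (fun x y hxy => by rw [H.symm, hxy]) (V.map (h Z))]
    intro ξ hξ
    obtain ⟨c, rfl⟩ := Submodule.mem_span_singleton.1 (hperp hξ)
    rw [map_smul, LinearMap.smul_apply, hnull, smul_zero]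
  obtain ⟨S, hSV, hS⟩ := hmem
  have hS₀ : S ≠ 0 := by
    rintro rfl
    exact H.self_ne_zero b hb.1 (by rw [← hS, map_zero])
  obtain ⟨φ, -, -, hφ⟩ := H.exists_coeff hb
  have hSperp : h S S ∈ B.orthogonal (V.map (h Z)) := by
    rintro _ ⟨A, -, rfl⟩
    rw [H.flat, hS, hφ, hnull, mul_zero]
  obtain ⟨c, hc⟩ := Submodule.mem_span_singleton.1 (hperp hSperp)
  refine hV S hSV hS₀ ?_
  rw [← hc, map_smul, map_smul, LinearMap.smul_apply, hnull, smul_zero, smul_zero]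

theorem exists_injective (H : IsFlatHermitian B σ h)
    (hV : ∀ S ∈ V, S ≠ 0 → B (h S S) (h S S) ≠ 0) (hdim : finrank ℂ W ≤ finrank ℂ V + 1) :
    ∃ Z, Function.Injective (h Z) := by
  obtain ⟨Z, -, hZ⟩ := H.exists_injOn hV
  by_cases hinj : ∀ X, h Z X = 0 → X = 0
  · exact ⟨Z, (injective_iff_map_eq_zero _).2 hinj⟩
  push Not at hinj
  obtain ⟨b, hZb, hb⟩ := hinj
  have hperp := H.orthogonal_le_span hZ hdim hZb hb
  have hker (X) (hX : h Z X = 0) (Y) : ∃ c : ℂ, c • h b b = h Y X :=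
    Submodule.mem_span_singleton.1 (hperp (H.apply_mem_orthogonal hX V Y))
  have hbp : IsPrincipal h b := ⟨hb, fun Y => (hker b hZb Y).imp fun _ => Eq.symm⟩
  have hbb := H.apply_self_ne_zero_of_orthogonal_le_span hV hbp hperp
  obtain ⟨φ, hφ, hφ', hφB⟩ := H.exists_coeff hbp
  have hφZ : φ Z = 0 :=
    (smul_eq_zero.1 ((hφ Z).symm.trans hZb)).resolve_right (H.self_ne_zero b hb)
  -- `h(Z, ·)` is orthogonal to `h(b, ·)`, so `h(Z + b, X) = 0` forces both terms to vanish.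
  refine ⟨Z + b, (injective_iff_map_eq_zero _).2 fun X hX => ?_⟩
  have hsum : h Z X + h b X = 0 := by simpa only [map_add, LinearMap.add_apply] using hX
  have hφX : conj (φ X) = 0 := by
    have hB := congrArg (B (h b b)) hsum
    rw [map_add, hφB, hφZ, hφ' X, map_smul, mul_zero, zero_mul, zero_add, map_zero] at hB
    exact (smul_eq_zero.1 hB).resolve_right hbb
  have hZX : h Z X = 0 := by rwa [hφ', hφX, zero_smul, add_zero] at hsum
  obtain ⟨c, hc⟩ := hker X hZX X
  have hc₀ : c = 0 := by
    have hB := hφB X X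
    rw [hφX, ← hc, map_smul, zero_mul, zero_mul] at hB
    exact (smul_eq_zero.1 hB).resolve_right hbb
  by_contra hX₀
  exact H.self_ne_zero X hX₀ (by rw [← hc, hc₀, zero_smul])

end RegularVector

section Diagonalization

variable {Z : T}

theorem eq_of_forall_apply_eq (H : IsFlatHermitian B σ h) (hZ : Function.Bijective (h Z)) {ξ η : W}
    (hξη : ∀ X, B ξ (h Z X) = B η (h Z X)) : ξ = η := by
  refine sub_eq_zero.1 (H.nondeg.1 _ fun ζ => ?_)
  obtain ⟨X, rfl⟩ := hZ.2 ζ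
  rw [map_sub, LinearMap.sub_apply, hξη, sub_self]

variable (h) in
/-- The shape operator `C_Y` of `h` relative to `Z`, defined by `h(Z, C_Y X) = h(Y, X)`. -/
def shapeOperator (hZ : Function.Bijective (h Z)) (Y : T) : End ℂ T :=
  (LinearEquiv.ofBijective (h Z) hZ).symm.toLinearMap ∘ₗ h Y

theorem apply_shapeOperator (hZ : Function.Bijective (h Z)) (Y X : T) :
    h Z (shapeOperator h hZ Y X) = h Y X :=
  (LinearEquiv.ofBijective (h Z) hZ).apply_symm_apply _

theorem commute_shapeOperator (H : IsFlatHermitian B σ h) (hZ : Function.Bijective (h Z))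
    (Y Y' : T) : Commute (shapeOperator h hZ Y) (shapeOperator h hZ Y') := by
  refine LinearMap.ext fun X => hZ.1 (H.eq_of_forall_apply_eq hZ fun X' => ?_)
  rw [End.mul_apply, End.mul_apply, apply_shapeOperator, apply_shapeOperator, H.flat Y,
    H.flat Y', apply_shapeOperator, apply_shapeOperator, H.flat Y X', H.symm]

theorem apply_shapeOperator_eq_zero (H : IsFlatHermitian B σ h) (hZ : Function.Bijective (h Z))
    {X x : T} (hx : h X x = 0) (Y : T) : h X (shapeOperator h hZ Y x) = 0 := by
  refine H.eq_of_forall_apply_eq hZ fun X' => ?_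
  rw [H.flat, apply_shapeOperator, H.flat, hx, map_zero, LinearMap.zero_apply, LinearMap.zero_apply]

theorem isPrincipal_of_shapeOperator (H : IsFlatHermitian B σ h) (hZ : Function.Bijective (h Z))
    {x : T} (hx : x ≠ 0) (hxe : ∀ Y, ∃ μ : ℂ, shapeOperator h hZ Y x = μ • x) :
    IsPrincipal h x := by
  have hmul (Y) : ∃ μ : ℂ, h Y x = μ • h Z x :=
    (hxe Y).imp fun μ hμ => by rw [← apply_shapeOperator hZ, hμ, map_smul]
  obtain ⟨ν, hν⟩ := hmul x
  have hν₀ : ν ≠ 0 := by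
    rintro rfl
    exact H.self_ne_zero x hx (by rw [hν, zero_smul])
  refine ⟨hx, fun Y => ?_⟩
  obtain ⟨μ, hμ⟩ := hmul Y
  exact ⟨μ * ν⁻¹, by rw [hμ, hν, smul_smul, inv_mul_cancel_right₀ hν₀]⟩

theorem apply_self_self_ne_zero (H : IsFlatHermitian B σ h) (hZ : Function.Bijective (h Z)) {X : T}
    (hX : IsPrincipal h X) : B (h X X) (h X X) ≠ 0 := by
  intro hnull
  obtain ⟨φ, -, -, hφ⟩ := H.exists_coeff hX
  refine H.self_ne_zero X hX.1 (H.eq_of_forall_apply_eq hZ fun X' => ?_)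
  rw [hφ, hnull, mul_zero, map_zero, LinearMap.zero_apply]

theorem iInf_ker_ne_bot (H : IsFlatHermitian B σ h) [FiniteDimensional ℂ T] {ι : Type*} [Fintype ι]
    {X : ι → T} (hX : ∀ i, IsPrincipal h (X i)) (hcard : Fintype.card ι < finrank ℂ T)
    (hne : ∀ i, B (h (X i) (X i)) (h (X i) (X i)) ≠ 0) :
    ⨅ i, (h (X i)).ker ≠ ⊥ := by
  let L : T →ₗ[ℂ] ι → ℂ := LinearMap.pi fun i => B (h (X i) (X i)) ∘ₗ h (X i)
  have hL : L.ker ≠ ⊥ := L.ker_ne_bot_of_finrank_lt (by rwa [finrank_fintype_fun_eq_card])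
  refine ne_bot_of_le_ne_bot hL (le_iInf fun i Y hY => ?_)
  obtain ⟨φ, -, hφ, -⟩ := H.exists_coeff (hX i)
  have hBY : B (h (X i) (X i)) (h (X i) Y) = 0 := congrFun (LinearMap.mem_ker.1 hY) i
  rw [hφ Y, map_smul] at hBY
  rw [LinearMap.mem_ker, hφ Y, (smul_eq_zero.1 hBY).resolve_right (hne i), zero_smul]

theorem exists_isPrincipalFamily (H : IsFlatHermitian B σ h) [FiniteDimensional ℂ T]
    (hZ : Function.Bijective (h Z)) {k : ℕ} (hk : k ≤ finrank ℂ T) :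
    ∃ X : Fin k → T, IsPrincipalFamily h X := by
  induction k with
  | zero => exact ⟨Fin.elim0, fun i => i.elim0, fun i => i.elim0⟩
  | succ k ih =>
    obtain ⟨X, hX⟩ := ih (Nat.le_of_succ_le hk)
    have hmem (Y) : Y ∈ ⨅ i, (h (X i)).ker ↔ ∀ i, h (X i) Y = 0 := by
      simp only [Submodule.mem_iInf, LinearMap.mem_ker]
    obtain ⟨x, hx, hx₀, hxe⟩ := exists_common_eigenvector (H.commute_shapeOperator hZ)
      (H.iInf_ker_ne_bot hX.isPrincipal (by rwa [Fintype.card_fin])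
        fun i => H.apply_self_self_ne_zero hZ (hX.isPrincipal i))
      fun Y y hy => (hmem _).2 fun i => H.apply_shapeOperator_eq_zero hZ ((hmem y).1 hy i) Y
    refine ⟨Fin.cons x X, Fin.cases (H.isPrincipal_of_shapeOperator hZ hx₀ hxe) hX.isPrincipal,
      Fin.cases (Fin.cases (fun hne => (hne rfl).elim) fun j _ => ?_)
        fun i => Fin.cases (fun _ => (hmem x).1 hx i) fun j hij => ?_⟩
    · rw [Fin.cons_zero, Fin.cons_succ, ← H.conj_eq, (hmem x).1 hx, map_zero]
    · exact hX.apply_eq_zero i j fun h => hij (by rw [h])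

end Diagonalization

end IsFlatHermitian

namespace IsPrincipalFamily

variable {ι : Type*} {X : ι → T}

theorem linearIndependent (hX : IsPrincipalFamily h X) (H : IsFlatHermitian B σ h) [Finite ι] :
    LinearIndependent ℂ X := by
  have := Fintype.ofFinite ι
  refine Fintype.linearIndependent_iff.2 fun c hc i => ?_
  have hi := congrArg (h (X i)) hc
  rw [map_sum, map_zero, Finset.sum_eq_single i
    (fun j _ hj => by rw [map_smul, hX.apply_eq_zero i j hj.symm, smul_zero]) (by simp),
    map_smul] at hi
  exact (smul_eq_zero.1 hi).resolve_right (H.self_ne_zero _ (hX.isPrincipal i).1)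

theorem apply_self_apply_self (hX : IsPrincipalFamily h X) (H : IsFlatHermitian B σ h) {i j : ι}
    (hij : i ≠ j) : B (h (X i) (X i)) (h (X j) (X j)) = 0 := by
  rw [H.flat, hX.apply_eq_zero i j hij, map_zero, LinearMap.zero_apply]

variable [Fintype ι] [FiniteDimensional ℂ W]

theorem eq_zero_of_forall_apply_self (hX : IsPrincipalFamily h X) (H : IsFlatHermitian B σ h)
    (hcard : Fintype.card ι = finrank ℂ W) (hne : ∀ i, B (h (X i) (X i)) (h (X i) (X i)) ≠ 0)
    {ξ : W} (hξ : ∀ i, B ξ (h (X i) (X i)) = 0) : ξ = 0 := by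
  have hind : LinearIndependent ℂ fun i => h (X i) (X i) :=
    LinearMap.linearIndependent_of_isOrthoᵢ (B := B)
      (fun i j hij => hX.apply_self_apply_self H hij) hne
  let e := basisOfLinearIndependentOfCardEqFinrank' _ hind hcard
  have hBξ : B ξ = 0 := e.ext fun i => by
    rw [coe_basisOfLinearIndependentOfCardEqFinrank', hξ, LinearMap.zero_apply]
  exact H.nondeg.1 ξ fun η => by rw [hBξ, LinearMap.zero_apply]

/-- Flatness makes `a` diagonal in the principal family, with `a(X_i, X_i)` a multiple of
`h(X_i, X_i)`; pairing with `f` shows that the multiple is zero. -/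
theorem eq_zero_of_flat (hX : IsPrincipalFamily h X) (H : IsFlatHermitian B σ h)
    [FiniteDimensional ℂ T] (hT : Fintype.card ι = finrank ℂ T) (hW : Fintype.card ι = finrank ℂ W)
    (hne : ∀ i, B (h (X i) (X i)) (h (X i) (X i)) ≠ 0) {a : T →ₗ[ℂ] T →ₗ[ℂ] W}
    (ha : ∀ x y, a x y = a y x) (hflat : ∀ x y z z', B (a x y) (h z z') = B (a z' y) (h z x))
    {f : W} (haf : ∀ x y, B (a x y) f = 0) (hhf : ∀ i, B (h (X i) (X i)) f ≠ 0) : a = 0 := by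
  have hperp (i j y) (hij : i ≠ j) : B (a (X i) y) (h (X j) (X j)) = 0 := by
    rw [hflat, hX.apply_eq_zero j i hij.symm, map_zero]
  have hdiag (i) : a (X i) (X i) = 0 := by
    set c := B (a (X i) (X i)) (h (X i) (X i)) / B (h (X i) (X i)) (h (X i) (X i)) with hc
    have hmul : a (X i) (X i) = c • h (X i) (X i) := by
      refine sub_eq_zero.1 (hX.eq_zero_of_forall_apply_self H hW hne fun k => ?_)
      rw [map_sub, map_smul, LinearMap.sub_apply, LinearMap.smul_apply, smul_eq_mul]
      rcases eq_or_ne i k with rfl | hik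
      · rw [hc, div_mul_cancel₀ _ (hne i), sub_self]
      · rw [hperp i k _ hik, hX.apply_self_apply_self H hik, mul_zero, sub_zero]
    have hf := haf (X i) (X i)
    rw [hmul, map_smul, LinearMap.smul_apply] at hf
    rw [hmul, (smul_eq_zero.1 hf).resolve_right (hhf i), zero_smul]
  let e := basisOfLinearIndependentOfCardEqFinrank' _ (hX.linearIndependent H) hT
  refine e.ext fun i => e.ext fun j => ?_
  rw [coe_basisOfLinearIndependentOfCardEqFinrank', LinearMap.zero_apply, LinearMap.zero_apply]
  rcases eq_or_ne i j with rfl | hij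
  · exact hdiag i
  · refine hX.eq_zero_of_forall_apply_self H hW hne fun k => ?_
    rcases eq_or_ne i k with rfl | hik
    · rw [ha, hperp j i _ hij.symm]
    · exact hperp i k _ hik

end IsPrincipalFamily

end FlatHermitian

/-! ### Second fundamental forms of Kaehler type -/

section ComplexModule

open Module

variable {E : Type*} [AddCommGroup E] [Module ℝ E]

/-- The complex vector space structure given by a complex structure `J`. -/
abbrev complexModule (J : E →ₗ[ℝ] E) (hJ : ∀ u, J (J u) = -u) : Module ℂ E where
  smul z u := z.re • u + z.im • J u
  one_smul u := by
    change (1 : ℂ).re • u + (1 : ℂ).im • J u = u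
    simp
  mul_smul z w u := by
    change (z * w).re • u + (z * w).im • J u
      = z.re • (w.re • u + w.im • J u) + z.im • J (w.re • u + w.im • J u)
    simp only [Complex.mul_re, Complex.mul_im, map_add, map_smul, hJ]
    module
  smul_zero z := by
    change z.re • (0 : E) + z.im • J 0 = 0
    simp
  smul_add z u v := by
    change z.re • (u + v) + z.im • J (u + v) = (z.re • u + z.im • J u) + (z.re • v + z.im • J v)
    rw [map_add]
    module
  add_smul z w u := by
    change (z + w).re • u + (z + w).im • J u = (z.re • u + z.im • J u) + (w.re • u + w.im • J u)
    simp only [Complex.add_re, Complex.add_im]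
    module
  zero_smul u := by
    change (0 : ℂ).re • u + (0 : ℂ).im • J u = 0
    simp

section

variable {J : E →ₗ[ℝ] E} (hJ : ∀ u, J (J u) = -u)

theorem complexModule_smul (z : ℂ) (u : E) :
    letI := complexModule J hJ
    z • u = z.re • u + z.im • J u := rfl

theorem complexModule_I_smul (u : E) :
    letI := complexModule J hJ
    Complex.I • u = J u := by
  rw [complexModule_smul hJ, Complex.I_re, Complex.I_im, zero_smul, zero_add, one_smul]

theorem isScalarTower_complexModule :
    letI := complexModule J hJ
    IsScalarTower ℝ ℂ E := by
  let _ := complexModule J hJ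
  refine ⟨fun r z u => ?_⟩
  rw [complexModule_smul hJ, complexModule_smul hJ, Complex.smul_re, Complex.smul_im, smul_add,
    smul_assoc, smul_assoc]

end

section

variable [Module ℂ E]

theorem I_smul_I_smul {E : Type*} [AddCommGroup E] [Module ℂ E] (u : E) :
    Complex.I • Complex.I • u = -u := by
  rw [smul_smul, Complex.I_mul_I, neg_one_smul]

variable [IsScalarTower ℝ ℂ E]

theorem re_smul_add_im_smul (z : ℂ) (u : E) : z.re • u + z.im • Complex.I • u = z • u := by
  rw [← smul_assoc, ← one_smul ℂ u, ← smul_assoc, smul_smul, mul_one, one_smul, ← add_smul,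
    Complex.real_smul, Complex.real_smul, mul_one, Complex.re_add_im]

variable (E) in
theorem finrank_real_eq_two_mul_finrank_complex : finrank ℝ E = 2 * finrank ℂ E := by
  rw [← finrank_mul_finrank ℝ ℂ E, Complex.finrank_real_complex]

end

end ComplexModule

section Complexification

open Module TensorProduct

variable {W : Type*} [AddCommGroup W] [Module ℝ W]

/-- The element `x + i y` of the complexification of `W`. -/
def ofReIm (x y : W) : ℂ ⊗[ℝ] W := 1 ⊗ₜ x + Complex.I ⊗ₜ y

theorem ofReIm_zero : ofReIm (0 : W) 0 = 0 := by
  rw [ofReIm, tmul_zero, tmul_zero, add_zero]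

theorem ofReIm_add (x y x' y' : W) : ofReIm x y + ofReIm x' y' = ofReIm (x + x') (y + y') := by
  rw [ofReIm, ofReIm, ofReIm, tmul_add, tmul_add, add_add_add_comm]

theorem tmul_eq_ofReIm (z : ℂ) (x : W) : z ⊗ₜ[ℝ] x = ofReIm (z.re • x) (z.im • x) := by
  rw [ofReIm, tmul_smul, tmul_smul, smul_tmul', smul_tmul', ← add_tmul, Complex.real_smul,
    Complex.real_smul, mul_one, Complex.re_add_im]

theorem smul_ofReIm (z : ℂ) (x y : W) :
    z • ofReIm x y = ofReIm (z.re • x - z.im • y) (z.re • y + z.im • x) := by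
  rw [ofReIm, smul_add, smul_tmul', smul_tmul', tmul_eq_ofReIm, tmul_eq_ofReIm, ofReIm_add]
  simp only [smul_eq_mul, mul_one, Complex.mul_I_re, Complex.mul_I_im, neg_smul, ← sub_eq_add_neg,
    add_comm]

theorem exists_ofReIm (ξ : ℂ ⊗[ℝ] W) : ∃ x y, ofReIm x y = ξ := by
  induction ξ with
  | zero => exact ⟨0, 0, ofReIm_zero⟩
  | tmul z x => exact ⟨_, _, (tmul_eq_ofReIm z x).symm⟩
  | add ξ η hξ hη =>
    obtain ⟨x, y, rfl⟩ := hξ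
    obtain ⟨x', y', rfl⟩ := hη
    exact ⟨_, _, (ofReIm_add x y x' y').symm⟩

theorem ofReIm_eq_zero_iff {x y : W} : ofReIm x y = 0 ↔ x = 0 ∧ y = 0 := by
  refine ⟨fun h => ?_, fun ⟨hx, hy⟩ => by rw [hx, hy, ofReIm_zero]⟩
  have hcoord (i : Fin 2) :
      (Complex.basisOneI.repr 1 i) • x + (Complex.basisOneI.repr Complex.I i) • y = 0 := by
    simpa only [ofReIm, map_add, map_zero, Finsupp.add_apply, Finsupp.zero_apply,
      equivFinsuppOfBasisLeft_apply_tmul_apply] using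
      DFunLike.congr_fun (congrArg (equivFinsuppOfBasisLeft Complex.basisOneI) h) i
  exact ⟨by simpa using hcoord 0, by simpa using hcoord 1⟩

variable (W) in
/-- Complex conjugation `x + i y ↦ x - i y` of the complexification of `W`. -/
def complexConj : ℂ ⊗[ℝ] W →ₗ⋆[ℂ] ℂ ⊗[ℝ] W where
  __ := Complex.conjAe.toLinearMap.rTensor W
  map_smul' z ξ := by
    induction ξ with
    | zero => simp
    | tmul w x => simp [smul_tmul']
    | add ξ η hξ hη => simp_all

theorem complexConj_ofReIm (x y : W) : complexConj W (ofReIm x y) = ofReIm x (-y) := by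
  simp [complexConj, ofReIm, neg_tmul, tmul_neg]

theorem baseChange_ofReIm (b : LinearMap.BilinForm ℝ W) (x y x' y' : W) :
    b.baseChange ℂ (ofReIm x y) (ofReIm x' y') = ⟨b x x' - b y y', b x y' + b y x'⟩ := by
  simp only [ofReIm, map_add, LinearMap.add_apply, LinearMap.BilinForm.baseChange_tmul]
  apply Complex.ext <;> simp [sub_eq_add_neg, add_comm]

theorem baseChange_comm {b : LinearMap.BilinForm ℝ W} (hb : ∀ x y, b x y = b y x)
    (ξ η : ℂ ⊗[ℝ] W) : b.baseChange ℂ ξ η = b.baseChange ℂ η ξ :=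
  (LinearMap.BilinForm.IsSymm.baseChange ℂ ⟨hb⟩).eq ξ η

theorem baseChange_nondegenerate {b : LinearMap.BilinForm ℝ W} (hs : ∀ x y, b x y = b y x)
    (hb : ∀ x, (∀ y, b x y = 0) → x = 0) : (b.baseChange ℂ).Nondegenerate := by
  have hleft (ξ) (hξ : ∀ η, b.baseChange ℂ ξ η = 0) : ξ = 0 := by
    obtain ⟨x, y, rfl⟩ := exists_ofReIm ξ
    have hw (w) : b x w = 0 ∧ b y w = 0 := by
      simpa only [baseChange_ofReIm, map_zero, sub_zero, zero_add, Complex.ext_iff,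
        Complex.zero_re, Complex.zero_im] using hξ (ofReIm w 0)
    rw [hb x fun w => (hw w).1, hb y fun w => (hw w).2, ofReIm_zero]
  exact ⟨hleft, fun ξ hξ => hleft ξ fun η => by rw [baseChange_comm hs, hξ]⟩

end Complexification

section HermitianPart

open Complex TensorProduct

variable {E W : Type*} [AddCommGroup E] [Module ℝ E] [Module ℂ E] [IsScalarTower ℝ ℂ E]
  [AddCommGroup W] [Module ℝ W]

theorem I_smul_smul (z : ℂ) (u : E) : I • z • u = z.re • I • u - z.im • u := by
  rw [smul_comm, ← re_smul_add_im_smul z, I_smul_I_smul, smul_neg, sub_eq_add_neg]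

/-- The `(1, 1)`-part of a real bilinear form `α`: up to a constant factor, `h(Y, X)` is the value
of the complex bilinear extension of `α` at the `(1, 0)`-part of `X` and the `(0, 1)`-part of
`Y`. -/
def hermitianPart (α : E →ₗ[ℝ] E →ₗ[ℝ] W) : E →ₗ⋆[ℂ] E →ₗ[ℂ] ℂ ⊗[ℝ] W :=
  LinearMap.mk₂'ₛₗ (starRingEnd ℂ) (RingHom.id ℂ)
    (fun Y X => ofReIm (α X Y + α (I • X) (I • Y)) (α X (I • Y) - α (I • X) Y))
    (fun Y Y' X => by
      rw [ofReIm_add]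
      congr 1 <;> simp only [smul_add, map_add] <;> abel)
    (fun z Y X => by
      rw [smul_ofReIm, I_smul_smul, ← re_smul_add_im_smul z Y]
      congr 1 <;> simp only [map_add, map_sub, map_smul, conj_re, conj_im] <;> module)
    (fun Y X X' => by
      rw [ofReIm_add]
      congr 1 <;> simp only [smul_add, map_add, LinearMap.add_apply] <;> abel)
    (fun z Y X => by
      rw [RingHom.id_apply, smul_ofReIm, I_smul_smul, ← re_smul_add_im_smul z X]
      congr 1 <;> simp only [map_add, map_sub, map_smul, LinearMap.add_apply, LinearMap.sub_apply,
        LinearMap.smul_apply] <;> module)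

/-- The `(2, 0)`-part of a real bilinear form `α`: up to a constant factor, the complex bilinear
extension of `α` evaluated at `(1, 0)`-parts. -/
def bilinearPart (α : E →ₗ[ℝ] E →ₗ[ℝ] W) : E →ₗ[ℂ] E →ₗ[ℂ] ℂ ⊗[ℝ] W :=
  LinearMap.mk₂ ℂ
    (fun X Y => ofReIm (α X Y - α (I • X) (I • Y)) (-(α X (I • Y) + α (I • X) Y)))
    (fun X X' Y => by
      rw [ofReIm_add]
      congr 1 <;> simp only [smul_add, map_add, LinearMap.add_apply] <;> abel)
    (fun z X Y => by
      rw [smul_ofReIm, I_smul_smul, ← re_smul_add_im_smul z X]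
      congr 1 <;> simp only [map_add, map_sub, map_smul, LinearMap.add_apply, LinearMap.sub_apply,
        LinearMap.smul_apply] <;> module)
    (fun X Y Y' => by
      rw [ofReIm_add]
      congr 1 <;> simp only [smul_add, map_add] <;> abel)
    (fun z X Y => by
      rw [smul_ofReIm, I_smul_smul, ← re_smul_add_im_smul z Y]
      congr 1 <;> simp only [map_add, map_sub, map_smul] <;> module)

variable {α : E →ₗ[ℝ] E →ₗ[ℝ] W}

theorem hermitianPart_apply (Y X : E) : hermitianPart α Y X =
    ofReIm (α X Y + α (I • X) (I • Y)) (α X (I • Y) - α (I • X) Y) := rfl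

theorem bilinearPart_apply (X Y : E) : bilinearPart α X Y =
    ofReIm (α X Y - α (I • X) (I • Y)) (-(α X (I • Y) + α (I • X) Y)) := rfl

theorem complexConj_hermitianPart (hα : ∀ u v, α u v = α v u) (X Y : E) :
    complexConj W (hermitianPart α Y X) = hermitianPart α X Y := by
  rw [hermitianPart_apply, hermitianPart_apply, complexConj_ofReIm, neg_sub, hα X, hα (I • X),
    hα X, hα (I • X)]

theorem hermitianPart_self (hα : ∀ u v, α u v = α v u) (X : E) :
    hermitianPart α X X = ofReIm (α X X + α (I • X) (I • X)) 0 := by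
  rw [hermitianPart_apply, hα X (I • X), sub_self]

theorem bilinearPart_comm (hα : ∀ u v, α u v = α v u) (X Y : E) :
    bilinearPart α X Y = bilinearPart α Y X := by
  rw [bilinearPart_apply, bilinearPart_apply, hα X, hα (I • X), hα X, hα (I • X),
    add_comm (α (I • Y) X)]

section Flatness

variable {b : LinearMap.BilinForm ℝ W} (hb : ∀ x y, b x y = b y x)
  (hK : ∀ u v w z, b (α u z) (α v w) - b (α u w) (α v z) =
    b (α (I • u) z) (α (I • v) w) - b (α (I • u) w) (α (I • v) z))

include hb hK

theorem hermitianPart_flat (Y X Y' X' : E) :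
    b.baseChange ℂ (hermitianPart α Y X) (hermitianPart α Y' X') =
      b.baseChange ℂ (hermitianPart α Y X') (hermitianPart α Y' X) := by
  have hKI (w z) := hK X (I • X') w z
  simp only [I_smul_I_smul, map_neg, LinearMap.neg_apply] at hKI
  rw [baseChange_comm hb (hermitianPart α Y X')]
  simp only [hermitianPart_apply, baseChange_ofReIm, map_add, map_sub, LinearMap.add_apply,
    LinearMap.sub_apply]
  apply Complex.ext
  · linear_combination hK X X' Y' Y - hK X X' (I • Y') (I • Y) + hKI (I • Y') Y + hKI Y' (I • Y)
  · linear_combination hK X X' (I • Y') Y + hK X X' Y' (I • Y) - hKI Y' Y +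
      hKI (I • Y') (I • Y)

theorem bilinearPart_flat (X Y Y' X' : E) :
    b.baseChange ℂ (bilinearPart α X Y) (hermitianPart α Y' X') =
      b.baseChange ℂ (bilinearPart α X' Y) (hermitianPart α Y' X) := by
  have hKI (w z) := hK X (I • X') w z
  simp only [I_smul_I_smul, map_neg, LinearMap.neg_apply] at hKI
  rw [baseChange_comm hb (bilinearPart α X' Y)]
  simp only [hermitianPart_apply, bilinearPart_apply, baseChange_ofReIm, map_add, map_sub, map_neg,
    LinearMap.add_apply, LinearMap.sub_apply, LinearMap.neg_apply]
  apply Complex.ext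
  · linear_combination hK X X' Y' Y + hK X X' (I • Y') (I • Y) + hKI (I • Y') Y - hKI Y' (I • Y)
  · linear_combination hK X X' (I • Y') Y - hK X X' Y' (I • Y) - hKI Y' Y -
      hKI (I • Y') (I • Y)

end Flatness

end HermitianPart

section KaehlerPoint

open Module Complex TensorProduct

variable {E W : Type*} [AddCommGroup E] [Module ℝ E] [AddCommGroup W] [Module ℝ W]

/-- A symmetric bilinear form `α` on a Hermitian vector space, with values in a Lorentzian vector
space that contains a timelike vector `f` with `⟨α, f⟩ = -g`, such that the algebraic curvature
tensor of `α` given by the Gauss equation is of Kaehler type. -/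
structure KaehlerPoint (J : E →ₗ[ℝ] E) (g : E → E → ℝ) (b : W →ₗ[ℝ] W →ₗ[ℝ] ℝ)
    (α : E →ₗ[ℝ] E →ₗ[ℝ] W) (f : W) : Prop where
  J_J : ∀ u, J (J u) = -u
  g_J : ∀ u v, g (J u) (J v) = g u v
  g_pos : ∀ u, u ≠ 0 → 0 < g u u
  b_symm : ∀ x y, b x y = b y x
  b_nondeg : ∀ x, (∀ y, b x y = 0) → x = 0
  α_symm : ∀ u v, α u v = α v u
  kaehler : ∀ u v w z, b (α u z) (α v w) - b (α u w) (α v z)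
    = b (α u (J z)) (α v (J w)) - b (α u (J w)) (α v (J z))
  α_f : ∀ u v, b (α u v) f = -g u v
  nonneg : ∀ x, b x f = 0 → 0 ≤ b x x

/-- `Z` is regular for `α` if `h(·, Z)` is injective, `h` being the `(1, 1)`-part of `α`. -/
def IsRegular (J : E →ₗ[ℝ] E) (α : E →ₗ[ℝ] E →ₗ[ℝ] W) (Z : E) : Prop :=
  ∀ u, α u Z + α (J u) (J Z) = 0 → α u (J Z) - α (J u) Z = 0 → u = 0

namespace KaehlerPoint

section

variable {J : E →ₗ[ℝ] E} {g : E → E → ℝ} {b : W →ₗ[ℝ] W →ₗ[ℝ] ℝ} {α : E →ₗ[ℝ] E →ₗ[ℝ] W} {f : W}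

theorem kaehler_left (H : KaehlerPoint J g b α f) (u v w z : E) :
    b (α u z) (α v w) - b (α u w) (α v z) =
      b (α (J u) z) (α (J v) w) - b (α (J u) w) (α (J v) z) := by
  have h := H.kaehler w z u v
  simp only [H.α_symm w, H.α_symm z] at h
  linarith [H.b_symm (α u z) (α v w), H.b_symm (α (J u) z) (α (J v) w)]

theorem g_J_left (H : KaehlerPoint J g b α f) (u v : E) : g (J u) v = -g u (J v) := by
  have h := H.α_f (J u) (J (J v))
  rw [H.g_J, H.J_J, map_neg, map_neg, LinearMap.neg_apply, H.α_f] at h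
  linarith

theorem g_J_self (H : KaehlerPoint J g b α f) (u : E) : g u (J u) = 0 := by
  have h := H.α_f (J u) u
  rw [H.α_symm, H.α_f, H.g_J_left] at h
  linarith

theorem apply_add_apply_J_self_pos (H : KaehlerPoint J g b α f) {S : E}
    (hS : b (α S (J S)) (α S (J S)) < b (α S S) (α (J S) (J S))) :
    0 < b (α S S + α (J S) (J S)) (α S S + α (J S) (J S)) := by
  have hsub : 0 ≤ b (α S S - α (J S) (J S)) (α S S - α (J S) (J S)) :=
    H.nonneg _ (by rw [map_sub, LinearMap.sub_apply, H.α_f, H.α_f, H.g_J, sub_self])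
  have hJ : 0 ≤ b (α S (J S)) (α S (J S)) :=
    H.nonneg _ (by rw [H.α_f, H.g_J_self, neg_zero])
  simp only [map_sub, map_add, LinearMap.sub_apply, LinearMap.add_apply] at hsub ⊢
  rw [H.b_symm (α (J S) (J S)) (α S S)] at hsub ⊢
  linarith

end

section ComplexStructure

variable [Module ℂ E] [IsScalarTower ℝ ℂ E] {g : E → E → ℝ} {b : W →ₗ[ℝ] W →ₗ[ℝ] ℝ}
  {α : E →ₗ[ℝ] E →ₗ[ℝ] W} {f : W}

theorem hermitianPart_eq_zero_iff {X Y : E} : hermitianPart α Y X = 0 ↔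
    α X Y + α (I • X) (I • Y) = 0 ∧ α X (I • Y) - α (I • X) Y = 0 :=
  ofReIm_eq_zero_iff

theorem isRegular_iff_injective {Z : E} :
    IsRegular (Algebra.lsmul ℝ ℝ E I) α Z ↔ Function.Injective (hermitianPart α Z) := by
  simp only [injective_iff_map_eq_zero, hermitianPart_eq_zero_iff, and_imp]
  rfl

theorem baseChange_hermitianPart_self (hα : ∀ u v, α u v = α v u) (X Y : E) :
    LinearMap.BilinForm.baseChange ℂ b (hermitianPart α X X) (hermitianPart α Y Y) =
      (b (α X X + α (I • X) (I • X)) (α Y Y + α (I • Y) (I • Y)) : ℝ) := by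
  rw [hermitianPart_self hα, hermitianPart_self hα, baseChange_ofReIm]
  apply Complex.ext <;> simp

section

variable [FiniteDimensional ℝ E] [FiniteDimensional ℝ W] {Z : E}

theorem finrank_complex_eq (hZ : Function.Injective (hermitianPart α Z))
    (hdim : finrank ℝ W ≤ finrank ℂ E) : finrank ℂ E = finrank ℝ W := by
  have := Module.Finite.right ℝ ℂ E
  exact le_antisymm
    ((LinearMap.finrank_le_finrank_of_injective hZ).trans_eq finrank_baseChange) hdim

theorem bijective_hermitianPart (hZ : Function.Injective (hermitianPart α Z))
    (hdim : finrank ℝ W ≤ finrank ℂ E) : Function.Bijective (hermitianPart α Z) := by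
  have := Module.Finite.right ℝ ℂ E
  refine ⟨hZ, (LinearMap.injective_iff_surjective_of_finrank_eq_finrank ?_).1 hZ⟩
  rw [finrank_complex_eq hZ hdim, finrank_baseChange]

end

variable (H : KaehlerPoint (Algebra.lsmul ℝ ℝ E I) g b α f)
include H

theorem baseChange_hermitianPart_self_f_ne_zero {X : E} (hX : X ≠ 0) :
    LinearMap.BilinForm.baseChange ℂ b (hermitianPart α X X) (ofReIm f 0) ≠ 0 := by
  have hf : b (α X X + α (I • X) (I • X)) f = -(2 * g X X) := by
    have hJ : b (α (I • X) (I • X)) f = -g X X := by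
      rw [← H.g_J X]
      exact H.α_f _ _
    rw [map_add, LinearMap.add_apply, H.α_f, hJ, two_mul, neg_add]
  rw [hermitianPart_self H.α_symm, baseChange_ofReIm, hf]
  intro h
  have hre := congrArg Complex.re h
  simp only [map_zero, sub_zero, zero_re] at hre
  linarith [H.g_pos X hX]

theorem baseChange_bilinearPart_f (X Y : E) :
    LinearMap.BilinForm.baseChange ℂ b (bilinearPart α X Y) (ofReIm f 0) = 0 := by
  have hre : b (α (I • X) (I • Y)) f = b (α X Y) f := by
    rw [H.α_f X, ← H.g_J X]
    exact H.α_f _ _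
  have him : b (α (I • X) Y) f = -b (α X (I • Y)) f := by
    rw [H.α_f, H.α_f, neg_inj]
    exact H.g_J_left X Y
  rw [bilinearPart_apply, baseChange_ofReIm]
  apply Complex.ext <;> simp [hre, him]

theorem isFlatHermitian :
    IsFlatHermitian (LinearMap.BilinForm.baseChange ℂ b) (complexConj W) (hermitianPart α) where
  symm := baseChange_comm H.b_symm
  nondeg := baseChange_nondegenerate H.b_symm H.b_nondeg
  conj_eq := complexConj_hermitianPart H.α_symm
  flat := hermitianPart_flat H.b_symm H.kaehler_left
  self_ne_zero X hX h := H.baseChange_hermitianPart_self_f_ne_zero hX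
    (by rw [h, map_zero, LinearMap.zero_apply])

variable [FiniteDimensional ℝ W]

theorem exists_injective_hermitianPart {V : Submodule ℂ E}
    (hdim : finrank ℝ W ≤ finrank ℂ V + 1)
    (hV : ∀ S ∈ V, S ≠ 0 → b (α S (I • S)) (α S (I • S)) < b (α S S) (α (I • S) (I • S))) :
    ∃ Z, Function.Injective (hermitianPart α Z) := by
  refine H.isFlatHermitian.exists_injective (V := V) (fun S hS hS₀ => ?_)
    (by rwa [finrank_baseChange])
  rw [baseChange_hermitianPart_self H.α_symm, ofReal_ne_zero]
  exact (H.apply_add_apply_J_self_pos (hV S hS hS₀)).ne'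

variable [FiniteDimensional ℝ E] {Z : E}

theorem exists_isPrincipalFamily (hZ : Function.Injective (hermitianPart α Z))
    (hdim : finrank ℝ W ≤ finrank ℂ E) :
    ∃ X : Fin (finrank ℝ W) → E, IsPrincipalFamily (hermitianPart α) X := by
  have := Module.Finite.right ℝ ℂ E
  exact H.isFlatHermitian.exists_isPrincipalFamily (bijective_hermitianPart hZ hdim) hdim

theorem bilinearPart_eq_zero (hZ : Function.Injective (hermitianPart α Z))
    (hdim : finrank ℝ W ≤ finrank ℂ E) : bilinearPart α = 0 := by
  have := Module.Finite.right ℝ ℂ E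
  obtain ⟨X, hX⟩ := H.exists_isPrincipalFamily hZ hdim
  exact hX.eq_zero_of_flat H.isFlatHermitian
    (by rw [Fintype.card_fin, finrank_complex_eq hZ hdim])
    (by rw [Fintype.card_fin, finrank_baseChange])
    (fun i => H.isFlatHermitian.apply_self_self_ne_zero (bijective_hermitianPart hZ hdim)
      (hX.isPrincipal i))
    (bilinearPart_comm H.α_symm)
    (fun X Y Y' X' => bilinearPart_flat H.b_symm H.kaehler_left X Y Y' X')
    (H.baseChange_bilinearPart_f)
    (fun i => H.baseChange_hermitianPart_self_f_ne_zero (hX.isPrincipal i).1)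

end ComplexStructure

end KaehlerPoint

theorem exists_eq_lsmul_I {J : E →ₗ[ℝ] E} (hJ : ∀ u, J (J u) = -u) :
    ∃ (_ : Module ℂ E) (_ : IsScalarTower ℝ ℂ E), J = Algebra.lsmul ℝ ℝ E I :=
  ⟨complexModule J hJ, isScalarTower_complexModule hJ,
    LinearMap.ext fun u => (complexModule_I_smul hJ u).symm⟩

theorem exists_forall_eq_smul_add_smul [FiniteDimensional ℝ E] {J : E →ₗ[ℝ] E}
    (hJ : ∀ u, J (J u) = -u) (hE : finrank ℝ E ≤ 3) :
    ∃ Z, ∀ u, ∃ s t : ℝ, u = s • Z + t • J Z := by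
  obtain ⟨_, _, rfl⟩ := exists_eq_lsmul_I hJ
  have := FiniteDimensional.right ℝ ℂ E
  have hE' := finrank_real_eq_two_mul_finrank_complex E
  obtain ⟨Z, hZ⟩ := (finrank_le_one_iff (K := ℂ) (V := E)).1 (by lia)
  refine ⟨Z, fun u => ?_⟩
  obtain ⟨c, rfl⟩ := hZ u
  exact ⟨c.re, c.im, (re_smul_add_im_smul c Z).symm⟩

namespace KaehlerPoint

variable {J : E →ₗ[ℝ] E} {g : E → E → ℝ} {b : W →ₗ[ℝ] W →ₗ[ℝ] ℝ} {α : E →ₗ[ℝ] E →ₗ[ℝ] W} {f : W}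
  [FiniteDimensional ℝ W]

theorem exists_isRegular (H : KaehlerPoint J g b α f) {V : Submodule ℝ E}
    (hVJ : ∀ S ∈ V, J S ∈ V) (hdim : 2 * finrank ℝ W ≤ finrank ℝ V + 2)
    (hV : ∀ S ∈ V, S ≠ 0 → b (α S (J S)) (α S (J S)) < b (α S S) (α (J S) (J S))) :
    ∃ Z, IsRegular J α Z := by
  obtain ⟨_, _, rfl⟩ := exists_eq_lsmul_I H.J_J
  let Vc : Submodule ℂ E :=
    { V with
      smul_mem' z u hu := by
        rw [← re_smul_add_im_smul]
        exact V.add_mem (V.smul_mem _ hu) (V.smul_mem _ (hVJ u hu)) }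
  have hVc : finrank ℝ V = 2 * finrank ℂ Vc := finrank_real_eq_two_mul_finrank_complex Vc
  obtain ⟨Z, hZ⟩ := H.exists_injective_hermitianPart (V := Vc) (by lia) hV
  exact ⟨Z, isRegular_iff_injective.2 hZ⟩

variable [FiniteDimensional ℝ E] {Z : E}

theorem finrank_eq_of_isRegular (H : KaehlerPoint J g b α f) (hZ : IsRegular J α Z)
    (hdim : 2 * finrank ℝ W ≤ finrank ℝ E) : finrank ℝ E = 2 * finrank ℝ W := by
  obtain ⟨_, _, rfl⟩ := exists_eq_lsmul_I H.J_J
  have hE := finrank_real_eq_two_mul_finrank_complex E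
  have := finrank_complex_eq (isRegular_iff_injective.1 hZ) (by lia)
  lia

theorem apply_J_J_of_isRegular (H : KaehlerPoint J g b α f) (hZ : IsRegular J α Z)
    (hdim : 2 * finrank ℝ W ≤ finrank ℝ E) (u v : E) : α (J u) (J v) = α u v := by
  obtain ⟨_, _, rfl⟩ := exists_eq_lsmul_I H.J_J
  have hE := finrank_real_eq_two_mul_finrank_complex E
  have h := congr($(H.bilinearPart_eq_zero (isRegular_iff_injective.1 hZ) (by lia)) u v)
  exact (sub_eq_zero.1 (ofReIm_eq_zero_iff.1 h).1).symm

theorem exists_diagonal (H : KaehlerPoint J g b α f) (hZ : IsRegular J α Z)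
    (hdim : 2 * finrank ℝ W ≤ finrank ℝ E) :
    ∃ X : Fin (finrank ℝ W) → E, (∀ i, X i ≠ 0) ∧
      (∀ i j, i ≠ j → α (X i) (X j) = 0 ∧ α (X i) (J (X j)) = 0) ∧
      (∀ i j, i ≠ j → b (α (X i) (X i)) (α (X j) (X j)) = 0) ∧
      ∀ i, b (α (X i) (X i)) (α (X i) (X i)) ≠ 0 := by
  have hαJ := H.apply_J_J_of_isRegular hZ hdim
  obtain ⟨_, _, rfl⟩ := exists_eq_lsmul_I H.J_J
  have hαI (u v : E) : α (I • u) (I • v) = α u v := hαJ u v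
  have hE := finrank_real_eq_two_mul_finrank_complex E
  rw [isRegular_iff_injective] at hZ
  obtain ⟨X, hX⟩ := H.exists_isPrincipalFamily hZ (by lia)
  have hform (i j) : LinearMap.BilinForm.baseChange ℂ b (hermitianPart α (X i) (X i))
      (hermitianPart α (X j) (X j)) = (4 * b (α (X i) (X i)) (α (X j) (X j)) : ℝ) := by
    rw [baseChange_hermitianPart_self H.α_symm, hαI, hαI, ← two_smul ℝ, ← two_smul ℝ, map_smul,
      map_smul, LinearMap.smul_apply, smul_smul, smul_eq_mul]
    norm_num
  refine ⟨X, fun i => (hX.isPrincipal i).1, fun i j hij => ?_, fun i j hij => ?_, fun i h => ?_⟩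
  · obtain ⟨hre, him⟩ := hermitianPart_eq_zero_iff.1 (hX.apply_eq_zero j i hij.symm)
    have him' : α (I • X i) (X j) = -α (X i) (I • X j) := by
      rw [← hαI (I • X i), I_smul_I_smul, map_neg, LinearMap.neg_apply]
    rw [hαI, ← two_smul ℝ] at hre
    rw [him', sub_neg_eq_add, ← two_smul ℝ] at him
    exact ⟨(smul_eq_zero.1 hre).resolve_left two_ne_zero,
      (smul_eq_zero.1 him).resolve_left two_ne_zero⟩
  · have h := hX.apply_self_apply_self H.isFlatHermitian hij
    rw [hform, ofReal_eq_zero] at h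
    linarith
  · refine H.isFlatHermitian.apply_self_self_ne_zero (bijective_hermitianPart hZ (by lia))
      (hX.isPrincipal i) ?_
    rw [hform, h, mul_zero, ofReal_zero]

end KaehlerPoint

end KaehlerPoint

/-! ### Immersions into an inner product space of arbitrary signature -/

section LocalImmersion

open Module Filter Topology

section FDeriv

variable {X G₁ G₂ G₃ : Type*} [NormedAddCommGroup X] [NormedSpace ℝ X]
  [NormedAddCommGroup G₁] [NormedSpace ℝ G₁] [NormedAddCommGroup G₂] [NormedSpace ℝ G₂]
  [NormedAddCommGroup G₃] [NormedSpace ℝ G₃]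

theorem fderiv_comp_clm_apply {c : X → G₂ →L[ℝ] G₃} {d : X → G₁ →L[ℝ] G₂} {y : X}
    (hc : DifferentiableAt ℝ c y) (hd : DifferentiableAt ℝ d y) (u : X) :
    fderiv ℝ (fun z => (c z).comp (d z)) y u =
      (c y).comp (fderiv ℝ d y u) + (fderiv ℝ c y u).comp (d y) := by
  rw [fderiv_clm_comp hc hd]
  rfl

theorem hasFDerivAt_clm_apply_const {T : X → G₁ →L[ℝ] G₂} {y : X} (hT : DifferentiableAt ℝ T y)
    (x : G₁) : HasFDerivAt (fun z => T z x) ((fderiv ℝ T y).flip x) y :=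
  (hT.hasFDerivAt.clm_apply (hasFDerivAt_const x y)).congr_fderiv (by ext; simp)

end FDeriv

variable {E L : Type*} [NormedAddCommGroup E] [NormedSpace ℝ E]
  [NormedAddCommGroup L] [NormedSpace ℝ L]

/-- The map `w ↦ ⟨w, A ·⟩`. -/
def dualMap (β : L →L[ℝ] L →L[ℝ] ℝ) (A : E →L[ℝ] L) : L →L[ℝ] (E →L[ℝ] ℝ) :=
  ((ContinuousLinearMap.compL ℝ E L ℝ).flip A).comp β

/-- The map `L → E` that inverts `A` on its range and vanishes on the orthogonal complement of the
range, if the form induced by `A` is nondegenerate. -/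
def tangentPart (β : L →L[ℝ] L →L[ℝ] ℝ) (A : E →L[ℝ] L) : L →L[ℝ] E :=
  ((dualMap β A).comp A).inverse.comp (dualMap β A)

/-- `F` is an immersion of `U` with positive definite induced metric. -/
structure LocalImmersion (β : L →L[ℝ] L →L[ℝ] ℝ) (U : Set E) (F : E → L) : Prop where
  isOpen : IsOpen U
  symm : ∀ x y, β x y = β y x
  smooth : ContDiffOn ℝ ∞ F U
  pos : ∀ y ∈ U, ∀ u, u ≠ 0 → 0 < β (fderiv ℝ F y u) (fderiv ℝ F y u)

variable (β : L →L[ℝ] L →L[ℝ] ℝ) (F : E → L)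

/-- The inverse of the differential of `F` on tangent vectors, zero on normal vectors. -/
def tangentCoord (y : E) : L →L[ℝ] E := tangentPart β (fderiv ℝ F y)

/-- The orthogonal projection onto the tangent space. -/
def tangentProj (y : E) : L →L[ℝ] L := (fderiv ℝ F y).comp (tangentCoord β F y)

/-- The Christoffel tensor `v ↦ Γ(u, v)` of the metric induced by `F`. -/
def leviCivita (y u : E) : E →L[ℝ] E := (tangentCoord β F y).comp (fderiv ℝ (fderiv ℝ F) y u)

/-- The derivative of the tangent projection. -/
def dTangentProj (y : E) : E →L[ℝ] L →L[ℝ] L := fderiv ℝ (tangentProj β F) y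

/-- The skew-adjoint endomorphism of the ambient space which is the second fundamental form on
tangent vectors and minus the shape operator on normal vectors. -/
def skewSff (y u : E) : L →L[ℝ] L := dTangentProj β F y u * (2 * tangentProj β F y - 1)

/-- The second fundamental form, written as the derivative of the tangent projection applied to
tangent vectors. -/
def sff (y u v : E) : L := dTangentProj β F y u (fderiv ℝ F y v)

variable {β F} {U : Set E}

section Gram

variable [FiniteDimensional ℝ E] {A : E →L[ℝ] L}

theorem isInvertible_dualMap_comp (hA : ∀ u, u ≠ 0 → 0 < β (A u) (A u)) :
    ((dualMap β A).comp A).IsInvertible := by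
  have hinj : Function.Injective ((dualMap β A).comp A : E →ₗ[ℝ] (E →L[ℝ] ℝ)) := by
    refine (injective_iff_map_eq_zero _).2 fun u hu => by_contra fun hu₀ => (hA u hu₀).ne' ?_
    exact congr($hu u)
  have hdim : finrank ℝ E = finrank ℝ (E →L[ℝ] ℝ) := by
    rw [← (LinearMap.toContinuousLinearMap (𝕜 := ℝ) (E := E) (F' := ℝ)).finrank_eq]
    exact Subspace.dual_finrank_eq.symm
  exact ⟨(LinearEquiv.ofInjectiveOfFinrankEq _ hinj hdim).toContinuousLinearEquiv, rfl⟩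

theorem tangentPart_comp (hA : ∀ u, u ≠ 0 → 0 < β (A u) (A u)) :
    (tangentPart β A).comp A = .id ℝ E := by
  rw [tangentPart, ContinuousLinearMap.comp_assoc,
    (isInvertible_dualMap_comp hA).inverse_comp_self]

theorem beta_tangentPart (hA : ∀ u, u ≠ 0 → 0 < β (A u) (A u)) (w : L) (u : E) :
    β (A (tangentPart β A w)) (A u) = β w (A u) :=
  congr($((isInvertible_dualMap_comp hA).self_comp_inverse) (dualMap β A w) u)

end Gram

namespace LocalImmersion

variable {y : E}

section

variable {G : Type*} [NormedAddCommGroup G] [NormedSpace ℝ G] {φ ψ : E → G}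

theorem contDiffOn_fderiv (H : LocalImmersion β U F) : ContDiffOn ℝ ∞ (fderiv ℝ F) U :=
  H.smooth.fderiv_of_isOpen H.isOpen (by simp)

theorem differentiableAt (H : LocalImmersion β U F) (hφ : ContDiffOn ℝ ∞ φ U) (hy : y ∈ U) :
    DifferentiableAt ℝ φ y :=
  (hφ.contDiffAt (H.isOpen.mem_nhds hy)).differentiableAt (by simp)

theorem fderiv_fderiv_comm (H : LocalImmersion β U F) (hφ : ContDiffOn ℝ ∞ φ U) (hy : y ∈ U)
    (u v : E) : fderiv ℝ (fderiv ℝ φ) y u v = fderiv ℝ (fderiv ℝ φ) y v u := by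
  refine (hφ.contDiffAt (H.isOpen.mem_nhds hy)).isSymmSndFDerivAt ?_ u v
  rw [minSmoothness_of_isRCLikeNormedField]
  exact ENat.LEInfty.out

theorem fderiv_congr (H : LocalImmersion β U F) (h : ∀ z ∈ U, φ z = ψ z) (hy : y ∈ U) :
    fderiv ℝ φ y = fderiv ℝ ψ y :=
  (eventuallyEq_of_mem (H.isOpen.mem_nhds hy) h).fderiv_eq

end

theorem leviCivita_comm (H : LocalImmersion β U F) (hy : y ∈ U) (u v : E) :
    leviCivita β F y u v = leviCivita β F y v u :=
  congrArg (tangentCoord β F y) (H.fderiv_fderiv_comm H.smooth hy u v)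

variable [FiniteDimensional ℝ E]

theorem contDiffOn_tangentCoord (H : LocalImmersion β U F) :
    ContDiffOn ℝ ∞ (tangentCoord β F) U := by
  intro y hy
  refine ContDiffAt.contDiffWithinAt ?_
  have hA : ContDiffAt ℝ ∞ (fderiv ℝ F) y := H.contDiffOn_fderiv.contDiffAt (H.isOpen.mem_nhds hy)
  have hdual : ContDiffAt ℝ ∞ (fun z => dualMap β (fderiv ℝ F z)) y := by
    unfold dualMap
    fun_prop
  have hgram : ContDiffAt ℝ ∞ (fun z => (dualMap β (fderiv ℝ F z)).comp (fderiv ℝ F z)) y :=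
    hdual.clm_comp hA
  exact ((isInvertible_dualMap_comp (H.pos y hy)).contDiffAt_map_inverse.comp y hgram).clm_comp
    hdual

theorem contDiffOn_tangentProj (H : LocalImmersion β U F) : ContDiffOn ℝ ∞ (tangentProj β F) U :=
  H.contDiffOn_fderiv.clm_comp H.contDiffOn_tangentCoord

theorem contDiffOn_dTangentProj (H : LocalImmersion β U F) :
    ContDiffOn ℝ ∞ (dTangentProj β F) U :=
  H.contDiffOn_tangentProj.fderiv_of_isOpen H.isOpen (by simp)

theorem tangentCoord_comp (H : LocalImmersion β U F) (hy : y ∈ U) :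
    (tangentCoord β F y).comp (fderiv ℝ F y) = .id ℝ E :=
  tangentPart_comp (H.pos y hy)

theorem tangentCoord_apply (H : LocalImmersion β U F) (hy : y ∈ U) (u : E) :
    tangentCoord β F y (fderiv ℝ F y u) = u :=
  congr($(H.tangentCoord_comp hy) u)

theorem tangentProj_comp (H : LocalImmersion β U F) (hy : y ∈ U) :
    (tangentProj β F y).comp (fderiv ℝ F y) = fderiv ℝ F y := by
  rw [tangentProj, ContinuousLinearMap.comp_assoc, H.tangentCoord_comp hy,
    ContinuousLinearMap.comp_id]

theorem tangentProj_apply (H : LocalImmersion β U F) (hy : y ∈ U) (u : E) :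
    tangentProj β F y (fderiv ℝ F y u) = fderiv ℝ F y u :=
  congr($(H.tangentProj_comp hy) u)

theorem tangentCoord_tangentProj (H : LocalImmersion β U F) (hy : y ∈ U) :
    (tangentCoord β F y).comp (tangentProj β F y) = tangentCoord β F y := by
  rw [tangentProj, ← ContinuousLinearMap.comp_assoc, H.tangentCoord_comp hy,
    ContinuousLinearMap.id_comp]

theorem tangentProj_mul_tangentProj (H : LocalImmersion β U F) (hy : y ∈ U) :
    tangentProj β F y * tangentProj β F y = tangentProj β F y :=
  ContinuousLinearMap.ext fun x => H.tangentProj_apply hy (tangentCoord β F y x)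

theorem beta_tangentProj (H : LocalImmersion β U F) (hy : y ∈ U) (x z : L) :
    β (tangentProj β F y x) z = β x (tangentProj β F y z) := by
  have h (x z) : β (tangentProj β F y x) (tangentProj β F y z) = β x (tangentProj β F y z) :=
    beta_tangentPart (H.pos y hy) x (tangentCoord β F y z)
  rw [← h x z, H.symm _ (tangentProj β F y z), h z x, H.symm]

theorem dTangentProj_eq (H : LocalImmersion β U F) (hy : y ∈ U) (u : E) :
    dTangentProj β F y u =
      tangentProj β F y * dTangentProj β F y u + dTangentProj β F y u * tangentProj β F y := by
  have hπ := H.differentiableAt H.contDiffOn_tangentProj hy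
  exact congr($(H.fderiv_congr (fun z hz => (H.tangentProj_mul_tangentProj hz).symm) hy) u).trans
    (fderiv_comp_clm_apply hπ hπ u)

theorem tangentProj_dTangentProj_tangentProj (H : LocalImmersion β U F) (hy : y ∈ U) (u : E) :
    tangentProj β F y * dTangentProj β F y u * tangentProj β F y = 0 := by
  have hidem := H.tangentProj_mul_tangentProj hy
  linear_combination (norm := noncomm_ring)
    -(tangentProj β F y * H.dTangentProj_eq hy u * tangentProj β F y)
      - hidem * dTangentProj β F y u * tangentProj β F y
      - tangentProj β F y * dTangentProj β F y u * hidem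

theorem dTangentProj_anticomm (H : LocalImmersion β U F) (hy : y ∈ U) (u : E) :
    (2 * tangentProj β F y - 1) * dTangentProj β F y u =
      -(dTangentProj β F y u * (2 * tangentProj β F y - 1)) := by
  linear_combination (norm := noncomm_ring) (-2) * H.dTangentProj_eq hy u

theorem skewSff_comp (H : LocalImmersion β U F) (hy : y ∈ U) (u : E) :
    (skewSff β F y u).comp (fderiv ℝ F y) = (dTangentProj β F y u).comp (fderiv ℝ F y) := by
  have hrefl : (2 * tangentProj β F y - 1).comp (fderiv ℝ F y) = fderiv ℝ F y := by
    rw [two_mul, ContinuousLinearMap.sub_comp, ContinuousLinearMap.add_comp,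
      H.tangentProj_comp hy, add_sub_assoc]
    exact add_eq_left.2 (sub_self _)
  exact congrArg (dTangentProj β F y u).comp hrefl

theorem fderiv_fderiv_eq (H : LocalImmersion β U F) (hy : y ∈ U) (u : E) :
    fderiv ℝ (fderiv ℝ F) y u =
      (fderiv ℝ F y).comp (leviCivita β F y u) + (skewSff β F y u).comp (fderiv ℝ F y) := by
  rw [H.skewSff_comp hy]
  exact congr($(H.fderiv_congr (fun z hz => (H.tangentProj_comp hz).symm) hy) u).trans
    (fderiv_comp_clm_apply (H.differentiableAt H.contDiffOn_tangentProj hy)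
      (H.differentiableAt H.contDiffOn_fderiv hy) u)

theorem skewSff_apply (H : LocalImmersion β U F) (hy : y ∈ U) (u v : E) :
    skewSff β F y u (fderiv ℝ F y v) = sff β F y u v :=
  congr($(H.skewSff_comp hy u) v)

theorem fderiv_fderiv_apply (H : LocalImmersion β U F) (hy : y ∈ U) (u v : E) :
    fderiv ℝ (fderiv ℝ F) y u v = fderiv ℝ F y (leviCivita β F y u v) + sff β F y u v := by
  rw [H.fderiv_fderiv_eq hy, ← H.skewSff_apply hy]
  rfl

theorem tangentCoord_skewSff (H : LocalImmersion β U F) (hy : y ∈ U) (u : E) :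
    (tangentCoord β F y).comp (skewSff β F y u) =
      -(tangentCoord β F y).comp (dTangentProj β F y u) := by
  have hproj :
      tangentProj β F y * skewSff β F y u = -(tangentProj β F y * dTangentProj β F y u) := by
    unfold skewSff
    linear_combination (norm := noncomm_ring) 2 * H.tangentProj_dTangentProj_tangentProj hy u
  have habs (T : L →L[ℝ] L) :
      (tangentCoord β F y).comp (tangentProj β F y * T) = (tangentCoord β F y).comp T :=
    congrArg (fun S : L →L[ℝ] E => S.comp T) (H.tangentCoord_tangentProj hy)
  rw [← habs (skewSff β F y u), hproj, ContinuousLinearMap.comp_neg, habs]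

theorem fderiv_tangentCoord (H : LocalImmersion β U F) (hy : y ∈ U) (u : E) :
    fderiv ℝ (tangentCoord β F) y u =
      -(leviCivita β F y u).comp (tangentCoord β F y) -
        (tangentCoord β F y).comp (skewSff β F y u) := by
  have hρ := H.differentiableAt H.contDiffOn_tangentCoord hy
  have hid : leviCivita β F y u + (fderiv ℝ (tangentCoord β F) y u).comp (fderiv ℝ F y) = 0 := by
    refine (fderiv_comp_clm_apply hρ (H.differentiableAt H.contDiffOn_fderiv hy) u).symm.trans ?_
    rw [H.fderiv_congr (fun z hz => H.tangentCoord_comp hz) hy, fderiv_fun_const]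
    rfl
  have habs : fderiv ℝ (tangentCoord β F) y u =
      (tangentCoord β F y).comp (dTangentProj β F y u) +
        (fderiv ℝ (tangentCoord β F) y u).comp (tangentProj β F y) :=
    congr($(H.fderiv_congr (fun z hz => (H.tangentCoord_tangentProj hz).symm) hy) u).trans
      (fderiv_comp_clm_apply hρ (H.differentiableAt H.contDiffOn_tangentProj hy) u)
  rw [habs, H.tangentCoord_skewSff hy, tangentProj, ← ContinuousLinearMap.comp_assoc,
    (neg_eq_of_add_eq_zero_right hid).symm, ContinuousLinearMap.neg_comp, sub_neg_eq_add, add_comm]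

theorem sff_comm (H : LocalImmersion β U F) (hy : y ∈ U) (u v : E) :
    sff β F y u v = sff β F y v u := by
  have h := H.fderiv_fderiv_comm H.smooth hy u v
  rw [H.fderiv_fderiv_apply hy, H.fderiv_fderiv_apply hy, H.leviCivita_comm hy u v] at h
  exact add_left_cancel h

theorem beta_dTangentProj (H : LocalImmersion β U F) (hy : y ∈ U) (u : E) (x z : L) :
    β (dTangentProj β F y u x) z = β x (dTangentProj β F y u z) := by
  have hπ (x) : HasFDerivAt (fun w => tangentProj β F w x) ((dTangentProj β F y).flip x) y :=
    hasFDerivAt_clm_apply_const (H.differentiableAt H.contDiffOn_tangentProj hy) x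
  have hleft := ((β.flip z).hasFDerivAt.comp y (hπ x)).fderiv
  have hright := ((β x).hasFDerivAt.comp y (hπ z)).fderiv
  exact congr($(hleft.symm.trans ((H.fderiv_congr (fun w hw => H.beta_tangentProj hw x z) hy).trans
    hright)) u)

theorem tangentProj_sff (H : LocalImmersion β U F) (hy : y ∈ U) (u v : E) :
    tangentProj β F y (sff β F y u v) = 0 := by
  rw [sff, ← H.tangentProj_apply hy v]
  exact congr($(H.tangentProj_dTangentProj_tangentProj hy u) (fderiv ℝ F y v))

theorem beta_sff (H : LocalImmersion β U F) (hy : y ∈ U) (u v w : E) :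
    β (sff β F y u v) (fderiv ℝ F y w) = 0 := by
  rw [← H.tangentProj_apply hy w, ← H.beta_tangentProj hy, H.tangentProj_sff hy, map_zero,
    zero_apply]

end LocalImmersion

end LocalImmersion

section LocalKaehler

open Module Filter Topology

variable {E L : Type*} [NormedAddCommGroup E] [NormedSpace ℝ E]
  [NormedAddCommGroup L] [NormedSpace ℝ L]
  {β : L →L[ℝ] L →L[ℝ] ℝ} {F : E → L} {U : Set E} {J : E → E →L[ℝ] E} {y : E}

/-- `F` is an immersion of `U` whose induced metric is Kaehler with complex structure `J`. -/
structure LocalKaehler (β : L →L[ℝ] L →L[ℝ] ℝ) (U : Set E) (F : E → L) (J : E → E →L[ℝ] E) : Prop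
    extends LocalImmersion β U F where
  nondeg : ∀ x, (∀ z, β x z = 0) → x = 0
  smooth_J : ContDiffOn ℝ ∞ J U
  J_J : ∀ y ∈ U, ∀ u, J y (J y u) = -u
  orth : ∀ y ∈ U, ∀ u v,
    β (fderiv ℝ F y (J y u)) (fderiv ℝ F y (J y v)) = β (fderiv ℝ F y u) (fderiv ℝ F y v)
  parallel : ∀ y ∈ U, ∀ u,
    fderiv ℝ J y u = (J y).comp (leviCivita β F y u) - (leviCivita β F y u).comp (J y)

/-- The complex structure on the tangent space, extended by zero to the normal space. -/
def ambientJ (β : L →L[ℝ] L →L[ℝ] ℝ) (F : E → L) (J : E → E →L[ℝ] E) (y : E) : L →L[ℝ] L :=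
  (fderiv ℝ F y).comp ((J y).comp (tangentCoord β F y))

/-- The covariant derivative of the second fundamental form. It is an endomorphism of the ambient
space; its values on tangent vectors are those of the usual tensor `(∇_u α)(v, ·)`. -/
def covSff (β : L →L[ℝ] L →L[ℝ] ℝ) (F : E → L) (y u v : E) : L →L[ℝ] L :=
  fderiv ℝ (dTangentProj β F) y u v -
    (skewSff β F y u * dTangentProj β F y v - dTangentProj β F y v * skewSff β F y u) -
    dTangentProj β F y (leviCivita β F y u v)

theorem clm_mul_apply (S T : L →L[ℝ] L) (x : L) : (S * T) x = S (T x) := rfl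

namespace LocalImmersion

variable [FiniteDimensional ℝ E]

theorem contDiffOn_skewSff (H : LocalImmersion β U F) (v : E) :
    ContDiffOn ℝ ∞ (fun z => skewSff β F z v) U := by
  have hB := H.contDiffOn_dTangentProj
  have hπ := H.contDiffOn_tangentProj
  unfold skewSff
  fun_prop

theorem reflection_mul_self (H : LocalImmersion β U F) (hy : y ∈ U) :
    (2 * tangentProj β F y - 1) * (2 * tangentProj β F y - 1) = 1 := by
  linear_combination (norm := noncomm_ring) 4 * H.tangentProj_mul_tangentProj hy

theorem skewSff_mul_skewSff (H : LocalImmersion β U F) (hy : y ∈ U) (u v : E) :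
    skewSff β F y u * skewSff β F y v = -(dTangentProj β F y u * dTangentProj β F y v) := by
  rw [skewSff, skewSff, mul_assoc, ← mul_assoc (2 * tangentProj β F y - 1),
    H.dTangentProj_anticomm hy, neg_mul, mul_assoc, H.reflection_mul_self hy, mul_one, mul_neg]

theorem fderiv_dTangentProj_comm (H : LocalImmersion β U F) (hy : y ∈ U) (u v : E) :
    fderiv ℝ (dTangentProj β F) y u v = fderiv ℝ (dTangentProj β F) y v u :=
  H.fderiv_fderiv_comm H.contDiffOn_tangentProj hy u v

theorem hasFDerivAt_dTangentProj_apply (H : LocalImmersion β U F) (hy : y ∈ U) (v : E) :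
    HasFDerivAt (fun z => dTangentProj β F z v) ((fderiv ℝ (dTangentProj β F) y).flip v) y :=
  hasFDerivAt_clm_apply_const (H.differentiableAt H.contDiffOn_dTangentProj hy) v

theorem fderiv_skewSff (H : LocalImmersion β U F) (hy : y ∈ U) (u v : E) :
    fderiv ℝ (fun z => skewSff β F z v) y u =
      dTangentProj β F y v * (2 * dTangentProj β F y u) +
        fderiv ℝ (dTangentProj β F) y u v * (2 * tangentProj β F y - 1) := by
  have hB := H.hasFDerivAt_dTangentProj_apply hy v
  have hrefl : HasFDerivAt (fun z => 2 * tangentProj β F z - 1)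
      ((2 : ℝ) • dTangentProj β F y) y := by
    have hπ := (H.differentiableAt H.contDiffOn_tangentProj hy).hasFDerivAt
    refine ((hπ.const_smul (2 : ℝ)).sub_const (1 : L →L[ℝ] L)).congr_of_eventuallyEq
      (Eventually.of_forall fun z => ?_)
    simp only [two_mul, two_smul, Pi.smul_apply]
  have hprod := fderiv_comp_clm_apply hB.differentiableAt hrefl.differentiableAt u
  rw [hB.fderiv, hrefl.fderiv, smul_apply, two_smul, ← two_mul] at hprod
  exact hprod

/-- Differentiating `dπ(v) = π dπ(v) + dπ(v) π`. -/
theorem fderiv_dTangentProj_eq (H : LocalImmersion β U F) (hy : y ∈ U) (u v : E) :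
    fderiv ℝ (dTangentProj β F) y u v =
      tangentProj β F y * fderiv ℝ (dTangentProj β F) y u v +
        dTangentProj β F y u * dTangentProj β F y v +
      (dTangentProj β F y v * dTangentProj β F y u +
        fderiv ℝ (dTangentProj β F) y u v * tangentProj β F y) := by
  have hB := H.hasFDerivAt_dTangentProj_apply hy v
  have hπ := H.differentiableAt H.contDiffOn_tangentProj hy
  have hderiv := H.fderiv_congr (fun w hw => H.dTangentProj_eq hw v) hy
  rw [fderiv_fun_add (hπ.fun_mul hB.differentiableAt) (hB.differentiableAt.fun_mul hπ),
    hB.fderiv] at hderiv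
  have hleft := fderiv_comp_clm_apply hπ hB.differentiableAt u
  have hright := fderiv_comp_clm_apply hB.differentiableAt hπ u
  rw [hB.fderiv] at hleft hright
  exact congr($hderiv u).trans congr($hleft + $hright)

theorem beta_fderiv_dTangentProj (H : LocalImmersion β U F) (hy : y ∈ U) (u v : E) (x z : L) :
    β (fderiv ℝ (dTangentProj β F) y u v x) z = β x (fderiv ℝ (dTangentProj β F) y u v z) := by
  have hB (x) : HasFDerivAt (fun w => dTangentProj β F w v x)
      (((fderiv ℝ (dTangentProj β F) y).flip v).flip x) y := by
    have h := H.hasFDerivAt_dTangentProj_apply hy v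
    exact h.fderiv ▸ hasFDerivAt_clm_apply_const h.differentiableAt x
  have hleft := ((β.flip z).hasFDerivAt.comp y (hB x)).fderiv
  have hright := ((β x).hasFDerivAt.comp y (hB z)).fderiv
  exact congr($(hleft.symm.trans ((H.fderiv_congr
    (fun w hw => H.beta_dTangentProj hw v x z) hy).trans hright)) u)

theorem beta_skewSff (H : LocalImmersion β U F) (hy : y ∈ U) (u : E) (x z : L) :
    β (skewSff β F y u x) z = -β x (skewSff β F y u z) := by
  have hrefl (x z) : β ((2 * tangentProj β F y - 1) x) z =
      β x ((2 * tangentProj β F y - 1) z) := by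
    simp only [two_mul, sub_apply, add_apply, map_sub, map_add, H.beta_tangentProj hy,
      one_apply_eq_self]
  have hanti : skewSff β F y u z = -((2 * tangentProj β F y - 1) (dTangentProj β F y u z)) := by
    rw [skewSff, ← neg_eq_iff_eq_neg, ← neg_apply, ← H.dTangentProj_anticomm hy, clm_mul_apply]
  rw [hanti, map_neg, neg_neg, ← hrefl, ← H.beta_dTangentProj hy, skewSff, clm_mul_apply]

theorem fderiv_sff (H : LocalImmersion β U F) (hy : y ∈ U) {φ ψ : E → E}
    (hφ : DifferentiableAt ℝ φ y) (hψ : DifferentiableAt ℝ ψ y) (u : E) :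
    fderiv ℝ (fun z => sff β F z (φ z) (ψ z)) y u =
      covSff β F y u (φ y) (fderiv ℝ F y (ψ y)) + skewSff β F y u (sff β F y (φ y) (ψ y)) +
        sff β F y (fderiv ℝ φ y u + leviCivita β F y u (φ y)) (ψ y) +
        sff β F y (φ y) (fderiv ℝ ψ y u + leviCivita β F y u (ψ y)) := by
  have hB := H.differentiableAt H.contDiffOn_dTangentProj hy
  have hA := H.differentiableAt H.contDiffOn_fderiv hy
  have hleibniz := (hB.hasFDerivAt.clm_apply hφ.hasFDerivAt).clm_apply
    (hA.hasFDerivAt.clm_apply hψ.hasFDerivAt)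
  have hgauss : fderiv ℝ (fderiv ℝ F) y u (ψ y) =
      fderiv ℝ F y (leviCivita β F y u (ψ y)) + skewSff β F y u (fderiv ℝ F y (ψ y)) := by
    rw [H.fderiv_fderiv_apply hy, H.skewSff_apply hy]
  refine Eq.trans congr($hleibniz.fderiv u) ?_
  simp only [covSff, sff, add_apply, ContinuousLinearMap.comp_apply,
    ContinuousLinearMap.flip_apply, sub_apply, map_add, hgauss, clm_mul_apply]
  abel

theorem covSff_comm (H : LocalImmersion β U F) (hy : y ∈ U) (u v : E) :
    covSff β F y u v = covSff β F y v u := by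
  rw [covSff, covSff, H.fderiv_dTangentProj_comm hy u v, H.leviCivita_comm hy u v]
  simp only [skewSff]
  linear_combination (norm := noncomm_ring)
    (-dTangentProj β F y u) * H.dTangentProj_anticomm hy v +
      dTangentProj β F y v * H.dTangentProj_anticomm hy u

theorem covSff_apply_comm (H : LocalImmersion β U F) (hy : y ∈ U) (u v w : E) :
    covSff β F y u v (fderiv ℝ F y w) = covSff β F y u w (fderiv ℝ F y v) := by
  have h := congr($(H.fderiv_congr (fun z hz => H.sff_comm hz v w) hy) u)
  rw [H.fderiv_sff hy (differentiableAt_const v) (differentiableAt_const w),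
    H.fderiv_sff hy (differentiableAt_const w) (differentiableAt_const v)] at h
  simp only [fderiv_fun_const, Pi.zero_apply, zero_apply, zero_add] at h
  rw [H.sff_comm hy v w, H.sff_comm hy _ w, H.sff_comm hy v] at h
  linear_combination (norm := module) h

theorem beta_covSff (H : LocalImmersion β U F) (hy : y ∈ U) (u v : E) (x z : L) :
    β (covSff β F y u v x) z = β x (covSff β F y u v z) := by
  simp only [covSff, sub_apply, map_sub, clm_mul_apply, H.beta_fderiv_dTangentProj hy,
    H.beta_dTangentProj hy, H.beta_skewSff hy]
  ring

theorem covSff_eq (H : LocalImmersion β U F) (hy : y ∈ U) (u v : E) :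
    covSff β F y u v =
      tangentProj β F y * covSff β F y u v + covSff β F y u v * tangentProj β F y := by
  rw [covSff, skewSff]
  have hπ := H.tangentProj_mul_tangentProj hy
  have hu := H.dTangentProj_eq hy u
  have hv := H.dTangentProj_eq hy v
  have hΓ := H.dTangentProj_eq hy (leviCivita β F y u v)
  have hanti := H.dTangentProj_anticomm hy v
  have hderiv := H.fderiv_dTangentProj_eq hy u v
  generalize fderiv ℝ (dTangentProj β F) y u v = c at *
  generalize dTangentProj β F y (leviCivita β F y u v) = g at *
  generalize dTangentProj β F y u = a at *
  generalize dTangentProj β F y v = b at *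
  generalize tangentProj β F y = t at *
  have hbracket :
      a * (2 * t - 1) * b - b * (a * (2 * t - 1)) = -((a * b + b * a) * (2 * t - 1)) := by
    linear_combination (norm := noncomm_ring) a * hanti
  have hcomm : t * (a * b + b * a) = (a * b + b * a) * t := by
    linear_combination (norm := noncomm_ring) -hu * b + a * hv - hv * a + b * hu
  rw [hbracket]
  linear_combination (norm := noncomm_ring)
    hderiv - hcomm * (2 * t - 1) - 4 * (a * b + b * a) * hπ - hΓ

end LocalImmersion

namespace LocalKaehler

theorem mono (H : LocalKaehler β U F J) {V : Set E} (hV : IsOpen V) (hVU : V ⊆ U) :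
    LocalKaehler β V F J where
  isOpen := hV
  symm := H.symm
  smooth := H.smooth.mono hVU
  pos y hy := H.pos y (hVU hy)
  nondeg := H.nondeg
  smooth_J := H.smooth_J.mono hVU
  J_J y hy := H.J_J y (hVU hy)
  orth y hy := H.orth y (hVU hy)
  parallel y hy := H.parallel y (hVU hy)

theorem fderiv_J_apply (H : LocalKaehler β U F J) (hy : y ∈ U) (u w : E) :
    fderiv ℝ (fun z => J z w) y u + leviCivita β F y u (J y w) = J y (leviCivita β F y u w) := by
  rw [(hasFDerivAt_clm_apply_const (H.differentiableAt H.smooth_J hy) w).fderiv,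
    ContinuousLinearMap.flip_apply, H.parallel y hy]
  exact sub_add_cancel _ _

theorem sff_J_add_sff_J (H : LocalKaehler β U F J)
    (hα : ∀ u v, sff β F y (J y u) (J y v) = sff β F y u v) (hy : y ∈ U) (u v : E) :
    sff β F y (J y u) v + sff β F y u (J y v) = 0 := by
  rw [← hα (J y u) v, H.J_J y hy, sff, map_neg, neg_apply]
  exact neg_add_cancel _

variable [FiniteDimensional ℝ E]

theorem contDiffOn_ambientJ (H : LocalKaehler β U F J) : ContDiffOn ℝ ∞ (ambientJ β F J) U :=
  H.contDiffOn_fderiv.clm_comp (H.smooth_J.clm_comp H.contDiffOn_tangentCoord)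

theorem ambientJ_apply (H : LocalKaehler β U F J) (hy : y ∈ U) (u : E) :
    ambientJ β F J y (fderiv ℝ F y u) = fderiv ℝ F y (J y u) := by
  change fderiv ℝ F y (J y (tangentCoord β F y (fderiv ℝ F y u))) = _
  rw [H.tangentCoord_apply hy]

theorem ambientJ_ambientJ (H : LocalKaehler β U F J) (hy : y ∈ U) (x : L) :
    ambientJ β F J y (ambientJ β F J y x) = -tangentProj β F y x := by
  change ambientJ β F J y (fderiv ℝ F y (J y (tangentCoord β F y x))) = _
  rw [H.ambientJ_apply hy, H.J_J y hy, map_neg]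
  rfl

theorem beta_ambientJ (H : LocalKaehler β U F J) (hy : y ∈ U) (x z : L) :
    β (ambientJ β F J y x) z = -β x (ambientJ β F J y z) := by
  have hproj (x) : tangentProj β F y (ambientJ β F J y x) = ambientJ β F J y x :=
    H.tangentProj_apply hy _
  have hskew (a c) : β (fderiv ℝ F y (J y a)) (fderiv ℝ F y c) =
      -β (fderiv ℝ F y a) (fderiv ℝ F y (J y c)) := by
    rw [← H.orth y hy (J y a) c, H.J_J y hy, map_neg, map_neg, neg_apply]
  calc β (ambientJ β F J y x) z = β (tangentProj β F y (ambientJ β F J y x)) z := by rw [hproj]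
    _ = β (ambientJ β F J y x) (tangentProj β F y z) := H.beta_tangentProj hy _ _
    _ = -β (tangentProj β F y x) (ambientJ β F J y z) := hskew _ _
    _ = -β x (ambientJ β F J y z) := by rw [H.beta_tangentProj hy, hproj]

theorem fderiv_ambientJ (H : LocalKaehler β U F J) (hy : y ∈ U) (u : E) :
    fderiv ℝ (ambientJ β F J) y u =
      skewSff β F y u * ambientJ β F J y - ambientJ β F J y * skewSff β F y u := by
  have hA := H.differentiableAt H.contDiffOn_fderiv hy
  have hJ := H.differentiableAt H.smooth_J hy
  have hρ := H.differentiableAt H.contDiffOn_tangentCoord hy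
  refine (fderiv_comp_clm_apply hA (hJ.clm_comp hρ) u).trans ?_
  rw [fderiv_comp_clm_apply hJ hρ, H.fderiv_fderiv_eq hy, H.fderiv_tangentCoord hy,
    H.parallel y hy]
  ext x
  simp only [ambientJ, add_apply, ContinuousLinearMap.comp_apply, sub_apply, neg_apply, map_add,
    map_sub, map_neg, clm_mul_apply]
  abel

theorem fderiv_fderiv_ambientJ (H : LocalKaehler β U F J) (hy : y ∈ U) (u v : E) :
    fderiv ℝ (fderiv ℝ (ambientJ β F J)) y u v =
      (skewSff β F y v * (skewSff β F y u * ambientJ β F J y - ambientJ β F J y * skewSff β F y u) +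
        fderiv ℝ (fun z => skewSff β F z v) y u * ambientJ β F J y) -
      (ambientJ β F J y * fderiv ℝ (fun z => skewSff β F z v) y u +
        (skewSff β F y u * ambientJ β F J y - ambientJ β F J y * skewSff β F y u) *
          skewSff β F y v) := by
  have hJ := H.differentiableAt H.contDiffOn_ambientJ hy
  have hS := H.differentiableAt (H.contDiffOn_skewSff v) hy
  have hdJ := H.differentiableAt
    (H.contDiffOn_ambientJ.fderiv_of_isOpen (m := ∞) H.isOpen (by simp)) hy
  have hflip : fderiv ℝ (fderiv ℝ (ambientJ β F J)) y u v =
      fderiv ℝ (fun z => fderiv ℝ (ambientJ β F J) z v) y u := by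
    rw [(hasFDerivAt_clm_apply_const hdJ v).fderiv, ContinuousLinearMap.flip_apply]
  rw [hflip, H.fderiv_congr (fun z hz => H.fderiv_ambientJ hz v) hy,
    fderiv_fun_sub (hS.fun_mul hJ) (hJ.fun_mul hS), sub_apply]
  have hleft := fderiv_comp_clm_apply hS hJ u
  have hright := fderiv_comp_clm_apply hJ hS u
  rw [H.fderiv_ambientJ hy] at hleft hright
  exact congr($hleft - $hright)

theorem dTangentProj_commutator_ambientJ (H : LocalKaehler β U F J) (hy : y ∈ U) (u v : E) :
    (dTangentProj β F y u * dTangentProj β F y v - dTangentProj β F y v * dTangentProj β F y u) *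
        ambientJ β F J y =
      ambientJ β F J y * (dTangentProj β F y u * dTangentProj β F y v -
        dTangentProj β F y v * dTangentProj β F y u) := by
  have h := H.fderiv_fderiv_comm H.contDiffOn_ambientJ hy u v
  rw [H.fderiv_fderiv_ambientJ hy, H.fderiv_fderiv_ambientJ hy, H.fderiv_skewSff hy,
    H.fderiv_skewSff hy, H.fderiv_dTangentProj_comm hy u v] at h
  have huv := H.skewSff_mul_skewSff hy u v
  have hvu := H.skewSff_mul_skewSff hy v u
  linear_combination (norm := noncomm_ring) -h - huv * ambientJ β F J y + hvu * ambientJ β F J y +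
    ambientJ β F J y * huv - ambientJ β F J y * hvu

theorem beta_sff_sff_sub (H : LocalKaehler β U F J) (hy : y ∈ U) (u v w z : E) :
    β (sff β F y u z) (sff β F y v w) - β (sff β F y u w) (sff β F y v z) =
      β (sff β F y u (J y z)) (sff β F y v (J y w)) -
        β (sff β F y u (J y w)) (sff β F y v (J y z)) := by
  set K := dTangentProj β F y u * dTangentProj β F y v -
    dTangentProj β F y v * dTangentProj β F y u with hK
  have hcurv (w z) : β (sff β F y u z) (sff β F y v w) - β (sff β F y u w) (sff β F y v z) =
      β (fderiv ℝ F y z) (K (fderiv ℝ F y w)) := by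
    simp only [sff, hK, sub_apply, map_sub, clm_mul_apply]
    rw [H.symm (dTangentProj β F y u (fderiv ℝ F y w)), H.beta_dTangentProj hy,
      H.beta_dTangentProj hy]
  have hJ : K (ambientJ β F J y (fderiv ℝ F y w)) = ambientJ β F J y (K (fderiv ℝ F y w)) :=
    congr($(H.dTangentProj_commutator_ambientJ hy u v) (fderiv ℝ F y w))
  rw [hcurv, hcurv, ← H.ambientJ_apply hy, ← H.ambientJ_apply hy, hJ, H.beta_ambientJ hy,
    H.ambientJ_ambientJ hy, map_neg, neg_neg, ← H.beta_tangentProj hy, H.tangentProj_apply hy]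

theorem covSff_J_apply (H : LocalKaehler β U F J)
    (hα : ∀ z ∈ U, ∀ u v, sff β F z (J z u) (J z v) = sff β F z u v) (hy : y ∈ U) (u v w : E) :
    covSff β F y u (J y v) (fderiv ℝ F y w) = -covSff β F y u v (fderiv ℝ F y (J y w)) := by
  have hJ (w) : DifferentiableAt ℝ (fun z => J z w) y :=
    (hasFDerivAt_clm_apply_const (H.differentiableAt H.smooth_J hy) w).differentiableAt
  have hsff {φ ψ : E → E} (hφ : DifferentiableAt ℝ φ y) (hψ : DifferentiableAt ℝ ψ y) :
      DifferentiableAt ℝ (fun z => sff β F z (φ z) (ψ z)) y :=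
    ((H.differentiableAt H.contDiffOn_dTangentProj hy).clm_apply hφ).clm_apply
      ((H.differentiableAt H.contDiffOn_fderiv hy).clm_apply hψ)
  have hv := differentiableAt_const (𝕜 := ℝ) (x := y) v
  have hw := differentiableAt_const (𝕜 := ℝ) (x := y) w
  have h := congr($(H.fderiv_congr (fun z hz => H.sff_J_add_sff_J (hα z hz) hz v w) hy) u)
  rw [fderiv_fun_add (hsff (hJ v) hw) (hsff hv (hJ w)), add_apply, H.fderiv_sff hy (hJ v) hw,
    H.fderiv_sff hy hv (hJ w), H.fderiv_J_apply hy, H.fderiv_J_apply hy] at h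
  simp only [fderiv_fun_const, Pi.zero_apply, zero_apply, zero_add] at h
  have hskew := congr(skewSff β F y u $(H.sff_J_add_sff_J (hα y hy) hy v w))
  rw [map_add, map_zero] at hskew
  linear_combination (norm := module) h - hskew -
    H.sff_J_add_sff_J (hα y hy) hy (leviCivita β F y u v) w -
    H.sff_J_add_sff_J (hα y hy) hy v (leviCivita β F y u w)

/-- `∇α` is symmetric in its three arguments, and moving `J` from one argument to another changes
the sign; moving it around all three forces `∇α = 0`. -/
theorem covSff_apply_eq_zero (H : LocalKaehler β U F J)
    (hα : ∀ z ∈ U, ∀ u v, sff β F z (J z u) (J z v) = sff β F z u v) (hy : y ∈ U) (u v w : E) :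
    covSff β F y u v (fderiv ℝ F y w) = 0 := by
  have hJ (u v w) : covSff β F y (J y u) v (fderiv ℝ F y w) = 0 := by
    have h₁₂ : covSff β F y (J y u) v (fderiv ℝ F y w) =
        -covSff β F y u (J y v) (fderiv ℝ F y w) := by
      rw [H.covSff_comm hy (J y u) v, H.covSff_apply_comm hy v, H.covSff_comm hy v,
        H.covSff_apply_comm hy w, H.covSff_comm hy u, H.covSff_apply_comm hy (J y v),
        H.covSff_comm hy (J y v), H.covSff_J_apply hα hy w u v, H.covSff_apply_comm hy w u]
    have h₁₃ : covSff β F y (J y u) v (fderiv ℝ F y w) =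
        -covSff β F y u v (fderiv ℝ F y (J y w)) := by
      rw [H.covSff_comm hy (J y u) v, H.covSff_J_apply hα hy, H.covSff_comm hy v u]
    rw [H.covSff_J_apply hα hy, neg_neg] at h₁₂
    have : IsAddTorsionFree L := .of_isTorsionFree ℝ L
    exact self_eq_neg.1 (h₁₃.trans congr(-$h₁₂.symm))
  rw [← neg_neg u, ← H.J_J y hy u, ← map_neg]
  exact hJ _ v w

theorem covSff_eq_zero (H : LocalKaehler β U F J)
    (hα : ∀ z ∈ U, ∀ u v, sff β F z (J z u) (J z v) = sff β F z u v) (hy : y ∈ U) (u v : E) :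
    covSff β F y u v = 0 := by
  have htangent (x) : covSff β F y u v (tangentProj β F y x) = 0 :=
    H.covSff_apply_eq_zero hα hy u v _
  have hnormal (x) : tangentProj β F y (covSff β F y u v x) = 0 := by
    refine H.nondeg _ fun z => ?_
    rw [H.beta_tangentProj hy, H.beta_covSff hy, htangent, map_zero]
  ext x
  rw [H.covSff_eq hy u v, add_apply, clm_mul_apply, clm_mul_apply, htangent, hnormal,
    add_zero, zero_apply]

end LocalKaehler

end LocalKaehler

section Propagation

open Module Filter Topology Asymptotics

section IsBigO

variable {E X : Type*} [NormedAddCommGroup E] [NormedSpace ℝ E]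
  [NormedAddCommGroup X] [NormedSpace ℝ X]

theorem eventually_eq_zero_of_fderiv_isBigO {D : E → X} {y₀ : E}
    (hdiff : ∀ᶠ y in 𝓝 y₀, DifferentiableAt ℝ D y) (hD : fderiv ℝ D =O[𝓝 y₀] D) (h₀ : D y₀ = 0) :
    ∀ᶠ y in 𝓝 y₀, D y = 0 := by
  obtain ⟨K, hK⟩ := hD.bound
  obtain ⟨r, hr, hball⟩ := Metric.eventually_nhds_iff_ball.1 (hdiff.and hK)
  refine Metric.eventually_nhds_iff_ball.2 ⟨r, hr, fun y hy => ?_⟩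
  let γ : ℝ → E := AffineMap.lineMap y₀ y
  have hγ (t : ℝ) (ht : t ∈ Set.Icc (0 : ℝ) 1) : γ t ∈ Metric.ball y₀ r :=
    (convex_ball y₀ r).lineMap_mem (Metric.mem_ball_self hr) hy ht
  have hderiv (t : ℝ) (ht : t ∈ Set.Icc (0 : ℝ) 1) :
      HasDerivAt (D ∘ γ) (fderiv ℝ D (γ t) (y - y₀)) t :=
    (hball _ (hγ t ht)).1.hasFDerivAt.comp_hasDerivAt t AffineMap.hasDerivAt_lineMap
  have hbound (t : ℝ) (ht : t ∈ Set.Icc (0 : ℝ) 1) :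
      ‖fderiv ℝ D (γ t) (y - y₀)‖ ≤ K * ‖y - y₀‖ * ‖(D ∘ γ) t‖ :=
    calc ‖fderiv ℝ D (γ t) (y - y₀)‖ ≤ K * ‖D (γ t)‖ * ‖y - y₀‖ :=
          (fderiv ℝ D (γ t)).le_of_opNorm_le (hball _ (hγ t ht)).2 _
      _ = K * ‖y - y₀‖ * ‖(D ∘ γ) t‖ := mul_right_comm _ _ _
  have h := eq_zero_of_abs_deriv_le_mul_abs_self_of_eq_zero_right
    (fun t ht => (hderiv t ht).continuousAt.continuousWithinAt)
    (fun t ht => (hderiv t (Set.Ico_subset_Icc_self ht)).hasDerivWithinAt)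
    (by rw [Function.comp_apply, show γ 0 = y₀ from AffineMap.lineMap_apply_zero y₀ y, h₀])
    (fun t ht => hbound t (Set.Ico_subset_Icc_self ht)) 1 (Set.right_mem_Icc.2 zero_le_one)
  rwa [Function.comp_apply, show γ 1 = y from AffineMap.lineMap_apply_one y₀ y] at h

theorem hasFDerivAt_const_comp {Y : Type*} [NormedAddCommGroup Y] [NormedSpace ℝ Y] (S : X →L[ℝ] Y)
    {T : E → E →L[ℝ] X} {T' : E →L[ℝ] E →L[ℝ] X} {y : E} (hT : HasFDerivAt T T' y) :
    HasFDerivAt (fun z => S.comp (T z)) ((ContinuousLinearMap.compL ℝ E X Y S).comp T') y :=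
  (ContinuousLinearMap.compL ℝ E X Y S).hasFDerivAt.comp y hT

theorem isBigO_of_forall_apply [FiniteDimensional ℝ E] {ι : Type*} {l : Filter ι}
    {T : ι → E →L[ℝ] X} {g : ι → ℝ} (h : ∀ u, (fun i => T i u) =O[l] g) : T =O[l] g := by
  obtain ⟨C, -, hC⟩ := (finBasis ℝ E).exists_opNorm_le (F := X)
  have hsum : (fun i => ∑ j, ‖T i (finBasis ℝ E j)‖) =O[l] g :=
    IsBigO.fun_sum fun j _ => (h (finBasis ℝ E j)).norm_left
  refine (IsBigO.of_bound C (Eventually.of_forall fun i => ?_)).trans hsum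
  have hnonneg : 0 ≤ ∑ j, ‖T i (finBasis ℝ E j)‖ := Finset.sum_nonneg fun j _ => norm_nonneg _
  rw [Real.norm_of_nonneg hnonneg]
  exact hC hnonneg fun j =>
    Finset.single_le_sum (fun j _ => norm_nonneg (T i (finBasis ℝ E j))) (Finset.mem_univ j)

theorem isBigO_clm_apply {ι : Type*} {l : Filter ι} {T : ι → E →L[ℝ] X} {φ : ι → E} {g : ι → ℝ}
    (hT : T =O[l] g) (hφ : φ =O[l] (1 : ι → ℝ)) : (fun i => T i (φ i)) =O[l] g := by
  refine IsBigO.trans (IsBigO.of_norm_le fun i => (T i).le_opNorm (φ i)) ?_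
  exact (hT.norm_left.mul hφ.norm_left).congr_right fun _ => mul_one _

theorem eventually_eq_zero_of_fderiv_isBigO₃ {X₁ X₂ X₃ : Type*}
    [NormedAddCommGroup X₁] [NormedSpace ℝ X₁] [NormedAddCommGroup X₂] [NormedSpace ℝ X₂]
    [NormedAddCommGroup X₃] [NormedSpace ℝ X₃] {D₁ : E → X₁} {D₂ : E → X₂} {D₃ : E → X₃} {y₀ : E}
    (hdiff : ∀ᶠ y in 𝓝 y₀,
      DifferentiableAt ℝ D₁ y ∧ DifferentiableAt ℝ D₂ y ∧ DifferentiableAt ℝ D₃ y)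
    (hD : ∀ g : E → ℝ, D₁ =O[𝓝 y₀] g → D₂ =O[𝓝 y₀] g → D₃ =O[𝓝 y₀] g →
      fderiv ℝ D₁ =O[𝓝 y₀] g ∧ fderiv ℝ D₂ =O[𝓝 y₀] g ∧ fderiv ℝ D₃ =O[𝓝 y₀] g)
    (h₁ : D₁ y₀ = 0) (h₂ : D₂ y₀ = 0) (h₃ : D₃ y₀ = 0) :
    ∀ᶠ y in 𝓝 y₀, D₁ y = 0 ∧ D₂ y = 0 ∧ D₃ y = 0 := by
  let D : E → X₁ × X₂ × X₃ := fun y => (D₁ y, D₂ y, D₃ y)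
  have hO : fderiv ℝ D =O[𝓝 y₀] D := by
    obtain ⟨hO₁, hO₂, hO₃⟩ := hD (fun y => ‖D y‖) isBigO_fst_prod.norm_right
      (isBigO_fst_prod.trans isBigO_snd_prod).norm_right
      (isBigO_snd_prod.trans isBigO_snd_prod).norm_right
    have hprod : fderiv ℝ D =ᶠ[𝓝 y₀] fun y =>
        (fderiv ℝ D₁ y).prod ((fderiv ℝ D₂ y).prod (fderiv ℝ D₃ y)) :=
      hdiff.mono fun y hy => (hy.1.hasFDerivAt.prodMk
        (hy.2.1.hasFDerivAt.prodMk hy.2.2.hasFDerivAt)).fderiv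
    refine hprod.trans_isBigO ((IsBigO.of_norm_left ?_).of_norm_right)
    refine (hO₁.norm_left.prod_left (hO₂.norm_left.prod_left hO₃.norm_left)).norm_left.congr_left
      fun y => ?_
    simp only [ContinuousLinearMap.opNorm_prod, Prod.norm_def, norm_norm]
  have hzero := eventually_eq_zero_of_fderiv_isBigO
    (hdiff.mono fun y hy => hy.1.prodMk (hy.2.1.prodMk hy.2.2)) hO
    (Prod.ext h₁ (Prod.ext h₂ h₃) : D y₀ = 0)
  exact hzero.mono fun y hy =>
    ⟨congrArg Prod.fst hy, congrArg (fun p => p.2.1) hy, congrArg (fun p => p.2.2) hy⟩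

end IsBigO

variable {E L : Type*} [NormedAddCommGroup E] [NormedSpace ℝ E]
  [NormedAddCommGroup L] [NormedSpace ℝ L]

/-- The commutator with `P`. -/
def commutatorCLM (P : L →L[ℝ] L) : (L →L[ℝ] L) →L[ℝ] (L →L[ℝ] L) :=
  ContinuousLinearMap.mul ℝ (L →L[ℝ] L) P - (ContinuousLinearMap.mul ℝ (L →L[ℝ] L)).flip P

theorem commutatorCLM_apply (P T : L →L[ℝ] L) : commutatorCLM P T = P * T - T * P := rfl

theorem commutatorCLM_eq_zero_iff {P T : L →L[ℝ] L} : commutatorCLM P T = 0 ↔ Commute P T :=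
  sub_eq_zero

theorem commutatorCLM_one (P : L →L[ℝ] L) : commutatorCLM P 1 = 0 := by
  rw [commutatorCLM_apply, mul_one, one_mul, sub_self]

theorem commutatorCLM_mul (P S T : L →L[ℝ] L) :
    commutatorCLM P (S * T) = commutatorCLM P S * T + S * commutatorCLM P T := by
  simp only [commutatorCLM_apply]
  noncomm_ring

theorem isBigO_commutatorCLM_mul {ι : Type*} {l : Filter ι} {P : L →L[ℝ] L} {S T : ι → L →L[ℝ] L}
    {g : ι → ℝ} (hS : S =O[l] (1 : ι → ℝ)) (hT : T =O[l] (1 : ι → ℝ))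
    (hPS : (fun i => commutatorCLM P (S i)) =O[l] g)
    (hPT : (fun i => commutatorCLM P (T i)) =O[l] g) :
    (fun i => commutatorCLM P (S i * T i)) =O[l] g := by
  simp only [commutatorCLM_mul]
  exact ((hPS.mul hT).congr_right fun _ => mul_one _).add
    ((hS.mul hPT).congr_right fun _ => one_mul _)

variable {β : L →L[ℝ] L →L[ℝ] ℝ} {F : E → L} {U : Set E} {J : E → E →L[ℝ] E} {y₀ : E}
  {P : L →L[ℝ] L} {g : E → ℝ}

variable (β F J P) in
/-- `P` commutes with the tangent projection and its first derivatives, and with the complex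
structure, at `y`. For self-adjoint `P` this is the compatibility, to first order, of the immersion
with the eigenspaces of `P`. -/
structure CommutesAt (y : E) : Prop where
  tangentProj : Commute P (tangentProj β F y)
  dTangentProj : ∀ v, Commute P (dTangentProj β F y v)
  ambientJ : Commute P (ambientJ β F J y)

namespace LocalImmersion

theorem isBigO_one (H : LocalImmersion β U F) {G : Type*} [NormedAddCommGroup G] [NormedSpace ℝ G]
    {φ : E → G} (hφ : ContDiffOn ℝ ∞ φ U) (hy₀ : y₀ ∈ U) : φ =O[𝓝 y₀] (1 : E → ℝ) :=
  (H.differentiableAt hφ hy₀).continuousAt.tendsto.isBigO_one ℝ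

variable [FiniteDimensional ℝ E]

theorem contDiffOn_leviCivita (H : LocalImmersion β U F) (u v : E) :
    ContDiffOn ℝ ∞ (fun y => leviCivita β F y u v) U := by
  have hρ := H.contDiffOn_tangentCoord
  have hF : ContDiffOn ℝ ∞ (fderiv ℝ (fderiv ℝ F)) U :=
    H.contDiffOn_fderiv.fderiv_of_isOpen H.isOpen (by simp)
  exact hρ.clm_apply ((hF.clm_apply contDiffOn_const).clm_apply contDiffOn_const)

theorem isBigO_commutatorCLM_skewSff (H : LocalImmersion β U F) (hy₀ : y₀ ∈ U)
    (hπ : (fun y => commutatorCLM P (tangentProj β F y)) =O[𝓝 y₀] g)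
    (hdπ : ∀ v, (fun y => commutatorCLM P (dTangentProj β F y v)) =O[𝓝 y₀] g) (u : E) :
    (fun y => commutatorCLM P (skewSff β F y u)) =O[𝓝 y₀] g := by
  have hsmooth := H.contDiffOn_tangentProj
  refine isBigO_commutatorCLM_mul
    (H.isBigO_one (H.contDiffOn_dTangentProj.clm_apply contDiffOn_const) hy₀)
    (H.isBigO_one (by fun_prop) hy₀) (hdπ u) ?_
  simpa only [two_mul, map_sub, map_add, commutatorCLM_one, sub_zero] using hπ.add hπ

theorem isBigO_commutatorCLM_skewSff_bracket (H : LocalImmersion β U F) (hy₀ : y₀ ∈ U)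
    (hπ : (fun y => commutatorCLM P (tangentProj β F y)) =O[𝓝 y₀] g)
    (hdπ : ∀ v, (fun y => commutatorCLM P (dTangentProj β F y v)) =O[𝓝 y₀] g) (u : E)
    {T : E → L →L[ℝ] L} (hT : ContDiffOn ℝ ∞ T U)
    (hPT : (fun y => commutatorCLM P (T y)) =O[𝓝 y₀] g) :
    (fun y => commutatorCLM P (skewSff β F y u * T y - T y * skewSff β F y u)) =O[𝓝 y₀] g := by
  have hS := H.isBigO_one (H.contDiffOn_skewSff u) hy₀
  have hPS := H.isBigO_commutatorCLM_skewSff hy₀ hπ hdπ u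
  simp only [map_sub]
  exact (isBigO_commutatorCLM_mul hS (H.isBigO_one hT hy₀) hPS hPT).sub
    (isBigO_commutatorCLM_mul (H.isBigO_one hT hy₀) hS hPT hPS)

theorem isBigO_commutatorCLM_fderiv_dTangentProj (H : LocalImmersion β U F)
    (hcov : ∀ y ∈ U, ∀ u v, covSff β F y u v = 0) (hy₀ : y₀ ∈ U)
    (hπ : (fun y => commutatorCLM P (tangentProj β F y)) =O[𝓝 y₀] g)
    (hdπ : (fun y => (commutatorCLM P).comp (dTangentProj β F y)) =O[𝓝 y₀] g) (u v : E) :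
    (fun y => commutatorCLM P (fderiv ℝ (dTangentProj β F) y u v)) =O[𝓝 y₀] g := by
  have happly {φ : E → E} (hφ : ContDiffOn ℝ ∞ φ U) :
      (fun y => commutatorCLM P (dTangentProj β F y (φ y))) =O[𝓝 y₀] g :=
    isBigO_clm_apply (T := fun y => (commutatorCLM P).comp (dTangentProj β F y)) hdπ
      (H.isBigO_one hφ hy₀)
  have hconst (v) := happly (contDiffOn_const (c := v))
  refine ((H.isBigO_commutatorCLM_skewSff_bracket hy₀ hπ hconst u
    (H.contDiffOn_dTangentProj.clm_apply contDiffOn_const) (hconst v)).add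
    (happly (H.contDiffOn_leviCivita u v))).congr' ?_ .rfl
  filter_upwards [H.isOpen.mem_nhds hy₀] with y hy
  have h := hcov y hy u v
  rw [covSff, sub_sub, sub_eq_zero] at h
  rw [h, map_add]

end LocalImmersion

/- The commutators of `P` with the tangent projection, its derivative and the complex structure
solve a linear system of differential equations, because the second fundamental form is parallel. -/
theorem LocalKaehler.eventually_commutesAt [FiniteDimensional ℝ E] (H : LocalKaehler β U F J)
    (hcov : ∀ y ∈ U, ∀ u v, covSff β F y u v = 0) (hy₀ : y₀ ∈ U) (hP : CommutesAt β F J P y₀) :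
    ∀ᶠ y in 𝓝 y₀, CommutesAt β F J P y := by
  let D₁ : E → L →L[ℝ] L := fun y => commutatorCLM P (tangentProj β F y)
  let D₂ : E → E →L[ℝ] L →L[ℝ] L := fun y => (commutatorCLM P).comp (dTangentProj β F y)
  let D₃ : E → L →L[ℝ] L := fun y => commutatorCLM P (ambientJ β F J y)
  have hD₁ (y) (hy : y ∈ U) : HasFDerivAt D₁ (D₂ y) y :=
    (commutatorCLM P).hasFDerivAt.comp y
      (H.differentiableAt H.contDiffOn_tangentProj hy).hasFDerivAt
  have hD₂ (y) (hy : y ∈ U) : HasFDerivAt D₂ ((ContinuousLinearMap.compL ℝ E (L →L[ℝ] L)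
      (L →L[ℝ] L) (commutatorCLM P)).comp (fderiv ℝ (dTangentProj β F) y)) y :=
    hasFDerivAt_const_comp _ (H.differentiableAt H.contDiffOn_dTangentProj hy).hasFDerivAt
  have hD₃ (y) (hy : y ∈ U) :
      HasFDerivAt D₃ ((commutatorCLM P).comp (fderiv ℝ (ambientJ β F J) y)) y :=
    (commutatorCLM P).hasFDerivAt.comp y
      (H.differentiableAt H.contDiffOn_ambientJ hy).hasFDerivAt
  have hU := H.isOpen.mem_nhds hy₀
  have hD₁₀ : D₁ y₀ = 0 := commutatorCLM_eq_zero_iff.2 hP.tangentProj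
  have hD₂₀ : D₂ y₀ = 0 :=
    ContinuousLinearMap.ext fun v => commutatorCLM_eq_zero_iff.2 (hP.dTangentProj v)
  have hD₃₀ : D₃ y₀ = 0 := commutatorCLM_eq_zero_iff.2 hP.ambientJ
  refine (eventually_eq_zero_of_fderiv_isBigO₃ (D₁ := D₁) (D₂ := D₂) (D₃ := D₃) ?_ ?_ hD₁₀ hD₂₀
    hD₃₀).mono fun y hy =>
    ⟨commutatorCLM_eq_zero_iff.1 hy.1,
      fun v => commutatorCLM_eq_zero_iff.1 congr($(hy.2.1) v), commutatorCLM_eq_zero_iff.1 hy.2.2⟩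
  · filter_upwards [hU] with y hy
    exact ⟨(hD₁ y hy).differentiableAt, (hD₂ y hy).differentiableAt, (hD₃ y hy).differentiableAt⟩
  intro g h₁ h₂ h₃
  refine ⟨?_, isBigO_of_forall_apply fun u => isBigO_of_forall_apply fun v => ?_,
    isBigO_of_forall_apply fun u => ?_⟩
  · exact h₂.congr' (mem_of_superset hU fun y hy => (hD₁ y hy).fderiv.symm) .rfl
  · refine (H.isBigO_commutatorCLM_fderiv_dTangentProj hcov hy₀ h₁ h₂ u v).congr' ?_ .rfl
    filter_upwards [hU] with y hy
    rw [(hD₂ y hy).fderiv]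
    rfl
  · refine (H.isBigO_commutatorCLM_skewSff_bracket hy₀ h₁ (fun v =>
      isBigO_clm_apply (T := D₂) h₂ (isBigO_const_const v one_ne_zero _)) u H.contDiffOn_ambientJ
      h₃).congr' ?_ .rfl
    filter_upwards [hU] with y hy
    rw [(hD₃ y hy).fderiv, ← H.fderiv_ambientJ hy]
    rfl

end Propagation

/-! ### Kaehler immersions into hyperbolic space -/

section HyperbolicKaehler

open Module Filter Topology

variable {E L : Type*} [NormedAddCommGroup E] [NormedSpace ℝ E] [NormedAddCommGroup L]
  [NormedSpace ℝ L]

/-- `F` is a Kaehler immersion into the hyperboloid `⟨x, x⟩ = -1` of a Lorentzian vector space. The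
signature of the form is encoded by its being nonnegative on the complement of timelike vectors. -/
structure HyperbolicKaehler (β : L →L[ℝ] L →L[ℝ] ℝ) (U : Set E) (F : E → L) (J : E → E →L[ℝ] E) :
    Prop extends LocalKaehler β U F J where
  norm_eq : ∀ y ∈ U, β (F y) (F y) = -1
  nonneg : ∀ x z, β z z < 0 → β x z = 0 → 0 ≤ β x x

variable {β : L →L[ℝ] L →L[ℝ] ℝ} {F : E → L} {U : Set E} {J : E → E →L[ℝ] E} {y : E}

variable (β F) in
/-- The normal space of the immersion `F` at `y`. -/
def normalSpace (y : E) : Submodule ℝ L := LinearMap.ker (tangentCoord β F y : L →ₗ[ℝ] E)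

theorem mem_normalSpace {x : L} : x ∈ normalSpace β F y ↔ tangentCoord β F y x = 0 := Iff.rfl

variable (β F) in
/-- The restriction of `β` to the normal space, as a bilinear form. -/
def normalForm (y : E) : normalSpace β F y →ₗ[ℝ] normalSpace β F y →ₗ[ℝ] ℝ :=
  LinearMap.mk₂ ℝ (fun x z => β (x : L) (z : L)) (by intros; simp) (by intros; simp)
    (by intros; simp) (by intros; simp)

variable (β F J) in
/-- Regularity of `Z` for the second fundamental form at `y`, see `IsRegular`. -/
def IsRegularAt (y Z : E) : Prop :=
  ∀ u, sff β F y u Z + sff β F y (J y u) (J y Z) = 0 →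
    sff β F y u (J y Z) - sff β F y (J y u) Z = 0 → u = 0

namespace LocalImmersion

variable [FiniteDimensional ℝ E]

theorem injective_fderiv (H : LocalImmersion β U F) (hy : y ∈ U) :
    Function.Injective (fderiv ℝ F y) :=
  Function.LeftInverse.injective (H.tangentCoord_apply hy)

theorem mem_normalSpace_iff (H : LocalImmersion β U F) (hy : y ∈ U) {x : L} :
    x ∈ normalSpace β F y ↔ tangentProj β F y x = 0 :=
  ((injective_iff_map_eq_zero' _).1 (H.injective_fderiv hy) _).symm

theorem sff_mem (H : LocalImmersion β U F) (hy : y ∈ U) (u v : E) :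
    sff β F y u v ∈ normalSpace β F y :=
  (H.mem_normalSpace_iff hy).2 (H.tangentProj_sff hy u v)

theorem sub_tangentProj_mem (H : LocalImmersion β U F) (hy : y ∈ U) (x : L) :
    x - tangentProj β F y x ∈ normalSpace β F y := by
  have hπ : tangentProj β F y (tangentProj β F y x) = tangentProj β F y x :=
    congr($(H.tangentProj_mul_tangentProj hy) x)
  rw [H.mem_normalSpace_iff hy, map_sub, hπ, sub_self]

/-- The second fundamental form with values in the normal space. -/
def normalSff (H : LocalImmersion β U F) (hy : y ∈ U) : E →ₗ[ℝ] E →ₗ[ℝ] normalSpace β F y :=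
  LinearMap.mk₂ ℝ (fun u v => ⟨sff β F y u v, H.sff_mem hy u v⟩)
    (by intros; ext1; simp [sff]) (by intros; ext1; simp [sff])
    (by intros; ext1; simp [sff]) (by intros; ext1; simp [sff])

theorem isRegular_normalSff_iff (H : LocalImmersion β U F) (hy : y ∈ U) {Z : E} :
    IsRegular (J y : E →ₗ[ℝ] E) (H.normalSff hy) Z ↔ IsRegularAt β F J y Z :=
  forall_congr' fun _ => imp_congr Subtype.ext_iff (imp_congr Subtype.ext_iff Iff.rfl)

theorem finrank_add_finrank_normalSpace [FiniteDimensional ℝ L] (H : LocalImmersion β U F)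
    (hy : y ∈ U) : finrank ℝ E + finrank ℝ (normalSpace β F y) = finrank ℝ L := by
  have hsurj : LinearMap.range (tangentCoord β F y : L →ₗ[ℝ] E) = ⊤ :=
    LinearMap.range_eq_top.2 (Function.RightInverse.surjective (H.tangentCoord_apply hy))
  rw [← (tangentCoord β F y : L →ₗ[ℝ] E).finrank_range_add_finrank_ker, hsurj, finrank_top]
  rfl

end LocalImmersion

namespace HyperbolicKaehler

theorem mono (H : HyperbolicKaehler β U F J) {V : Set E} (hV : IsOpen V) (hVU : V ⊆ U) :
    HyperbolicKaehler β V F J where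
  toLocalKaehler := H.toLocalKaehler.mono hV hVU
  norm_eq y hy := H.norm_eq y (hVU hy)
  nonneg := H.nonneg

theorem hasFDerivAt (H : HyperbolicKaehler β U F J) (hy : y ∈ U) :
    HasFDerivAt F (fderiv ℝ F y) y :=
  (H.differentiableAt H.smooth hy).hasFDerivAt

theorem beta_fderiv (H : HyperbolicKaehler β U F J) (hy : y ∈ U) (u : E) :
    β (F y) (fderiv ℝ F y u) = 0 := by
  have hconst := H.fderiv_congr (fun z hz => H.norm_eq z hz) hy
  have hβF := (β.hasFDerivAt.comp y (H.hasFDerivAt hy)).clm_apply (H.hasFDerivAt hy)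
  have h : β (F y) (fderiv ℝ F y u) + β (fderiv ℝ F y u) (F y) = 0 := by
    simpa using congr($(hβF.fderiv.symm.trans hconst) u)
  rw [H.symm (fderiv ℝ F y u)] at h
  linarith

variable [FiniteDimensional ℝ E]

theorem tangentProj_self (H : HyperbolicKaehler β U F J) (hy : y ∈ U) :
    tangentProj β F y (F y) = 0 :=
  H.nondeg _ fun _ => (H.beta_tangentProj hy _ _).trans (H.beta_fderiv hy _)

theorem beta_sff_self (H : HyperbolicKaehler β U F J) (hy : y ∈ U) (u v : E) :
    β (sff β F y u v) (F y) = -β (fderiv ℝ F y u) (fderiv ℝ F y v) := by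
  have hzero := H.fderiv_congr (fun z hz => H.beta_fderiv hz v) hy
  have hdF := (H.differentiableAt H.contDiffOn_fderiv hy).hasFDerivAt
  have hβF := (β.hasFDerivAt.comp y (H.hasFDerivAt hy)).clm_apply
    (hdF.clm_apply (hasFDerivAt_const v y))
  have h : β (F y) (fderiv ℝ (fderiv ℝ F) y u v) + β (fderiv ℝ F y u) (fderiv ℝ F y v) = 0 := by
    simpa using congr($(hβF.fderiv.symm.trans hzero) u)
  rw [H.fderiv_fderiv_apply hy, map_add, H.beta_fderiv hy, H.symm (F y)] at h
  linarith

theorem kaehlerPoint (H : HyperbolicKaehler β U F J) (hy : y ∈ U) :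
    KaehlerPoint (J y : E →ₗ[ℝ] E) (fun u v => β (fderiv ℝ F y u) (fderiv ℝ F y v))
      (normalForm β F y) (H.normalSff hy)
      ⟨F y, (H.mem_normalSpace_iff hy).2 (H.tangentProj_self hy)⟩ where
  J_J := H.J_J y hy
  g_J := H.orth y hy
  g_pos := H.pos y hy
  b_symm x z := H.symm _ _
  b_nondeg x hx := by
    refine Subtype.ext (H.nondeg _ fun z => ?_)
    have hnormal : β x (z - tangentProj β F y z) = 0 := hx ⟨_, H.sub_tangentProj_mem hy z⟩
    have htangent : β x (tangentProj β F y z) = 0 := by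
      rw [← H.beta_tangentProj hy, (H.mem_normalSpace_iff hy).1 x.2, map_zero, zero_apply]
    rwa [map_sub, htangent, sub_zero] at hnormal
  α_symm u v := Subtype.ext (H.sff_comm hy u v)
  kaehler u v w z := H.beta_sff_sff_sub hy u v w z
  α_f u v := H.beta_sff_self hy u v
  nonneg x hx := H.nonneg x (F y) (by rw [H.norm_eq y hy]; norm_num) hx

theorem sff_J_J [FiniteDimensional ℝ L] (H : HyperbolicKaehler β U F J)
    (hdim : 2 * finrank ℝ L ≤ 3 * finrank ℝ E) (hy : y ∈ U) {Z : E} (hZ : IsRegularAt β F J y Z)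
    (u v : E) : sff β F y (J y u) (J y v) = sff β F y u v := by
  have hW := H.finrank_add_finrank_normalSpace hy
  exact congrArg Subtype.val <|
    (H.kaehlerPoint hy).apply_J_J_of_isRegular ((H.isRegular_normalSff_iff hy).2 hZ) (by lia) u v

theorem eventually_isRegularAt (H : HyperbolicKaehler β U F J) (hy : y ∈ U) {Z : E}
    (hZ : IsRegularAt β F J y Z) : ∀ᶠ z in 𝓝 y, IsRegularAt β F J z Z := by
  let α (z v : E) : E →L[ℝ] L := (dTangentProj β F z).flip (fderiv ℝ F z v)
  let T (z : E) : E →L[ℝ] L × L :=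
    (α z Z + (α z (J z Z)).comp (J z)).prod (α z (J z Z) - (α z Z).comp (J z))
  have hT (z : E) : Function.Injective (T z) ↔ IsRegularAt β F J z Z := by
    rw [injective_iff_map_eq_zero]
    refine forall_congr' fun u => ?_
    rw [← and_imp]
    exact imp_congr Prod.ext_iff Iff.rfl
  have hU := H.isOpen.mem_nhds hy
  have hJ : ContinuousAt J y := (H.smooth_J.contDiffAt hU).continuousAt
  have hα {v : E → E} (hv : ContinuousAt v y) : ContinuousAt (fun z => α z (v z)) y :=
    ((ContinuousLinearMap.flipₗᵢ ℝ E L L).continuous.continuousAt.comp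
      (H.contDiffOn_dTangentProj.contDiffAt hU).continuousAt).clm_apply
      ((H.contDiffOn_fderiv.contDiffAt hU).continuousAt.clm_apply hv)
  have hαZ := hα (continuousAt_const (y := Z))
  have hαJZ := hα (hJ.clm_apply (continuousAt_const (y := Z)))
  have hT_cont : ContinuousAt T y :=
    (ContinuousLinearMap.prodₗᵢ ℝ :
      (E →L[ℝ] L) × (E →L[ℝ] L) ≃ₗᵢ[ℝ] (E →L[ℝ] L × L)).continuous.continuousAt.comp
      ((hαZ.add (hαJZ.clm_comp hJ)).prodMk (hαJZ.sub (hαZ.clm_comp hJ)))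
  exact (hT_cont.eventually (ContinuousLinearMap.isOpen_injective.mem_nhds ((hT y).2 hZ))).mono
    fun z hz => (hT z).1 hz

end HyperbolicKaehler

end HyperbolicKaehler

section Splitting

open Module Filter Topology

variable {E L : Type*} [NormedAddCommGroup E] [NormedSpace ℝ E]
  [NormedAddCommGroup L] [NormedSpace ℝ L]
  {β : L →L[ℝ] L →L[ℝ] ℝ} {F : E → L} {U : Set E} {J : E → E →L[ℝ] E} {y : E}

variable (β F) in
/-- The endomorphism of the tangent space at `y` induced by an endomorphism `P` of `L` that commutes
with the tangent projection. -/
def tangentRestrict (P : L →L[ℝ] L) (y : E) : E →L[ℝ] E :=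
  (tangentCoord β F y).comp (P.comp (fderiv ℝ F y))

/-- An orthogonal decomposition of `L` into subspaces of dimension at most three. -/
structure OrthogonalSplitting {κ : Type*} [Fintype κ] (β : L →L[ℝ] L →L[ℝ] ℝ)
    (P : κ → L →L[ℝ] L) : Prop where
  mul_self : ∀ i, P i * P i = P i
  mul_ne : ∀ i j, i ≠ j → P i * P j = 0
  sum_eq : ∀ x, ∑ i, P i x = x
  symm : ∀ i x z, β (P i x) z = β x (P i z)
  finrank_le : ∀ i, finrank ℝ (LinearMap.range (P i : L →ₗ[ℝ] L)) ≤ 3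

theorem OrthogonalSplitting.beta_apply_self {κ : Type*} [Fintype κ] {P : κ → L →L[ℝ] L}
    (HP : OrthogonalSplitting β P) (x : L) : β x x = ∑ i, β x (P i x) := by
  rw [← map_sum, HP.sum_eq]

variable [FiniteDimensional ℝ E]

section Commute

variable {P : L →L[ℝ] L}

theorem LocalImmersion.fderiv_tangentRestrict (H : LocalImmersion β U F) (hy : y ∈ U)
    (hP : Commute P (tangentProj β F y)) (u : E) :
    fderiv ℝ F y (tangentRestrict β F P y u) = P (fderiv ℝ F y u) := by
  have h : P (tangentProj β F y (fderiv ℝ F y u)) = tangentProj β F y (P (fderiv ℝ F y u)) :=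
    congr($(hP.eq) (fderiv ℝ F y u))
  rw [H.tangentProj_apply hy] at h
  exact h.symm

theorem LocalImmersion.finrank_range_tangentRestrict_le [FiniteDimensional ℝ L]
    (H : LocalImmersion β U F) (hy : y ∈ U) (hP : Commute P (tangentProj β F y)) :
    finrank ℝ (LinearMap.range (tangentRestrict β F P y : E →ₗ[ℝ] E)) ≤
      finrank ℝ (LinearMap.range (P : L →ₗ[ℝ] L)) := by
  rw [(Submodule.equivMapOfInjective (fderiv ℝ F y : E →ₗ[ℝ] L) (H.injective_fderiv hy)
    _).finrank_eq]
  refine Submodule.finrank_mono ?_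
  rintro _ ⟨_, ⟨u, rfl⟩, rfl⟩
  exact ⟨fderiv ℝ F y u, (H.fderiv_tangentRestrict hy hP u).symm⟩

theorem HyperbolicKaehler.fderiv_beta_self_eq_zero (H : HyperbolicKaehler β U F J) (hy : y ∈ U)
    (hsymm : ∀ x z, β (P x) z = β x (P z)) (hP : Commute P (tangentProj β F y)) :
    HasFDerivAt (fun z => β (P (F z)) (F z)) (0 : E →L[ℝ] ℝ) y := by
  have hF := H.hasFDerivAt hy
  refine (((β.comp P).hasFDerivAt.comp y hF).clm_apply hF).congr_fderiv
    (ContinuousLinearMap.ext fun u => ?_)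
  have hPF : β (F y) (P (fderiv ℝ F y u)) = 0 := by
    rw [← H.fderiv_tangentRestrict hy hP, H.beta_fderiv hy]
  change β (P (F y)) (fderiv ℝ F y u) + β (P (fderiv ℝ F y u)) (F y) = 0
  rw [hsymm, H.symm (P _), hPF, add_zero]

namespace CommutesAt

theorem tangentRestrict_J (hP : CommutesAt β F J P y) (H : LocalKaehler β U F J) (hy : y ∈ U)
    (u : E) : tangentRestrict β F P y (J y u) = J y (tangentRestrict β F P y u) := by
  apply H.injective_fderiv hy
  rw [H.fderiv_tangentRestrict hy hP.tangentProj, ← H.ambientJ_apply hy, ← H.ambientJ_apply hy,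
    H.fderiv_tangentRestrict hy hP.tangentProj]
  exact congr($(hP.ambientJ.eq) (fderiv ℝ F y u))

theorem apply_sff (hP : CommutesAt β F J P y) (H : LocalImmersion β U F) (hy : y ∈ U) (u v : E) :
    P (sff β F y u v) = sff β F y u (tangentRestrict β F P y v) := by
  rw [sff, sff, H.fderiv_tangentRestrict hy hP.tangentProj]
  exact congr($((hP.dTangentProj u).eq) (fderiv ℝ F y v))

theorem exists_generator [FiniteDimensional ℝ L] (hP : CommutesAt β F J P y)
    (H : LocalKaehler β U F J) (hy : y ∈ U)
    (hdim : finrank ℝ (LinearMap.range (P : L →ₗ[ℝ] L)) ≤ 3) :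
    ∃ Z, ∀ u, ∃ s t : ℝ, tangentRestrict β F P y u =
      s • tangentRestrict β F P y Z + t • J y (tangentRestrict β F P y Z) := by
  let Q : E →ₗ[ℝ] E := tangentRestrict β F P y
  have hJQ : ∀ u ∈ LinearMap.range Q, (J y : E →ₗ[ℝ] E) u ∈ LinearMap.range Q := by
    rintro _ ⟨u, rfl⟩
    exact ⟨J y u, hP.tangentRestrict_J H hy u⟩
  obtain ⟨⟨_, Z, rfl⟩, hZ⟩ := exists_forall_eq_smul_add_smul (J := (J y : E →ₗ[ℝ] E).restrict hJQ)
    (fun u => Subtype.ext (H.J_J y hy u))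
    ((H.finrank_range_tangentRestrict_le hy hP.tangentProj).trans hdim)
  refine ⟨Z, fun u => ?_⟩
  obtain ⟨s, t, h⟩ := hZ ⟨Q u, u, rfl⟩
  exact ⟨s, t, congrArg Subtype.val h⟩

end CommutesAt

end Commute

namespace HyperbolicKaehler

variable {κ : Type*} [Fintype κ] {P : κ → L →L[ℝ] L}

theorem beta_fderiv_tangentRestrict_eq_zero (H : HyperbolicKaehler β U F J) (hy : y ∈ U)
    {P : L →L[ℝ] L} (hP : CommutesAt β F J P y) {u Z : E}
    (hplus : sff β F y u Z + sff β F y (J y u) (J y Z) = 0)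
    (hminus : sff β F y u (J y Z) - sff β F y (J y u) Z = 0) :
    β (fderiv ℝ F y u) (fderiv ℝ F y (tangentRestrict β F P y Z)) = 0 ∧
      β (fderiv ℝ F y u) (fderiv ℝ F y (J y (tangentRestrict β F P y Z))) = 0 := by
  have hgJ (u v : E) : β (fderiv ℝ F y (J y u)) (fderiv ℝ F y v) =
      -β (fderiv ℝ F y u) (fderiv ℝ F y (J y v)) := (H.kaehlerPoint hy).g_J_left u v
  constructor
  · have h := congr(β (P $hplus) (F y))
    simp only [map_add, map_zero, add_apply, zero_apply, hP.apply_sff H.toLocalImmersion hy,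
      hP.tangentRestrict_J H.toLocalKaehler hy, H.beta_sff_self hy, H.orth y hy] at h
    linarith
  · have h := congr(β (P $hminus) (F y))
    simp only [map_sub, map_zero, sub_apply, zero_apply, hP.apply_sff H.toLocalImmersion hy,
      hP.tangentRestrict_J H.toLocalKaehler hy, H.beta_sff_self hy, hgJ] at h
    linarith

/- The sum of generators of the summands, which are complex lines, is regular. -/
theorem exists_isRegularAt [FiniteDimensional ℝ L] (H : HyperbolicKaehler β U F J) (hy : y ∈ U)
    (HP : OrthogonalSplitting β P) (hP : ∀ i, CommutesAt β F J (P i) y) :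
    ∃ Z, IsRegularAt β F J y Z := by
  let Q (i : κ) : E →L[ℝ] E := tangentRestrict β F (P i) y
  have hQ (i u) : fderiv ℝ F y (Q i u) = P i (fderiv ℝ F y u) :=
    H.fderiv_tangentRestrict hy (hP i).tangentProj u
  choose Z hZ using fun i => (hP i).exists_generator H.toLocalKaehler hy (HP.finrank_le i)
  have hQZ (i) : Q i (∑ j, Q j (Z j)) = Q i (Z i) := by
    apply H.injective_fderiv hy
    rw [map_sum, map_sum, Finset.sum_eq_single i _ (by simp), hQ, hQ]
    · exact congr($(HP.mul_self i) (fderiv ℝ F y (Z i)))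
    · intro j _ hj
      rw [hQ, hQ]
      exact congr($(HP.mul_ne i j hj.symm) (fderiv ℝ F y (Z j)))
  refine ⟨∑ j, Q j (Z j), fun u hplus hminus => ?_⟩
  by_contra hu
  refine (H.pos y hy u hu).ne' ?_
  rw [HP.beta_apply_self]
  refine Finset.sum_eq_zero fun i _ => ?_
  have horth := H.beta_fderiv_tangentRestrict_eq_zero hy (hP i) hplus hminus
  change β _ (fderiv ℝ F y (Q i _)) = 0 ∧ β _ (fderiv ℝ F y (J y (Q i _))) = 0 at horth
  obtain ⟨s, t, hst⟩ := hZ i u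
  change Q i u = s • Q i (Z i) + t • J y (Q i (Z i)) at hst
  rw [hQZ] at horth
  rw [← hQ, hst, map_add, map_add, map_smul, map_smul, map_smul, map_smul, horth.1, horth.2,
    smul_zero, smul_zero, add_zero]

theorem eventually_commutesAt_and_beta_eq [FiniteDimensional ℝ L] (H : HyperbolicKaehler β U F J)
    (hy : y ∈ U) (HP : OrthogonalSplitting β P) (hdim : 2 * finrank ℝ L ≤ 3 * finrank ℝ E)
    (hP : ∀ i, CommutesAt β F J (P i) y) :
    ∀ᶠ z in 𝓝 y, ∀ i, CommutesAt β F J (P i) z ∧ β (P i (F z)) (F z) = β (P i (F y)) (F y) := by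
  obtain ⟨Z, hZ⟩ := H.exists_isRegularAt hy HP hP
  obtain ⟨V, hV, hVo, hyV⟩ := eventually_nhds_iff.1
    ((H.eventually_isRegularAt hy hZ).and (H.isOpen.mem_nhds hy))
  have HV := H.mono hVo fun z hz => (hV z hz).2
  have hcov : ∀ z ∈ V, ∀ u v, covSff β F z u v = 0 := fun z hz u v =>
    HV.covSff_eq_zero (fun w hw => HV.sff_J_J hdim hw (hV w hw).1) hz u v
  refine eventually_all.2 fun i => ?_
  have hcomm := HV.eventually_commutesAt hcov hyV (hP i)
  refine hcomm.and ?_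
  have hderiv : ∀ᶠ z in 𝓝 y, HasFDerivAt
      (fun z => β (P i (F z)) (F z) - β (P i (F y)) (F y)) (0 : E →L[ℝ] ℝ) z := by
    filter_upwards [hcomm, hVo.mem_nhds hyV] with z hz hzV
    exact (HV.fderiv_beta_self_eq_zero hzV (HP.symm i) hz.tangentProj).sub_const _
  exact (eventually_eq_zero_of_fderiv_isBigO (hderiv.mono fun _ h => h.differentiableAt)
    ((Asymptotics.isBigO_zero _ _).congr' (hderiv.mono fun _ h => h.fderiv.symm) .rfl)
    (sub_self _)).mono fun _ => sub_eq_zero.1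

end HyperbolicKaehler

end Splitting

section LorentzForm

variable {ι : Type*} [Fintype ι] [DecidableEq ι] {o : ι} {x z : ι → ℝ}

theorem lorentz_eq (o : ι) (x z : ι → ℝ) :
    lorentz o x z = ∑ i ∈ Finset.univ.erase o, x i * z i - x o * z o := by
  have hne : ∀ i ∈ Finset.univ.erase o, (if i = o then -1 else 1) * (x i * z i) = x i * z i :=
    fun i hi => by rw [if_neg (Finset.ne_of_mem_erase hi), one_mul]
  rw [lorentz, ← Finset.add_sum_erase _ _ (Finset.mem_univ o), Finset.sum_congr rfl hne, if_pos rfl]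
  ring

/-- The Lorentzian inner product as a continuous bilinear form. -/
def lorentzForm (o : ι) : (ι → ℝ) →L[ℝ] (ι → ℝ) →L[ℝ] ℝ :=
  LinearMap.toContinuousBilinearMap <| LinearMap.mk₂ ℝ (lorentz o)
    (by intros; simp [lorentz, mul_add, add_mul, Finset.sum_add_distrib])
    (by intros; simp [lorentz, Finset.mul_sum, mul_assoc, mul_left_comm])
    (by intros; simp [lorentz, mul_add, Finset.sum_add_distrib])
    (by intros; simp [lorentz, Finset.mul_sum, mul_left_comm])

theorem lorentzForm_apply (o : ι) (x z : ι → ℝ) : lorentzForm o x z = lorentz o x z := rfl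

theorem lorentz_comm (o : ι) (x z : ι → ℝ) : lorentz o x z = lorentz o z x := by
  simp only [lorentz, mul_comm (x _)]

theorem lorentz_single (o : ι) (x : ι → ℝ) (i : ι) :
    lorentz o x (Pi.single i 1) = (if i = o then -1 else 1) * x i := by
  simp [lorentz, Pi.single_apply]

theorem eq_zero_of_lorentz_eq_zero (h : ∀ z, lorentz o x z = 0) : x = 0 := by
  ext i
  have hi := h (Pi.single i 1)
  rw [lorentz_single] at hi
  exact (mul_eq_zero.1 hi).resolve_left (by split_ifs <;> norm_num)

theorem sq_sum_erase_lt_of_lorentz_neg (hx : lorentz o x x < 0) (hz : lorentz o z z < 0) :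
    (∑ i ∈ Finset.univ.erase o, x i * z i) ^ 2 < (x o * z o) ^ 2 := by
  rw [lorentz_eq, sub_neg] at hx hz
  have hnonneg (w : ι → ℝ) : 0 ≤ ∑ i ∈ Finset.univ.erase o, w i * w i :=
    Finset.sum_nonneg fun i _ => mul_self_nonneg _
  calc (∑ i ∈ Finset.univ.erase o, x i * z i) ^ 2
      ≤ (∑ i ∈ Finset.univ.erase o, x i * x i) * ∑ i ∈ Finset.univ.erase o, z i * z i := by
        simpa only [sq] using Finset.sum_mul_sq_le_sq_mul_sq (Finset.univ.erase o) x z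
    _ < (x o * x o) * (z o * z o) := mul_lt_mul'' hx hz (hnonneg x) (hnonneg z)
    _ = (x o * z o) ^ 2 := by ring

theorem lorentz_self_nonneg_of_orthogonal (hz : lorentz o z z < 0) (hxz : lorentz o x z = 0) :
    0 ≤ lorentz o x x := by
  by_contra! hx
  rw [lorentz_eq, sub_eq_zero] at hxz
  exact (sq_sum_erase_lt_of_lorentz_neg hx hz).ne (by rw [hxz])

theorem pos_iff_lorentz_neg (hx : lorentz o x x < 0) (hz : lorentz o z z < 0) (hzo : 0 < z o) :
    0 < x o ↔ lorentz o x z < 0 := by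
  have habs := sq_lt_sq.1 (sq_sum_erase_lt_of_lorentz_neg hx hz)
  rw [lorentz_eq, sub_neg]
  constructor
  · intro hxo
    rw [abs_of_pos (mul_pos hxo hzo)] at habs
    exact (le_abs_self _).trans_lt habs
  · intro h
    by_contra! hxo
    rw [abs_of_nonpos (mul_nonpos_of_nonpos_of_nonneg hxo hzo.le)] at habs
    linarith [neg_abs_le (∑ i ∈ Finset.univ.erase o, x i * z i)]

theorem lorentz_self_neg_of_mem_hyperboloid {c : ℝ} (hc : c < 0) (hx : x ∈ hyperboloid o c) :
    lorentz o x x < 0 :=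
  hx.1.trans_lt (one_div_neg.2 hc)

theorem image_hyperboloid {ι' : Type*} [Fintype ι'] [DecidableEq ι'] {o' : ι'}
    (Φ : (ι → ℝ) ≃ₗ[ℝ] (ι' → ℝ)) (hΦ : ∀ x z, lorentz o' (Φ x) (Φ z) = lorentz o x z)
    (ho : 0 < Φ (Pi.single o 1) o') {c : ℝ} (hc : c < 0) :
    Φ '' hyperboloid o c = hyperboloid o' c := by
  have hsingle : lorentz o (Pi.single o 1) (Pi.single o 1) = -1 := by simp [lorentz_single]
  have hpos (x) (hx : lorentz o x x = 1 / c) : 0 < Φ x o' ↔ 0 < x o := by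
    have hneg : lorentz o x x < 0 := hx ▸ one_div_neg.2 hc
    rw [pos_iff_lorentz_neg (by rwa [hΦ]) (by rw [hΦ, hsingle]; norm_num) ho, hΦ, lorentz_single,
      if_pos rfl, neg_one_mul, neg_lt_zero]
  ext w
  constructor
  · rintro ⟨x, ⟨hx, hxo⟩, rfl⟩
    exact ⟨by rw [hΦ, hx], (hpos x hx).2 hxo⟩
  · rintro ⟨hw, hwo⟩
    obtain ⟨x, rfl⟩ := Φ.surjective w
    rw [hΦ] at hw
    exact ⟨x, ⟨hw, (hpos x hw).1 hwo⟩, rfl⟩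

end LorentzForm

section Frames

open Module

variable {L : Type*} [NormedAddCommGroup L] [NormedSpace ℝ L] {β : L →L[ℝ] L →L[ℝ] ℝ}

theorem sum_orthogonal_expansion {ι : Type*} [Fintype ι] {e : ι → L}
    (horth : ∀ a b, a ≠ b → β (e a) (e b) = 0) (hne : ∀ a, β (e a) (e a) ≠ 0)
    (hspan : ⊤ ≤ Submodule.span ℝ (Set.range e)) (x : L) :
    ∑ a, (β x (e a) / β (e a) (e a)) • e a = x := by
  obtain ⟨c, rfl⟩ := (Submodule.mem_span_range_iff_exists_fun ℝ).1
    (hspan (Submodule.mem_top (x := x)))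
  refine Finset.sum_congr rfl fun a _ => ?_
  congr 1
  rw [map_sum, sum_apply, Finset.sum_eq_single a _ (by simp), map_smul, smul_apply, smul_eq_mul,
    mul_div_cancel_right₀ _ (hne a)]
  intro b _ hb
  rw [map_smul, smul_apply, horth b a hb, smul_zero]

theorem span_eq_top_of_orthogonal [FiniteDimensional ℝ L] {ι : Type*} [Fintype ι] {e : ι → L}
    (horth : ∀ a b, a ≠ b → β (e a) (e b) = 0) (hne : ∀ a, β (e a) (e a) ≠ 0)
    (hcard : Fintype.card ι = finrank ℝ L) : ⊤ ≤ Submodule.span ℝ (Set.range e) :=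
  ((LinearMap.linearIndependent_of_isOrthoᵢ (B := β.toLinearMap₁₂) (fun a b hab => horth a b hab)
    hne).span_eq_top_of_card_eq_finrank' hcard).ge

theorem exists_beta_self_neg {ι : Type*} [Finite ι] {e : ι → L}
    (horth : ∀ a b, a ≠ b → β (e a) (e b) = 0) (hne : ∀ a, β (e a) (e a) ≠ 0)
    (hspan : ⊤ ≤ Submodule.span ℝ (Set.range e)) {x : L} (hx : β x x < 0) :
    ∃ a, β (e a) (e a) < 0 := by
  cases nonempty_fintype ι
  by_contra! h
  refine hx.not_ge ?_
  rw [← congr(β x $(sum_orthogonal_expansion horth hne hspan x)), map_sum]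
  refine Finset.sum_nonneg fun a _ => ?_
  rw [map_smul, smul_eq_mul, div_mul_eq_mul_div]
  exact div_nonneg (mul_self_nonneg _) (h a)

/-- The multiple of `x` whose `β`-norm is `±1`. It is `0` if `x` is null. -/
def normalize (β : L →L[ℝ] L →L[ℝ] ℝ) (x : L) : L := (√|β x x|)⁻¹ • x

theorem beta_normalize_normalize (x z : L) :
    β (normalize β x) (normalize β z) = (√|β x x|)⁻¹ * (√|β z z|)⁻¹ * β x z := by
  simp only [normalize, map_smul, smul_apply, smul_eq_mul]
  ring

theorem beta_normalize_self (x : L) : β (normalize β x) (normalize β x) = β x x / |β x x| := by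
  rw [beta_normalize_normalize, ← mul_inv, Real.mul_self_sqrt (abs_nonneg _), inv_mul_eq_div]

variable {κ : Type*} {e : κ × Fin 3 → L}

/-- The orthogonal projection to the span of the three frame vectors with index `i`. -/
def blockProj (β : L →L[ℝ] L →L[ℝ] ℝ) (e : κ × Fin 3 → L) (i : κ) : L →L[ℝ] L :=
  ∑ k, ((β (e (i, k)) (e (i, k)))⁻¹ • β.flip (e (i, k))).smulRight (e (i, k))

theorem blockProj_apply (i : κ) (x : L) :
    blockProj β e i x = ∑ k, (β x (e (i, k)) / β (e (i, k)) (e (i, k))) • e (i, k) := by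
  simp only [blockProj, sum_apply, ContinuousLinearMap.smulRight_apply,
    smul_apply, ContinuousLinearMap.flip_apply, smul_eq_mul, div_eq_inv_mul]

theorem blockProj_self (horth : ∀ a b, a ≠ b → β (e a) (e b) = 0) (hne : ∀ a, β (e a) (e a) ≠ 0)
    (i : κ) (k : Fin 3) : blockProj β e i (e (i, k)) = e (i, k) := by
  rw [blockProj_apply, Finset.sum_eq_single k
    (fun l _ hl => by rw [horth (i, k) (i, l) (by simpa using hl.symm), zero_div, zero_smul])
    (by simp), div_self (hne _), one_smul]

theorem blockProj_eq_zero {i : κ} {x : L} (hx : ∀ k, β x (e (i, k)) = 0) :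
    blockProj β e i x = 0 := by
  rw [blockProj_apply]
  exact Finset.sum_eq_zero fun k _ => by rw [hx, zero_div, zero_smul]

theorem blockProj_of_ne (horth : ∀ a b, a ≠ b → β (e a) (e b) = 0) {i j : κ} (hij : i ≠ j)
    (k : Fin 3) : blockProj β e i (e (j, k)) = 0 :=
  blockProj_eq_zero fun l => horth _ _ (by simp [hij.symm])

theorem finrank_range_blockProj_le (i : κ) :
    finrank ℝ (LinearMap.range (blockProj β e i : L →ₗ[ℝ] L)) ≤ 3 := by
  have hle : LinearMap.range (blockProj β e i : L →ₗ[ℝ] L) ≤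
      Submodule.span ℝ (Set.range fun k => e (i, k)) := by
    rintro _ ⟨x, rfl⟩
    rw [ContinuousLinearMap.coe_coe, blockProj_apply]
    exact Submodule.sum_mem _ fun k _ => Submodule.smul_mem _ _ (Submodule.subset_span ⟨k, rfl⟩)
  have := FiniteDimensional.span_of_finite ℝ (Set.finite_range fun k => e (i, k))
  have hcard := finrank_range_le_card (R := ℝ) fun k => e (i, k)
  rw [Fintype.card_fin] at hcard
  exact (Submodule.finrank_mono hle).trans hcard

theorem orthogonalSplitting_blockProj [Fintype κ] (hsymm : ∀ x z, β x z = β z x)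
    (horth : ∀ a b, a ≠ b → β (e a) (e b) = 0) (hne : ∀ a, β (e a) (e a) ≠ 0)
    (hspan : ⊤ ≤ Submodule.span ℝ (Set.range e)) :
    OrthogonalSplitting β (blockProj β e) where
  mul_self i := by
    ext x
    rw [clm_mul_apply, blockProj_apply i x, map_sum]
    simp only [map_smul, blockProj_self horth hne]
  mul_ne i j hij := by
    ext x
    rw [clm_mul_apply, blockProj_apply j x, map_sum]
    simp only [map_smul, blockProj_of_ne horth hij, smul_zero, Finset.sum_const_zero, zero_apply]
  sum_eq x := by
    conv_rhs => rw [← sum_orthogonal_expansion horth hne hspan x, Fintype.sum_prod_type]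
    simp only [blockProj_apply]
  symm i x z := by
    simp only [blockProj_apply, map_sum, map_smul, sum_apply, smul_apply, smul_eq_mul]
    refine Finset.sum_congr rfl fun k _ => ?_
    rw [hsymm (e (i, k)) z]
    ring
  finrank_le := finrank_range_blockProj_le

theorem commute_blockProj [Finite κ] (horth : ∀ a b, a ≠ b → β (e a) (e b) = 0)
    (hne : ∀ a, β (e a) (e a) ≠ 0) (hspan : ⊤ ≤ Submodule.span ℝ (Set.range e))
    {T : L →L[ℝ] L} (hT : ∀ i j k l, i ≠ j → β (T (e (i, k))) (e (j, l)) = 0) (i : κ) :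
    Commute (blockProj β e i) T := by
  classical
  cases nonempty_fintype κ
  have hframe (j k) : blockProj β e i (T (e (j, k))) = T (blockProj β e i (e (j, k))) := by
    by_cases hij : i = j
    · subst hij
      rw [blockProj_self horth hne]
      conv_rhs => rw [← sum_orthogonal_expansion horth hne hspan (T (e (i, k)))]
      rw [Fintype.sum_prod_type, Finset.sum_eq_single i _ (by simp), blockProj_apply]
      exact fun j _ hj =>
        Finset.sum_eq_zero fun l _ => by rw [hT i j k l hj.symm, zero_div, zero_smul]
    · rw [blockProj_eq_zero fun l => hT j i k l (Ne.symm hij), blockProj_of_ne horth hij, map_zero]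
  refine ContinuousLinearMap.ext fun x => ?_
  rw [clm_mul_apply, clm_mul_apply]
  conv => congr <;> rw [← sum_orthogonal_expansion horth hne hspan x]
  simp only [map_sum, map_smul, hframe]

end Frames

section AdaptedFrame

open Module

variable {E L : Type*} [NormedAddCommGroup E] [NormedSpace ℝ E] [NormedAddCommGroup L]
  [NormedSpace ℝ L] {β : L →L[ℝ] L →L[ℝ] ℝ} {F : E → L} {U : Set E} {J : E → E →L[ℝ] E} {y : E}
  {κ : Type*}

/-- The vectors `X i` diagonalize the second fundamental form at `y` over the complex numbers. -/
structure IsDiagonal (β : L →L[ℝ] L →L[ℝ] ℝ) (F : E → L) (J : E → E →L[ℝ] E) (y : E) (X : κ → E) :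
    Prop where
  ne_zero : ∀ i, X i ≠ 0
  sff_J_J : ∀ u v, sff β F y (J y u) (J y v) = sff β F y u v
  sff_eq_zero : ∀ i j, i ≠ j → sff β F y (X i) (X j) = 0
  sff_J_eq_zero : ∀ i j, i ≠ j → sff β F y (X i) (J y (X j)) = 0
  orthogonal : ∀ i j, i ≠ j → β (sff β F y (X i) (X i)) (sff β F y (X j) (X j)) = 0
  ne : ∀ i, β (sff β F y (X i) (X i)) (sff β F y (X i) (X i)) ≠ 0

theorem IsDiagonal.comp {κ' : Type*} {X : κ → E} (h : IsDiagonal β F J y X) {σ : κ' → κ}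
    (hσ : Function.Injective σ) : IsDiagonal β F J y (X ∘ σ) where
  ne_zero _ := h.ne_zero _
  sff_J_J := h.sff_J_J
  sff_eq_zero _ _ hij := h.sff_eq_zero _ _ (hσ.ne hij)
  sff_J_eq_zero _ _ hij := h.sff_J_eq_zero _ _ (hσ.ne hij)
  orthogonal _ _ hij := h.orthogonal _ _ (hσ.ne hij)
  ne _ := h.ne _

variable (β F J) in
/-- The frame of `L` formed by the vectors `α(X i, X i)`, `F_* X i` and `F_* J X i`. -/
def diagonalFrame (y : E) (X : κ → E) (a : κ × Fin 3) : L :=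
  ![sff β F y (X a.1) (X a.1), fderiv ℝ F y (X a.1), fderiv ℝ F y (J y (X a.1))] a.2

theorem HyperbolicKaehler.exists_isDiagonal [FiniteDimensional ℝ E] [FiniteDimensional ℝ L]
    (H : HyperbolicKaehler β U F J) (hy : y ∈ U) {k : ℕ}
    (hL : finrank ℝ L = finrank ℝ E + k) (hE : 2 * k ≤ finrank ℝ E) {Z : E}
    (hZ : IsRegularAt β F J y Z) :
    finrank ℝ E = 2 * k ∧ ∃ X : Fin k → E, IsDiagonal β F J y X := by
  have hW := H.finrank_add_finrank_normalSpace hy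
  obtain rfl : finrank ℝ (normalSpace β F y) = k := by lia
  have hK := H.kaehlerPoint hy
  have hreg := (H.isRegular_normalSff_iff hy).2 hZ
  obtain ⟨X, hX₀, hX, horth, hne⟩ := hK.exists_diagonal hreg hE
  exact ⟨hK.finrank_eq_of_isRegular hreg hE, X,
    { ne_zero := hX₀
      sff_J_J := fun u v => congrArg Subtype.val (hK.apply_J_J_of_isRegular hreg hE u v)
      sff_eq_zero := fun i j hij => congrArg Subtype.val (hX i j hij).1
      sff_J_eq_zero := fun i j hij => congrArg Subtype.val (hX i j hij).2
      orthogonal := horth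
      ne := hne }⟩

theorem LocalImmersion.beta_dTangentProj_of_tangentProj_eq_zero [FiniteDimensional ℝ E]
    (H : LocalImmersion β U F) (hy : y ∈ U) (v : E) {ξ η : L}
    (hξ : tangentProj β F y ξ = 0) (hη : tangentProj β F y η = 0) :
    β (dTangentProj β F y v ξ) η = 0 := by
  rw [H.dTangentProj_eq hy v, add_apply, clm_mul_apply, clm_mul_apply, hξ, map_zero,
    add_zero, H.beta_tangentProj hy, hη, map_zero]

namespace IsDiagonal

variable {X : κ → E}

theorem sff_J_left (h : IsDiagonal β F J y X) (H : HyperbolicKaehler β U F J) (hy : y ∈ U)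
    (u v : E) : sff β F y (J y u) v = -sff β F y u (J y v) :=
  eq_neg_of_add_eq_zero_left (H.sff_J_add_sff_J h.sff_J_J hy u v)

theorem frame_pos (h : IsDiagonal β F J y X) (H : HyperbolicKaehler β U F J) (hy : y ∈ U)
    (i : κ) {k : Fin 3} (hk : k ≠ 0) :
    0 < β (diagonalFrame β F J y X (i, k)) (diagonalFrame β F J y X (i, k)) := by
  have hpos := H.pos y hy (X i) (h.ne_zero i)
  fin_cases k
  · exact absurd rfl hk
  · exact hpos
  · exact hpos.trans_eq (H.orth y hy _ _).symm

theorem frame_ne (h : IsDiagonal β F J y X) (H : HyperbolicKaehler β U F J) (hy : y ∈ U)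
    (a : κ × Fin 3) : β (diagonalFrame β F J y X a) (diagonalFrame β F J y X a) ≠ 0 := by
  obtain ⟨i, k⟩ := a
  rcases eq_or_ne k 0 with rfl | hk
  · exact h.ne i
  · exact (h.frame_pos H hy i hk).ne'

variable [FiniteDimensional ℝ E]

theorem sff_J_self (h : IsDiagonal β F J y X) (H : HyperbolicKaehler β U F J) (hy : y ∈ U) (u : E) :
    sff β F y u (J y u) = 0 := by
  have hneg := h.sff_J_left H hy u u
  rw [H.sff_comm hy, eq_neg_iff_add_eq_zero, ← two_smul ℝ] at hneg
  exact (smul_eq_zero.1 hneg).resolve_left two_ne_zero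

theorem beta_fderiv_fderiv_eq_zero (h : IsDiagonal β F J y X) (H : HyperbolicKaehler β U F J)
    (hy : y ∈ U) {i j : κ} (hij : i ≠ j) :
    β (fderiv ℝ F y (X i)) (fderiv ℝ F y (X j)) = 0 := by
  rw [← neg_eq_zero, ← H.beta_sff_self hy, h.sff_eq_zero i j hij, map_zero, zero_apply]

theorem beta_fderiv_fderiv_J_eq_zero (h : IsDiagonal β F J y X) (H : HyperbolicKaehler β U F J)
    (hy : y ∈ U) {i j : κ} (hij : i ≠ j) :
    β (fderiv ℝ F y (X i)) (fderiv ℝ F y (J y (X j))) = 0 := by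
  rw [← neg_eq_zero, ← H.beta_sff_self hy, h.sff_J_eq_zero i j hij, map_zero, zero_apply]

theorem frame_orthogonal (h : IsDiagonal β F J y X) (H : HyperbolicKaehler β U F J) (hy : y ∈ U)
    (a b : κ × Fin 3) (hab : a ≠ b) :
    β (diagonalFrame β F J y X a) (diagonalFrame β F J y X b) = 0 := by
  obtain ⟨i, k⟩ := a
  obtain ⟨j, l⟩ := b
  have hnormal (u v w) : β (fderiv ℝ F y w) (sff β F y u v) = 0 := by rw [H.symm, H.beta_sff hy]
  have hJ (u) : β (fderiv ℝ F y u) (fderiv ℝ F y (J y u)) = 0 := (H.kaehlerPoint hy).g_J_self u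
  by_cases hij : i = j
  · subst hij
    have hkl : k ≠ l := fun hkl => hab (by rw [hkl])
    fin_cases k <;> fin_cases l <;>
      first
      | exact absurd rfl hkl
      | exact H.beta_sff hy _ _ _
      | exact hnormal _ _ _
      | exact hJ _
      | exact (H.symm _ _).trans (hJ _)
  · have hX := h.beta_fderiv_fderiv_eq_zero H hy hij
    fin_cases k <;> fin_cases l <;>
      first
      | exact h.orthogonal i j hij
      | exact H.beta_sff hy _ _ _
      | exact hnormal _ _ _
      | exact hX
      | exact h.beta_fderiv_fderiv_J_eq_zero H hy hij
      | exact (H.symm _ _).trans (h.beta_fderiv_fderiv_J_eq_zero H hy (Ne.symm hij))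
      | exact (H.orth y hy _ _).trans hX

theorem frame_pos_of_ne (h : IsDiagonal β F J y X) (H : HyperbolicKaehler β U F J) (hy : y ∈ U)
    {i : κ} (hi : β (diagonalFrame β F J y X (i, 0)) (diagonalFrame β F J y X (i, 0)) < 0)
    {a : κ × Fin 3} (ha : a ≠ (i, 0)) :
    0 < β (diagonalFrame β F J y X a) (diagonalFrame β F J y X a) :=
  (H.nonneg _ _ hi (h.frame_orthogonal H hy _ _ ha)).lt_of_ne' (h.frame_ne H hy a)

theorem beta_tangentProj_frame (h : IsDiagonal β F J y X) (H : HyperbolicKaehler β U F J)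
    (hy : y ∈ U) (i j : κ) (k l : Fin 3) (hij : i ≠ j) :
    β (tangentProj β F y (diagonalFrame β F J y X (i, k))) (diagonalFrame β F J y X (j, l)) =
      0 := by
  have horth (k') := h.frame_orthogonal H hy (i, k') (j, l) (by simp [hij])
  fin_cases k
  · change β (tangentProj β F y (sff β F y (X i) (X i))) _ = 0
    rw [H.tangentProj_sff hy, map_zero, zero_apply]
  · change β (tangentProj β F y (fderiv ℝ F y (X i))) _ = 0
    rw [H.tangentProj_apply hy]
    exact horth 1
  · change β (tangentProj β F y (fderiv ℝ F y (J y (X i)))) _ = 0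
    rw [H.tangentProj_apply hy]
    exact horth 2

theorem beta_ambientJ_frame (h : IsDiagonal β F J y X) (H : HyperbolicKaehler β U F J) (hy : y ∈ U)
    (i j : κ) (k l : Fin 3) (hij : i ≠ j) :
    β (ambientJ β F J y (diagonalFrame β F J y X (i, k))) (diagonalFrame β F J y X (j, l)) = 0 := by
  have horth (k') := h.frame_orthogonal H hy (i, k') (j, l) (by simp [hij])
  fin_cases k
  · change β (fderiv ℝ F y (J y (tangentCoord β F y (sff β F y (X i) (X i))))) _ = 0
    rw [mem_normalSpace.1 (H.sff_mem hy _ _), map_zero, map_zero, map_zero, zero_apply]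
  · change β (ambientJ β F J y (fderiv ℝ F y (X i))) _ = 0
    rw [H.ambientJ_apply hy]
    exact horth 2
  · change β (ambientJ β F J y (fderiv ℝ F y (J y (X i)))) _ = 0
    rw [H.ambientJ_apply hy, H.J_J y hy, map_neg, map_neg, neg_apply, neg_eq_zero]
    exact horth 1

section Span

variable [Fintype κ] [FiniteDimensional ℝ L]

theorem span_frame (h : IsDiagonal β F J y X) (H : HyperbolicKaehler β U F J) (hy : y ∈ U)
    (hcard : Fintype.card (κ × Fin 3) = finrank ℝ L) :
    ⊤ ≤ Submodule.span ℝ (Set.range (diagonalFrame β F J y X)) :=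
  span_eq_top_of_orthogonal (h.frame_orthogonal H hy) (h.frame_ne H hy) hcard

theorem exists_eq_sum_smul (h : IsDiagonal β F J y X) (H : HyperbolicKaehler β U F J) (hy : y ∈ U)
    (hcard : Fintype.card (κ × Fin 3) = finrank ℝ L) (v : E) :
    ∃ r s : κ → ℝ, v = ∑ i, (r i • X i + s i • J y (X i)) := by
  have hexp := sum_orthogonal_expansion (h.frame_orthogonal H hy) (h.frame_ne H hy)
    (h.span_frame H hy hcard) (fderiv ℝ F y v)
  have hnormal (i) : β (fderiv ℝ F y v) (diagonalFrame β F J y X (i, 0)) = 0 := by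
    rw [H.symm]
    exact H.beta_sff hy _ _ _
  simp only [Fintype.sum_prod_type, Fin.sum_univ_three, hnormal, zero_div, zero_smul,
    zero_add] at hexp
  let coeff (k : Fin 3) (i : κ) : ℝ := β (fderiv ℝ F y v) (diagonalFrame β F J y X (i, k)) /
    β (diagonalFrame β F J y X (i, k)) (diagonalFrame β F J y X (i, k))
  refine ⟨coeff 1, coeff 2, H.injective_fderiv hy (hexp.symm.trans ?_)⟩
  simp only [map_sum, map_add, map_smul]
  rfl

theorem sff_mem_span (h : IsDiagonal β F J y X) (H : HyperbolicKaehler β U F J) (hy : y ∈ U)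
    (hcard : Fintype.card (κ × Fin 3) = finrank ℝ L) (v : E) (j : κ) :
    sff β F y v (X j) ∈ Submodule.span ℝ {sff β F y (X j) (X j)} := by
  obtain ⟨r, s, rfl⟩ := h.exists_eq_sum_smul H hy hcard v
  have hsum : sff β F y (∑ i, (r i • X i + s i • J y (X i))) (X j) =
      ∑ i, (r i • sff β F y (X i) (X j) + s i • sff β F y (J y (X i)) (X j)) := by
    simp only [sff, map_sum, map_add, map_smul, sum_apply, add_apply, smul_apply]
  have hJ (i) : sff β F y (J y (X i)) (X j) = 0 := by
    rw [h.sff_J_left H hy, neg_eq_zero]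
    rcases eq_or_ne i j with rfl | hij
    · exact h.sff_J_self H hy _
    · exact h.sff_J_eq_zero i j hij
  rw [hsum]
  refine Submodule.sum_mem _ fun i _ => ?_
  rw [hJ, smul_zero, add_zero]
  refine Submodule.smul_mem _ _ ?_
  rcases eq_or_ne i j with rfl | hij
  · exact Submodule.mem_span_singleton_self _
  · rw [h.sff_eq_zero i j hij]
    exact Submodule.zero_mem _

theorem dTangentProj_frame_mem_span (h : IsDiagonal β F J y X) (H : HyperbolicKaehler β U F J)
    (hy : y ∈ U) (hcard : Fintype.card (κ × Fin 3) = finrank ℝ L) (v : E) (j : κ) {k : Fin 3}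
    (hk : k ≠ 0) : dTangentProj β F y v (diagonalFrame β F J y X (j, k)) ∈
      Submodule.span ℝ {diagonalFrame β F J y X (j, 0)} := by
  fin_cases k
  · exact absurd rfl hk
  · exact h.sff_mem_span H hy hcard v j
  · change sff β F y v (J y (X j)) ∈ _
    rw [← neg_neg (sff β F y v _), ← h.sff_J_left H hy]
    exact Submodule.neg_mem _ (h.sff_mem_span H hy hcard (J y v) j)

theorem beta_dTangentProj_frame (h : IsDiagonal β F J y X) (H : HyperbolicKaehler β U F J)
    (hy : y ∈ U) (hcard : Fintype.card (κ × Fin 3) = finrank ℝ L) (v : E)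
    (i j : κ) (k l : Fin 3) (hij : i ≠ j) :
    β (dTangentProj β F y v (diagonalFrame β F J y X (i, k))) (diagonalFrame β F J y X (j, l)) =
      0 := by
  have htangent {i j} (hij : i ≠ j) {k : Fin 3} (hk : k ≠ 0) (l : Fin 3) :
      β (dTangentProj β F y v (diagonalFrame β F J y X (i, k))) (diagonalFrame β F J y X (j, l)) =
        0 := by
    obtain ⟨r, hr⟩ := Submodule.mem_span_singleton.1
      (h.dTangentProj_frame_mem_span H hy hcard v i hk)
    rw [← hr, map_smul, smul_apply, h.frame_orthogonal H hy (i, 0) (j, l) (by simp [hij]),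
      smul_zero]
  by_cases hk : k = 0
  · by_cases hl : l = 0
    · subst hk hl
      exact H.beta_dTangentProj_of_tangentProj_eq_zero hy v (H.tangentProj_sff hy _ _)
        (H.tangentProj_sff hy _ _)
    · rw [H.beta_dTangentProj hy, H.symm]
      exact htangent hij.symm hl k
  · exact htangent hij hk l

theorem exists_timelike (h : IsDiagonal β F J y X) (H : HyperbolicKaehler β U F J) (hy : y ∈ U)
    (hcard : Fintype.card (κ × Fin 3) = finrank ℝ L) :
    ∃ i, β (diagonalFrame β F J y X (i, 0)) (diagonalFrame β F J y X (i, 0)) < 0 := by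
  obtain ⟨⟨i, k⟩, hneg⟩ := exists_beta_self_neg (h.frame_orthogonal H hy) (h.frame_ne H hy)
    (h.span_frame H hy hcard) ((H.norm_eq y hy).trans_lt neg_one_lt_zero)
  obtain rfl : k = 0 := by_contra fun hk => hneg.not_gt (h.frame_pos H hy i hk)
  exact ⟨i, hneg⟩

end Span

end IsDiagonal

/-- An orthonormal frame of a Lorentzian form `β` whose only timelike vector is `b o`. -/
structure LorentzFrame {ι : Type*} [DecidableEq ι] (β : L →L[ℝ] L →L[ℝ] ℝ) (o : ι) (b : ι → L) :
    Prop where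
  orthogonal : ∀ a a', a ≠ a' → β (b a) (b a') = 0
  norm_eq : ∀ a, β (b a) (b a) = if a = o then -1 else 1

/-- A Lorentzian frame whose blocks of three vectors are invariant under the projection to the
tangent space, its derivative and the complex structure at `y`, and such that the position vector
`F y` has a negative product with the first vector of each block and is orthogonal to the others. -/
structure AdaptedFrame {p : ℕ} (β : L →L[ℝ] L →L[ℝ] ℝ) (F : E → L) (J : E → E →L[ℝ] E) (y : E)
    (b : Fin (p + 1) × Fin 3 → L) : Prop extends LorentzFrame β (0, 0) b where
  commutesAt : ∀ i, CommutesAt β F J (blockProj β b i) y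
  beta_self_neg : ∀ i, β (b (i, 0)) (F y) < 0
  beta_self_eq_zero : ∀ i k, k ≠ 0 → β (b (i, k)) (F y) = 0

variable [FiniteDimensional ℝ E] [FiniteDimensional ℝ L]

theorem commute_blockProj_normalize [Fintype κ] {e : κ × Fin 3 → L}
    (horth : ∀ a b, a ≠ b → β (e a) (e b) = 0) (hne : ∀ a, β (e a) (e a) ≠ 0)
    (hcard : Fintype.card (κ × Fin 3) = finrank ℝ L)
    {T : L →L[ℝ] L} (hT : ∀ i j k l, i ≠ j → β (T (e (i, k))) (e (j, l)) = 0) (i : κ) :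
    Commute (blockProj β (fun a => normalize β (e a)) i) T := by
  have horth' (a b) (hab : a ≠ b) : β (normalize β (e a)) (normalize β (e b)) = 0 := by
    rw [beta_normalize_normalize, horth a b hab, mul_zero]
  have hne' (a) : β (normalize β (e a)) (normalize β (e a)) ≠ 0 := by
    rw [beta_normalize_self]
    exact div_ne_zero (hne a) (abs_ne_zero.2 (hne a))
  refine commute_blockProj horth' hne' (span_eq_top_of_orthogonal horth' hne' hcard)
    (fun i j k l hij => ?_) i
  simp only [normalize, map_smul, smul_apply, hT i j k l hij, smul_zero]

theorem IsDiagonal.adaptedFrame_normalize {p : ℕ} {X : Fin (p + 1) → E}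
    (h : IsDiagonal β F J y X) (H : HyperbolicKaehler β U F J) (hy : y ∈ U)
    (hcard : Fintype.card (Fin (p + 1) × Fin 3) = finrank ℝ L)
    (hneg : β (diagonalFrame β F J y X (0, 0)) (diagonalFrame β F J y X (0, 0)) < 0) :
    AdaptedFrame β F J y fun a => normalize β (diagonalFrame β F J y X a) := by
  have horth := h.frame_orthogonal H hy
  have hne := h.frame_ne H hy
  have hcomm {T : L →L[ℝ] L} := commute_blockProj_normalize (T := T) horth hne hcard
  exact
    { orthogonal := fun a a' haa' => by rw [beta_normalize_normalize, horth a a' haa', mul_zero]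
      norm_eq := fun a => by
        rw [beta_normalize_self]
        split_ifs with ha
        · rw [ha, abs_of_neg hneg, div_neg_self hneg.ne]
        · rw [abs_of_pos (h.frame_pos_of_ne H hy hneg ha), div_self (hne a)]
      commutesAt := fun i =>
        { tangentProj := hcomm (h.beta_tangentProj_frame H hy) i
          dTangentProj := fun v => hcomm (h.beta_dTangentProj_frame H hy hcard v) i
          ambientJ := hcomm (h.beta_ambientJ_frame H hy) i }
      beta_self_neg := fun i => by
        rw [normalize, map_smul, smul_apply, smul_eq_mul]
        refine mul_neg_of_pos_of_neg (inv_pos.2 (Real.sqrt_pos.2 (abs_pos.2 (hne _)))) ?_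
        exact (H.beta_sff_self hy _ _).trans_lt (neg_neg_of_pos (H.pos y hy _ (h.ne_zero i)))
      beta_self_eq_zero := fun i k hk => by
        have htangent (v) : β (fderiv ℝ F y v) (F y) = 0 := by rw [H.symm, H.beta_fderiv hy]
        have hframe : β (diagonalFrame β F J y X (i, k)) (F y) = 0 := by
          fin_cases k
          · exact absurd rfl hk
          · exact htangent _
          · exact htangent _
        rw [normalize, map_smul, smul_apply, hframe, smul_zero] }

theorem HyperbolicKaehler.exists_adaptedFrame (H : HyperbolicKaehler β U F J) (hy : y ∈ U) {p : ℕ}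
    (hL : finrank ℝ L = finrank ℝ E + (p + 1)) (hE : 2 * (p + 1) ≤ finrank ℝ E) {Z : E}
    (hZ : IsRegularAt β F J y Z) :
    finrank ℝ E = 2 * (p + 1) ∧ ∃ b : Fin (p + 1) × Fin 3 → L, AdaptedFrame β F J y b := by
  obtain ⟨hE', X, hX⟩ := H.exists_isDiagonal hy hL hE hZ
  have hcard : Fintype.card (Fin (p + 1) × Fin 3) = finrank ℝ L := by
    rw [Fintype.card_prod, Fintype.card_fin, Fintype.card_fin]
    lia
  obtain ⟨i, hi⟩ := hX.exists_timelike H hy hcard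
  refine ⟨hE', _, (hX.comp (Equiv.swap 0 i).injective).adaptedFrame_normalize H hy hcard ?_⟩
  simpa only [diagonalFrame, Function.comp_apply, Equiv.swap_apply_left] using hi

end AdaptedFrame

/-! ### Charts -/

section Gauss

variable {E L : Type*} [NormedAddCommGroup E] [NormedSpace ℝ E] [FiniteDimensional ℝ E]
  [NormedAddCommGroup L] [NormedSpace ℝ L]
  {β : L →L[ℝ] L →L[ℝ] ℝ} {F : E → L} {U : Set E} {y : E}

namespace LocalImmersion

theorem fderiv_leviCivita_add (H : LocalImmersion β U F) (hy : y ∈ U) (u v w : E) :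
    fderiv ℝ (fun z => leviCivita β F z v w) y u +
        leviCivita β F y u (leviCivita β F y v w) =
      tangentCoord β F y (fderiv ℝ (fderiv ℝ (fderiv ℝ F)) y u v w +
        dTangentProj β F y u (sff β F y v w)) := by
  have hcoord := (H.differentiableAt H.contDiffOn_tangentCoord hy).hasFDerivAt
  have hF₂ := (H.differentiableAt
    (H.contDiffOn_fderiv.fderiv_of_isOpen (m := ∞) H.isOpen (by simp)) hy).hasFDerivAt
  have hderiv : fderiv ℝ (fun z => leviCivita β F z v w) y u =
      tangentCoord β F y (fderiv ℝ (fderiv ℝ (fderiv ℝ F)) y u v w) +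
        fderiv ℝ (tangentCoord β F) y u (fderiv ℝ (fderiv ℝ F) y v w) := by
    refine congr($((hcoord.clm_apply ((hF₂.clm_apply (hasFDerivAt_const v y)).clm_apply
      (hasFDerivAt_const w y))).fderiv) u).trans ?_
    simp
  have hnormal (x) : tangentCoord β F y (dTangentProj β F y u (fderiv ℝ F y x)) = 0 :=
    mem_normalSpace.1 (H.sff_mem hy u x)
  have hskew (x) :
      tangentCoord β F y (skewSff β F y u x) = -tangentCoord β F y (dTangentProj β F y u x) :=
    congr($(H.tangentCoord_skewSff hy u) x)
  have hcomm : tangentCoord β F y (fderiv ℝ (fderiv ℝ F) y v w) = leviCivita β F y v w := rfl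
  rw [hderiv, H.fderiv_tangentCoord hy]
  simp only [sub_apply, neg_apply, ContinuousLinearMap.comp_apply, hskew]
  rw [hcomm, H.fderiv_fderiv_apply hy, map_add, map_add, hnormal, map_add]
  abel

theorem gauss_equation (H : LocalImmersion β U F) (hy : y ∈ U) (u v w z : E) :
    β (fderiv ℝ F y
        ((fderiv ℝ (fun z => leviCivita β F z v w) y u +
            leviCivita β F y u (leviCivita β F y v w)) -
          (fderiv ℝ (fun z => leviCivita β F z u w) y v +
            leviCivita β F y v (leviCivita β F y u w)))) (fderiv ℝ F y z) =
      β (sff β F y v w) (sff β F y u z) - β (sff β F y u w) (sff β F y v z) := by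
  rw [H.fderiv_leviCivita_add hy, H.fderiv_leviCivita_add hy, ← map_sub,
    H.fderiv_fderiv_comm H.contDiffOn_fderiv hy u v, add_sub_add_left_eq_sub]
  change β (tangentProj β F y _) _ = _
  rw [H.beta_tangentProj hy, H.tangentProj_apply hy, map_sub, sub_apply, H.beta_dTangentProj hy,
    H.beta_dTangentProj hy]
  rfl

end LocalImmersion

end Gauss

section Coordinates

open Module IsManifold

variable {d : ℕ} {M : Type*} [TopologicalSpace M]
  {e : OpenPartialHomeomorph M (EuclideanSpace ℝ (Fin d))} {y : EuclideanSpace ℝ (Fin d)} {x : M}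

/-- A map to hyperbolic space in the chart `e`, with values in the Lorentzian space. -/
def chartMap {N : ℕ} (f : M → HyperbolicSpace N)
    (e : OpenPartialHomeomorph M (EuclideanSpace ℝ (Fin d))) (y : EuclideanSpace ℝ (Fin d)) :
    Fin (N + 1) → ℝ := f (e.symm y)

theorem chartMap_apply {N : ℕ} {f : M → HyperbolicSpace N} (hx : x ∈ e.source) :
    chartMap f e (e x) = f x := by
  rw [chartMap, e.left_inv hx]

variable [ChartedSpace (EuclideanSpace ℝ (Fin d)) M]

theorem mdifferentiable_of_mem_maximalAtlas (he : e ∈ maximalAtlas (𝓡 d) ∞ M) :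
    e.MDifferentiable (𝓡 d) (𝓡 d) :=
  ⟨(contMDiffOn_of_mem_maximalAtlas he).mdifferentiableOn (by simp),
    (contMDiffOn_symm_of_mem_maximalAtlas he).mdifferentiableOn (by simp)⟩

theorem toCoord_ofCoord (he : e ∈ maximalAtlas (𝓡 d) ∞ M) (hy : y ∈ e.target)
    (u : EuclideanSpace ℝ (Fin d)) : toCoord e (e.symm y) (ofCoord e y u) = u :=
  congr($((mdifferentiable_of_mem_maximalAtlas he).comp_symm_deriv hy) u)

theorem ofCoord_apply_toCoord (he : e ∈ maximalAtlas (𝓡 d) ∞ M) (hx : x ∈ e.source)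
    (v : TangentSpace (𝓡 d) x) : ofCoord e (e x) (toCoord e x v) = v :=
  congr($((mdifferentiable_of_mem_maximalAtlas he).symm_comp_deriv hx) v)

theorem ofCoord_toCoord (he : e ∈ maximalAtlas (𝓡 d) ∞ M) (hy : y ∈ e.target)
    (v : TangentSpace (𝓡 d) (e.symm y)) : ofCoord e y (toCoord e (e.symm y) v) = v := by
  have h := ofCoord_apply_toCoord he (e.map_target hy) v
  rwa [e.right_inv hy] at h

theorem ofCoord_ne_zero (he : e ∈ maximalAtlas (𝓡 d) ∞ M) (hy : y ∈ e.target)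
    {u : EuclideanSpace ℝ (Fin d)} (hu : u ≠ 0) : ofCoord e y u ≠ 0 := fun h =>
  hu <| (toCoord_ofCoord he hy u).symm.trans <|
    congr(toCoord e (e.symm y) $h).trans (map_zero (mfderiv (𝓡 d) (𝓡 d) e (e.symm y)))

/-- A field of endomorphisms of the tangent spaces in the chart `e`, bundled as linear maps. -/
def chartEndo (J : ∀ x : M, TangentSpace (𝓡 d) x →L[ℝ] TangentSpace (𝓡 d) x)
    (e : OpenPartialHomeomorph M (EuclideanSpace ℝ (Fin d))) (y : EuclideanSpace ℝ (Fin d)) :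
    EuclideanSpace ℝ (Fin d) →L[ℝ] EuclideanSpace ℝ (Fin d) :=
  (mfderiv (𝓡 d) (𝓡 d) e (e.symm y)).comp
    ((J (e.symm y)).comp (mfderiv (𝓡 d) (𝓡 d) e.symm y))

theorem chartEndo_apply (J : ∀ x : M, TangentSpace (𝓡 d) x →L[ℝ] TangentSpace (𝓡 d) x)
    (y u : EuclideanSpace ℝ (Fin d)) : chartEndo J e y u = coordEndo J e y u := rfl

theorem coordEndo_toCoord (J : ∀ x : M, TangentSpace (𝓡 d) x →L[ℝ] TangentSpace (𝓡 d) x)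
    (he : e ∈ maximalAtlas (𝓡 d) ∞ M) (hx : x ∈ e.source) (v : TangentSpace (𝓡 d) x) :
    coordEndo J e (e x) (toCoord e x v) = toCoord e x (J x v) := by
  have hJ (x') (hx' : x' = x) (a : EuclideanSpace ℝ (Fin d)) :
      toCoord e x' (J x' a) = toCoord e x (J x a) := by
    rw [hx']
  exact (hJ _ (e.left_inv hx) _).trans congr(toCoord e x (J x $(ofCoord_apply_toCoord he hx v)))

variable [IsManifold (𝓡 d) ∞ M]

theorem contMDiffOn_ofCoord (he : e ∈ maximalAtlas (𝓡 d) ∞ M) (u : EuclideanSpace ℝ (Fin d)) :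
    ContMDiffOn (𝓡 d) (𝓡 d).tangent ∞
      (fun y => (⟨e.symm y, ofCoord e y u⟩ : TangentBundle (𝓡 d) M)) e.target := by
  have hconst : ContMDiffOn (𝓡 d) (𝓡 d).tangent ∞
      (fun y => (⟨y, u⟩ : TangentBundle (𝓡 d) (EuclideanSpace ℝ (Fin d)))) e.target :=
    contMDiffOn_vectorSpace_iff_contDiffOn.2 contDiffOn_const
  refine (((contMDiffOn_symm_of_mem_maximalAtlas he).contMDiffOn_tangentMapWithin le_rfl
    e.open_target.uniqueMDiffOn).comp hconst fun y hy => hy).congr fun y hy => ?_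
  simp only [Function.comp_apply, tangentMapWithin, mfderivWithin_of_isOpen e.open_target hy]
  rfl

theorem contDiffOn_toCoord (he : e ∈ maximalAtlas (𝓡 d) ∞ M)
    {v : ∀ y, TangentSpace (𝓡 d) (e.symm y)}
    (hv : ContMDiffOn (𝓡 d) (𝓡 d).tangent ∞
      (fun y => (⟨e.symm y, v y⟩ : TangentBundle (𝓡 d) M)) e.target) :
    ContDiffOn ℝ ∞ (fun y => toCoord e (e.symm y) (v y)) e.target := by
  refine contMDiffOn_vectorSpace_iff_contDiffOn.1 <|
    (((contMDiffOn_of_mem_maximalAtlas he).contMDiffOn_tangentMapWithin le_rfl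
      e.open_source.uniqueMDiffOn).comp hv fun y hy => e.map_target hy).congr fun y hy => ?_
  simp only [Function.comp_apply, tangentMapWithin,
    mfderivWithin_of_isOpen e.open_source (e.map_target hy)]
  exact congrArg (fun z => (⟨z, toCoord e (e.symm y) (v y)⟩ :
    TangentBundle (𝓡 d) (EuclideanSpace ℝ (Fin d)))) (e.right_inv hy).symm

theorem contDiffOn_chartEndo (K : KaehlerStructure d M) (he : e ∈ maximalAtlas (𝓡 d) ∞ M) :
    ContDiffOn ℝ ∞ (chartEndo K.J e) e.target :=
  contDiffOn_clm_apply.2 fun u => contDiffOn_toCoord he <|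
    (K.contMDiff_J.comp_contMDiffOn (contMDiffOn_symm_of_mem_maximalAtlas he)).clm_bundle_apply
      (contMDiffOn_ofCoord he u)

theorem KaehlerStructure.inner_J_self (K : KaehlerStructure d M) (v : TangentSpace (𝓡 d) x) :
    K.metric.inner x v (K.J x v) = 0 := by
  have h := K.inner_J_J x v (K.J x v)
  rw [K.J_J, map_neg, K.metric.symm] at h
  linarith

theorem KaehlerStructure.sectionalCurvature_J_pos_iff (K : KaehlerStructure d M)
    {v : TangentSpace (𝓡 d) x} (hv : v ≠ 0) :
    0 < sectionalCurvature K.metric x v (K.J x v) ↔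
      0 < curvature K.metric x v (K.J x v) (K.J x v) v := by
  have hpos := K.metric.pos x v hv
  rw [sectionalCurvature, K.inner_J_self, K.inner_J_J]
  exact div_pos_iff_of_pos_right (by nlinarith)

namespace IsIsometricImmersion

variable {N : ℕ} {f : M → HyperbolicSpace N} {g : RiemMetric d M}

theorem contDiffOn_chartMap (hf : IsIsometricImmersion g f) (he : e ∈ maximalAtlas (𝓡 d) ∞ M) :
    ContDiffOn ℝ ∞ (chartMap f e) e.target :=
  contMDiffOn_iff_contDiffOn.1 <|
    hf.contMDiff.comp_contMDiffOn (contMDiffOn_symm_of_mem_maximalAtlas he)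

theorem fderiv_chartMap (hf : IsIsometricImmersion g f) (he : e ∈ maximalAtlas (𝓡 d) ∞ M)
    (hy : y ∈ e.target) (u : EuclideanSpace ℝ (Fin d)) :
    fderiv ℝ (chartMap f e) y u =
      mfderiv (𝓡 d) 𝓘(ℝ, Fin (N + 1) → ℝ) (fun x => (f x : Fin (N + 1) → ℝ)) (e.symm y)
        (ofCoord e y u) := by
  rw [← mfderiv_eq_fderiv]
  exact congr($(mfderiv_comp y (hf.contMDiff.mdifferentiable (by simp) (e.symm y))
    ((mdifferentiable_of_mem_maximalAtlas he).mdifferentiableAt_symm hy)) u)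

theorem coordMetric_eq (hf : IsIsometricImmersion g f) (he : e ∈ maximalAtlas (𝓡 d) ∞ M)
    (hy : y ∈ e.target) (u v : EuclideanSpace ℝ (Fin d)) :
    coordMetric g e y u v =
      lorentzForm 0 (fderiv ℝ (chartMap f e) y u) (fderiv ℝ (chartMap f e) y v) := by
  rw [lorentzForm_apply, hf.fderiv_chartMap he hy u, hf.fderiv_chartMap he hy v]
  exact (hf.isometric _ _ _).symm

theorem localImmersion (hf : IsIsometricImmersion g f) (he : e ∈ maximalAtlas (𝓡 d) ∞ M) :
    LocalImmersion (lorentzForm 0) e.target (chartMap f e) where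
  isOpen := e.open_target
  symm := lorentz_comm 0
  smooth := hf.contDiffOn_chartMap he
  pos y hy u hu := by
    rw [← hf.coordMetric_eq he hy]
    exact g.pos _ _ (ofCoord_ne_zero he hy hu)

theorem fderiv_coordMetric (hf : IsIsometricImmersion g f) (he : e ∈ maximalAtlas (𝓡 d) ∞ M)
    (hy : y ∈ e.target) (u v w : EuclideanSpace ℝ (Fin d)) :
    fderiv ℝ (fun z => coordMetric g e z v w) y u =
      lorentzForm 0 (fderiv ℝ (fderiv ℝ (chartMap f e)) y u v) (fderiv ℝ (chartMap f e) y w) +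
        lorentzForm 0 (fderiv ℝ (chartMap f e) y v)
          (fderiv ℝ (fderiv ℝ (chartMap f e)) y u w) := by
  have H := hf.localImmersion he
  have hF := (H.differentiableAt H.contDiffOn_fderiv hy).hasFDerivAt
  rw [H.fderiv_congr (fun z hz => hf.coordMetric_eq he hz v w) hy]
  refine congr($((((lorentzForm (0 : Fin (N + 1))).hasFDerivAt.comp y
    (hF.clm_apply (hasFDerivAt_const v y))).clm_apply
      (hF.clm_apply (hasFDerivAt_const w y))).fderiv) u).trans ?_
  simp [add_comm]

theorem christoffelLower_eq (hf : IsIsometricImmersion g f) (he : e ∈ maximalAtlas (𝓡 d) ∞ M)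
    (hy : y ∈ e.target) (u v w : EuclideanSpace ℝ (Fin d)) :
    christoffelLower g e y u v w =
      coordMetric g e y (leviCivita (lorentzForm 0) (chartMap f e) y u v) w := by
  have H := hf.localImmersion he
  have hcomm := H.fderiv_fderiv_comm H.smooth hy
  have hproj : lorentzForm 0 (fderiv ℝ (chartMap f e) y
        (leviCivita (lorentzForm 0) (chartMap f e) y u v)) (fderiv ℝ (chartMap f e) y w) =
      lorentzForm 0 (fderiv ℝ (fderiv ℝ (chartMap f e)) y u v) (fderiv ℝ (chartMap f e) y w) := by
    rw [H.fderiv_fderiv_apply hy, map_add, add_apply, H.beta_sff hy, add_zero]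
  rw [hf.coordMetric_eq he hy, hproj, christoffelLower]
  simp only [hf.fderiv_coordMetric he hy]
  rw [hcomm v u, hcomm w u, hcomm w v, H.symm (fderiv ℝ (chartMap f e) y v),
    H.symm (fderiv ℝ (chartMap f e) y u)]
  ring

theorem gram_mulVec (hf : IsIsometricImmersion g f) (he : e ∈ maximalAtlas (𝓡 d) ∞ M)
    (hy : y ∈ e.target) (u : EuclideanSpace ℝ (Fin d)) (l : Fin d) :
    (gram g e y).mulVec u.ofLp l = coordMetric g e y u (EuclideanSpace.single l (1 : ℝ)) := by
  have hu : u = ∑ k, u k • EuclideanSpace.single k (1 : ℝ) := by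
    ext i
    simp [Pi.single_apply]
  conv_rhs => rw [hu]
  simp only [hf.coordMetric_eq he hy, map_sum, map_smul, sum_apply, smul_apply, smul_eq_mul,
    Matrix.mulVec, dotProduct, gram, Matrix.of_apply]
  exact Finset.sum_congr rfl fun k _ => by rw [(hf.localImmersion he).symm, mul_comm]

theorem dotProduct_gram_mulVec (hf : IsIsometricImmersion g f) (he : e ∈ maximalAtlas (𝓡 d) ∞ M)
    (hy : y ∈ e.target) (u v : EuclideanSpace ℝ (Fin d)) :
    v.ofLp ⬝ᵥ (gram g e y).mulVec u.ofLp = coordMetric g e y u v := by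
  have hv : v = ∑ k, v k • EuclideanSpace.single k (1 : ℝ) := by
    ext i
    simp [Pi.single_apply]
  conv_rhs => rw [hv]
  simp only [dotProduct, hf.gram_mulVec he hy]
  simp only [hf.coordMetric_eq he hy, map_sum, map_smul, smul_eq_mul]

theorem isUnit_det_gram (hf : IsIsometricImmersion g f) (he : e ∈ maximalAtlas (𝓡 d) ∞ M)
    (hy : y ∈ e.target) : IsUnit (gram g e y).det := by
  rw [← Matrix.isUnit_iff_isUnit_det, ← Matrix.mulVec_injective_iff_isUnit]
  refine (injective_iff_map_eq_zero (Matrix.mulVecLin _)).2 fun v hv => ?_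
  by_contra hne
  refine (hf.localImmersion he).pos y hy (WithLp.toLp 2 v)
    (fun h => hne congr(WithLp.ofLp $h)) |>.ne' ?_
  rw [← hf.coordMetric_eq he hy, ← hf.dotProduct_gram_mulVec he hy]
  exact congr(v ⬝ᵥ $hv).trans (dotProduct_zero v)

theorem christoffel_eq (hf : IsIsometricImmersion g f) (he : e ∈ maximalAtlas (𝓡 d) ∞ M)
    (hy : y ∈ e.target) (u v : EuclideanSpace ℝ (Fin d)) :
    christoffel g e y u v = leviCivita (lorentzForm 0) (chartMap f e) y u v := by
  have hinv (w : Fin d → ℝ) : (gram g e y)⁻¹.mulVec ((gram g e y).mulVec w) = w := by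
    rw [Matrix.mulVec_mulVec, Matrix.nonsing_inv_mul _ (hf.isUnit_det_gram he hy),
      Matrix.one_mulVec]
  simp only [christoffel, hf.christoffelLower_eq he hy, ← hf.gram_mulVec he hy]
  exact congr(WithLp.toLp 2 $(hinv _))

theorem coordMetric_coordCurvature (hf : IsIsometricImmersion g f)
    (he : e ∈ maximalAtlas (𝓡 d) ∞ M) (hy : y ∈ e.target) (u v w z : EuclideanSpace ℝ (Fin d)) :
    coordMetric g e y (coordCurvature g e y u v w) z =
      lorentzForm 0 (sff (lorentzForm 0) (chartMap f e) y v w)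
          (sff (lorentzForm 0) (chartMap f e) y u z) -
        lorentzForm 0 (sff (lorentzForm 0) (chartMap f e) y u w)
          (sff (lorentzForm 0) (chartMap f e) y v z) := by
  have H := hf.localImmersion he
  rw [hf.coordMetric_eq he hy, coordCurvature,
    H.fderiv_congr (fun z hz => hf.christoffel_eq he hz _ _) hy,
    H.fderiv_congr (fun z hz => hf.christoffel_eq he hz _ _) hy]
  simp only [hf.christoffel_eq he hy]
  exact H.gauss_equation hy _ _ _ _

theorem fderiv_chartEndo {K : KaehlerStructure d M} (hf : IsIsometricImmersion K.metric f)
    (he : e ∈ maximalAtlas (𝓡 d) ∞ M) (hy : y ∈ e.target) (u : EuclideanSpace ℝ (Fin d)) :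
    fderiv ℝ (chartEndo K.J e) y u =
      (chartEndo K.J e y).comp (leviCivita (lorentzForm 0) (chartMap f e) y u) -
        (leviCivita (lorentzForm 0) (chartMap f e) y u).comp (chartEndo K.J e y) := by
  ext1 v
  have hJ := (((contDiffOn_chartEndo K he).contDiffAt
    (e.open_target.mem_nhds hy)).differentiableAt (by simp)).hasFDerivAt
  have hderiv : fderiv ℝ (fun z => coordEndo K.J e z v) y u =
      fderiv ℝ (chartEndo K.J e) y u v := by
    refine congr($((hJ.clm_apply (hasFDerivAt_const v y)).fderiv) u).trans ?_
    simp
  have hparallel := K.parallel_J e he y hy u v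
  rw [coordCovDeriv, hderiv, hf.christoffel_eq he hy, hf.christoffel_eq he hy,
    sub_eq_zero] at hparallel
  exact eq_sub_of_add_eq hparallel

theorem hyperbolicKaehler {K : KaehlerStructure d M} (hf : IsIsometricImmersion K.metric f)
    (he : e ∈ maximalAtlas (𝓡 d) ∞ M) :
    HyperbolicKaehler (lorentzForm 0) e.target (chartMap f e) (chartEndo K.J e) where
  toLocalImmersion := hf.localImmersion he
  nondeg _ h := eq_zero_of_lorentz_eq_zero h
  smooth_J := contDiffOn_chartEndo K he
  J_J y hy u := by
    simp only [chartEndo_apply, coordEndo]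
    rw [ofCoord_toCoord he hy, K.J_J]
    exact (map_neg (mfderiv (𝓡 d) (𝓡 d) _ _) _).trans congr(-$(toCoord_ofCoord he hy u))
  orth y hy u v := by
    rw [← hf.coordMetric_eq he hy, ← hf.coordMetric_eq he hy]
    simp only [chartEndo_apply, coordEndo, coordMetric]
    rw [ofCoord_toCoord he hy, ofCoord_toCoord he hy, K.inner_J_J]
  parallel _ := hf.fderiv_chartEndo he
  norm_eq y _ := (f (e.symm y)).2.1.trans (by norm_num)
  nonneg z w hw h := lorentz_self_nonneg_of_orthogonal (o := 0) (x := z) (z := w) hw h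

theorem curvature_eq (hf : IsIsometricImmersion g f) (x : M) (u v w z : TangentSpace (𝓡 d) x) :
    let e := chartAt (EuclideanSpace ℝ (Fin d)) x
    let α := sff (lorentzForm 0) (chartMap f e) (e x)
    curvature g x u v w z =
      lorentzForm 0 (α (toCoord e x v) (toCoord e x w)) (α (toCoord e x u) (toCoord e x z)) -
        lorentzForm 0 (α (toCoord e x u) (toCoord e x w)) (α (toCoord e x v) (toCoord e x z)) :=
  hf.coordMetric_coordCurvature (chart_mem_maximalAtlas x) (mem_chart_target _ x) _ _ _ _

theorem exists_isRegularAt {K : KaehlerStructure d M} (hf : IsIsometricImmersion K.metric f) (x : M)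
    (V : Submodule ℝ (TangentSpace (𝓡 d) x)) (hVJ : ∀ S ∈ V, K.J x S ∈ V)
    (hdim : 2 * N ≤ 2 * d + finrank ℝ V)
    (hV : ∀ S ∈ V, S ≠ 0 → 0 < sectionalCurvature K.metric x S (K.J x S)) :
    let e := chartAt (EuclideanSpace ℝ (Fin d)) x
    ∃ Z, IsRegularAt (lorentzForm 0) (chartMap f e) (chartEndo K.J e) (e x) Z := by
  intro e
  have he : e ∈ maximalAtlas (𝓡 d) ∞ M := chart_mem_maximalAtlas x
  have hx : x ∈ e.source := mem_chart_source _ x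
  have hy : e x ∈ e.target := e.map_source hx
  have H := hf.hyperbolicKaehler he
  have hJ (v) : chartEndo K.J e (e x) (toCoord e x v) = toCoord e x (K.J x v) :=
    coordEndo_toCoord K.J he hx v
  let D : TangentSpace (𝓡 d) x →ₗ[ℝ] EuclideanSpace ℝ (Fin d) :=
    (mfderiv (𝓡 d) (𝓡 d) e x).toLinearMap
  have hD : Function.Injective D := (mdifferentiable_of_mem_maximalAtlas he).mfderiv_injective hx
  have hVD : finrank ℝ (V.map D) = finrank ℝ V :=
    (Submodule.equivMapOfInjective D hD V).finrank_eq.symm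
  have hW := H.finrank_add_finrank_normalSpace hy
  rw [finrank_euclideanSpace_fin, finrank_fin_fun] at hW
  have hdim' : 2 * finrank ℝ (normalSpace (lorentzForm 0) (chartMap f e) (e x)) ≤
      finrank ℝ (V.map D) + 2 := by
    rw [hVD]
    omega
  have hJD : ∀ S ∈ V.map D, chartEndo K.J e (e x) S ∈ V.map D := by
    rintro _ ⟨S, hS, rfl⟩
    exact ⟨K.J x S, hVJ S hS, (hJ S).symm⟩
  obtain ⟨Z, hZ⟩ := (H.kaehlerPoint hy).exists_isRegular hJD hdim' <| by
    rintro _ ⟨S, hS, rfl⟩ hS0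
    have hS0' : S ≠ 0 := fun h => hS0 (by rw [h, map_zero])
    have hpos := (K.sectionalCurvature_J_pos_iff hS0').1 (hV S hS hS0')
    rw [hf.curvature_eq, sub_pos, ← hJ, H.sff_comm hy (chartEndo _ _ _ _) (toCoord e x S),
      H.symm (sff _ _ _ (chartEndo _ _ _ _) _)] at hpos
    exact hpos
  exact ⟨Z, (H.isRegular_normalSff_iff hy).1 hZ⟩

end IsIsometricImmersion

end Coordinates

section Propagation

open Module Filter Topology IsManifold

section Local

variable {E L : Type*} [NormedAddCommGroup E] [NormedSpace ℝ E] [NormedAddCommGroup L]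
  [NormedSpace ℝ L] {β : L →L[ℝ] L →L[ℝ] ℝ} {F : E → L} {U : Set E} {J : E → E →L[ℝ] E} {y : E}
  {P : L →L[ℝ] L} {T : E → L →L[ℝ] L} {O : Set E}

theorem commute_of_mem_closure {X : Type*} [TopologicalSpace X] {T : X → L →L[ℝ] L} {O : Set X}
    {x : X} (hT : ContinuousAt T x) (hO : ∀ z ∈ O, Commute P (T z)) (hx : x ∈ closure O) :
    Commute P (T x) := by
  simp only [← commutatorCLM_eq_zero_iff] at hO ⊢
  exact ((commutatorCLM P).continuous.continuousAt.comp hT).continuousWithinAt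
    |>.eq_const_of_mem_closure hx hO

theorem commute_fderiv_apply (hT : DifferentiableAt ℝ T y) (hP : ∀ᶠ z in 𝓝 y, Commute P (T z))
    (v : E) : Commute P (fderiv ℝ T y v) := by
  simp only [← commutatorCLM_eq_zero_iff] at hP ⊢
  have hzero : HasFDerivAt (fun z => commutatorCLM P (T z)) (0 : E →L[ℝ] L →L[ℝ] L) y :=
    (hasFDerivAt_const 0 y).congr_of_eventuallyEq hP
  exact congr($(((commutatorCLM P).hasFDerivAt.comp y hT.hasFDerivAt).unique hzero) v)

namespace LocalKaehler

variable [FiniteDimensional ℝ E]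

theorem commute_tangentProj_of_forall_exists (H : LocalKaehler β U F J) (hy : y ∈ U)
    (hP : ∀ x z, β (P x) z = β x (P z))
    (h : ∀ u, ∃ v, P (fderiv ℝ F y u) = fderiv ℝ F y v) : Commute P (tangentProj β F y) := by
  have hmaps (x) : tangentProj β F y (P (tangentProj β F y x)) = P (tangentProj β F y x) := by
    obtain ⟨v, hv⟩ := h (tangentCoord β F y x)
    have hv' : P (tangentProj β F y x) = fderiv ℝ F y v := hv
    rw [hv', H.tangentProj_apply hy]
  refine ContinuousLinearMap.ext fun x => sub_eq_zero.1 (H.nondeg _ fun z => ?_)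
  change β (P (tangentProj β F y x) - tangentProj β F y (P x)) z = 0
  rw [map_sub, sub_apply, ← hmaps x, H.beta_tangentProj hy, hP, H.beta_tangentProj hy, hmaps,
    H.beta_tangentProj hy, hP, sub_self]

theorem commute_iff_forall_exists (H : LocalKaehler β U F J) (hy : y ∈ U)
    (hP : ∀ x z, β (P x) z = β x (P z)) :
    Commute P (tangentProj β F y) ∧ Commute P (ambientJ β F J y) ↔
      ∀ u, ∃ v, P (fderiv ℝ F y u) = fderiv ℝ F y v ∧
        P (fderiv ℝ F y (J y u)) = fderiv ℝ F y (J y v) := by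
  constructor
  · rintro ⟨hPπ, hPJ⟩ u
    refine ⟨tangentCoord β F y (P (fderiv ℝ F y u)), ?_, ?_⟩
    · have h := congr($(hPπ.eq) (fderiv ℝ F y u))
      rwa [clm_mul_apply, H.tangentProj_apply hy] at h
    · have h := congr($(hPJ.eq) (fderiv ℝ F y u))
      rwa [clm_mul_apply, H.ambientJ_apply hy] at h
  · intro h
    have hPπ := H.commute_tangentProj_of_forall_exists hy hP fun u => (h u).imp fun _ => And.left
    refine ⟨hPπ, ContinuousLinearMap.ext fun x => ?_⟩
    obtain ⟨v, hv, hv'⟩ := h (tangentCoord β F y x)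
    have hvx : v = tangentCoord β F y (P x) :=
      H.injective_fderiv hy (hv.symm.trans congr($(hPπ.eq) x))
    exact hv'.trans (hvx ▸ rfl)

theorem commutesAt_of_mem_closure (H : LocalKaehler β U F J) (hy : y ∈ U)
    (hO : IsOpen O) (hOU : O ⊆ U) (hyO : y ∈ closure O)
    (hP : ∀ z ∈ O, Commute P (tangentProj β F z) ∧ Commute P (ambientJ β F J z)) :
    CommutesAt β F J P y where
  tangentProj := commute_of_mem_closure
    (H.differentiableAt H.contDiffOn_tangentProj hy).continuousAt
    (fun z hz => (hP z hz).1) hyO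
  dTangentProj v := commute_of_mem_closure (T := fun z => dTangentProj β F z v)
    ((H.differentiableAt H.contDiffOn_dTangentProj hy).continuousAt.clm_apply continuousAt_const)
    (fun _ hz => commute_fderiv_apply (H.differentiableAt H.contDiffOn_tangentProj (hOU hz))
      (eventually_of_mem (hO.mem_nhds hz) fun w hw => (hP w hw).1) v) hyO
  ambientJ := commute_of_mem_closure (H.differentiableAt H.contDiffOn_ambientJ hy).continuousAt
    (fun z hz => (hP z hz).2) hyO

end LocalKaehler

end Local

variable {d N : ℕ} {M : Type*} [TopologicalSpace M] [ChartedSpace (EuclideanSpace ℝ (Fin d)) M]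
  [IsManifold (𝓡 d) ∞ M] {K : KaehlerStructure d M} {f : M → HyperbolicSpace N} {κ : Type*}
  {P : κ → (Fin (N + 1) → ℝ) →L[ℝ] (Fin (N + 1) → ℝ)} {r : κ → ℝ}
  {e : OpenPartialHomeomorph M (EuclideanSpace ℝ (Fin d))} {x : M} {y : EuclideanSpace ℝ (Fin d)}

/-- The differential of `f` as a map into Lorentz space. -/
abbrev ambientDeriv (f : M → HyperbolicSpace N) (x : M) :
    TangentSpace (𝓡 d) x →L[ℝ] (Fin (N + 1) → ℝ) :=
  mfderiv (𝓡 d) 𝓘(ℝ, Fin (N + 1) → ℝ) (fun x => (f x : Fin (N + 1) → ℝ)) x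

variable (K f P r) in
/-- At `x`, the decomposition `P` of the ambient space induces a decomposition of the tangent space
into complex subspaces, and `r j` is the square of the norm of the component `P j (f x)`. -/
def SplitsAt (x : M) : Prop :=
  ∀ j, (∀ u : TangentSpace (𝓡 d) x, ∃ v : TangentSpace (𝓡 d) x,
    P j (ambientDeriv f x u) = ambientDeriv f x v ∧
      P j (ambientDeriv f x (K.J x u)) = ambientDeriv f x (K.J x v)) ∧
    lorentzForm 0 (P j (f x)) (f x) = r j

theorem splitsAt_symm_iff [Fintype κ] (hf : IsIsometricImmersion K.metric f)
    (he : e ∈ maximalAtlas (𝓡 d) ∞ M) (HP : OrthogonalSplitting (lorentzForm 0) P)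
    (hy : y ∈ e.target) :
    SplitsAt K f P r (e.symm y) ↔ ∀ j,
      (Commute (P j) (tangentProj (lorentzForm 0) (chartMap f e) y) ∧
        Commute (P j) (ambientJ (lorentzForm 0) (chartMap f e) (chartEndo K.J e) y)) ∧
      lorentzForm 0 (P j (chartMap f e y)) (chartMap f e y) = r j := by
  refine forall_congr' fun j => and_congr_left fun _ => ?_
  have H := hf.hyperbolicKaehler he
  rw [H.commute_iff_forall_exists hy (HP.symm j)]
  have hsurj : Function.Surjective (ofCoord e y) :=
    Function.RightInverse.surjective (ofCoord_toCoord he hy)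
  have hJ (u) : K.J (e.symm y) (ofCoord e y u) = ofCoord e y (chartEndo K.J e y u) :=
    (ofCoord_toCoord he hy _).symm
  simp only [hf.fderiv_chartMap he hy, hsurj.forall, hsurj.exists, hJ]
  exact Iff.rfl

theorem eventually_splitsAt [Fintype κ] (hf : IsIsometricImmersion K.metric f)
    (he : e ∈ maximalAtlas (𝓡 d) ∞ M) (HP : OrthogonalSplitting (lorentzForm 0) P)
    (hdim : 2 * (N + 1) ≤ 3 * d) (hx : x ∈ e.source)
    (h : ∀ j, CommutesAt (lorentzForm 0) (chartMap f e) (chartEndo K.J e) (P j) (e x))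
    (hr : ∀ j, lorentzForm 0 (P j (f x)) (f x) = r j) :
    ∀ᶠ z in 𝓝 x, SplitsAt K f P r z := by
  have hcommute := (hf.hyperbolicKaehler he).eventually_commutesAt_and_beta_eq (e.map_source hx) HP
    (by rwa [finrank_euclideanSpace_fin, finrank_fin_fun]) h
  filter_upwards [(e.continuousAt hx).eventually hcommute, e.open_source.mem_nhds hx] with z hz hze
  rw [← e.left_inv hze, splitsAt_symm_iff hf he HP (e.map_source hze)]
  refine fun j => ⟨⟨(hz j).1.tangentProj, (hz j).1.ambientJ⟩, (hz j).2.trans ?_⟩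
  rw [chartMap_apply hx, hr]

theorem eventually_splitsAt_of_mem_closure_interior [Fintype κ]
    (hf : IsIsometricImmersion K.metric f) (HP : OrthogonalSplitting (lorentzForm 0) P)
    (hdim : 2 * (N + 1) ≤ 3 * d) (hx : x ∈ closure (interior {z | SplitsAt K f P r z})) :
    ∀ᶠ z in 𝓝 x, SplitsAt K f P r z := by
  let e := chartAt (EuclideanSpace ℝ (Fin d)) x
  have he : e ∈ maximalAtlas (𝓡 d) ∞ M := chart_mem_maximalAtlas x
  have hxe : x ∈ e.source := mem_chart_source _ x
  let S : Set M := e.source ∩ interior {z | SplitsAt K f P r z}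
  have hS : IsOpen (e '' S) :=
    e.isOpen_image_of_subset_source (e.open_source.inter isOpen_interior) Set.inter_subset_left
  have hSe : e '' S ⊆ e.target := by
    rintro _ ⟨z, hz, rfl⟩
    exact e.map_source hz.1
  have hxS : e x ∈ closure (e '' S) :=
    mem_closure_image (e.continuousAt hxe) (e.open_source.inter_closure ⟨hxe, hx⟩)
  have hsplit : ∀ y ∈ e '' S, SplitsAt K f P r (e.symm y) := by
    rintro _ ⟨z, hz, rfl⟩
    rw [e.left_inv hz.1]
    exact interior_subset hz.2
  refine eventually_splitsAt hf he HP hdim hxe (fun j => ?_) fun j => ?_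
  · exact (hf.hyperbolicKaehler he).commutesAt_of_mem_closure (e.map_source hxe) hS hSe hxS
      fun y hy => ((splitsAt_symm_iff hf he HP (hSe hy)).1 (hsplit y hy) j).1
  · have hcont : Continuous fun z => lorentzForm 0 (P j (f z)) (f z) := by
      have := hf.contMDiff.continuous
      fun_prop
    exact hcont.continuousWithinAt.eq_const_of_mem_closure hx fun z hz => (interior_subset hz j).2

theorem splitsAt_of_eventually [Fintype κ] [ConnectedSpace M] (hf : IsIsometricImmersion K.metric f)
    (HP : OrthogonalSplitting (lorentzForm 0) P) (hdim : 2 * (N + 1) ≤ 3 * d) {x₀ : M}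
    (hx₀ : ∀ᶠ z in 𝓝 x₀, SplitsAt K f P r z) (x : M) : SplitsAt K f P r x := by
  have hclosed : IsClosed (interior {z | SplitsAt K f P r z}) :=
    isClosed_of_closure_subset fun _ hx => mem_interior_iff_mem_nhds.2 <|
      eventually_splitsAt_of_mem_closure_interior hf HP hdim hx
  have huniv := IsClopen.eq_univ ⟨hclosed, isOpen_interior⟩ ⟨x₀, mem_interior_iff_mem_nhds.2 hx₀⟩
  exact interior_subset (huniv ▸ Set.mem_univ x)

end Propagation

/-! ### Open subsets of the extrinsic product -/

section Rescaling

open Module Filter Topology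

variable {E L : Type*} [NormedAddCommGroup L] [NormedSpace ℝ L] {β : L →L[ℝ] L →L[ℝ] ℝ}
  {F : E → L} {U : Set E} {y : E} {κ : Type*} [Fintype κ] {P : κ → L →L[ℝ] L} {r : κ → ℝ}

namespace OrthogonalSplitting

theorem sum_beta_apply (HP : OrthogonalSplitting β P) (x z : L) :
    ∑ i, β (P i x) z = β x z := by
  rw [← sum_apply, ← map_sum, HP.sum_eq]

theorem apply_sum_smul (HP : OrthogonalSplitting β P) (j : κ) (t : κ → ℝ) (x : L) :
    P j (∑ i, t i • P i x) = t j • P j x := by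
  have hzero (i) (hij : i ≠ j) : P j (t i • P i x) = 0 := by
    rw [map_smul, ← clm_mul_apply, HP.mul_ne j i hij.symm, zero_apply, smul_zero]
  rw [map_sum, Finset.sum_eq_single j (fun i _ => hzero i) (by simp), map_smul, ← clm_mul_apply,
    HP.mul_self]

theorem beta_apply_smul_self (HP : OrthogonalSplitting β P) {j : κ} {w x : L} {a : ℝ}
    (hw : P j w = a • P j x) : β (P j w) w = a ^ 2 * β (P j x) x := by
  have hself (z) : β (P j z) z = β (P j z) (P j z) := by
    rw [← HP.symm, ← clm_mul_apply, HP.mul_self]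
  rw [hself, hw, hself]
  simp only [map_smul, smul_apply, smul_eq_mul]
  ring

end OrthogonalSplitting

variable (F P) in
/-- The extension of `F` to a family of maps, obtained by rescaling each component `P j (F y)` by
the factor `1 + t j`. -/
def rescale (q : E × (κ → ℝ)) : L := F q.1 + ∑ j, q.2 j • P j (F q.1)

theorem rescale_zero (y : E) : rescale F P (y, 0) = F y := by
  simp [rescale]

theorem OrthogonalSplitting.beta_rescale (HP : OrthogonalSplitting β P) (j : κ)
    (q : E × (κ → ℝ)) :
    β (P j (rescale F P q)) (rescale F P q) = (1 + q.2 j) ^ 2 * β (P j (F q.1)) (F q.1) :=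
  HP.beta_apply_smul_self (by rw [rescale, map_add, HP.apply_sum_smul, add_smul, one_smul])

theorem eq_zero_of_beta_rescale_eq (HP : OrthogonalSplitting β P) (hr : ∀ j, r j ≠ 0)
    {q : E × (κ → ℝ)} (hF : ∀ j, β (P j (F q.1)) (F q.1) = r j) (hq : ∀ j, -1 < q.2 j)
    (h : ∀ j, β (P j (rescale F P q)) (rescale F P q) = r j) : q.2 = 0 := by
  ext j
  have hsq : (1 + q.2 j) ^ 2 = 1 := by
    have hj := h j
    rw [HP.beta_rescale, hF] at hj
    exact mul_right_cancel₀ (hr j) (hj.trans (one_mul _).symm)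
  have hone := (pow_eq_one_iff_of_nonneg (by linarith [hq j]) two_ne_zero).1 hsq
  simpa using hone

theorem eventually_rescale_mem_image [TopologicalSpace E] (HP : OrthogonalSplitting β P)
    (hU : U ∈ 𝓝 y) (hr : ∀ j, r j ≠ 0)
    (hF : ∀ z ∈ U, ∀ j, β (P j (F z)) (F z) = r j) :
    ∀ᶠ q in 𝓝 (y, (0 : κ → ℝ)),
      (∀ j, β (P j (rescale F P q)) (rescale F P q) = r j) → rescale F P q ∈ F '' U := by
  have hfst : ∀ᶠ q : E × (κ → ℝ) in 𝓝 (y, 0), q.1 ∈ U := continuousAt_fst.eventually hU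
  have hsnd : ∀ᶠ q : E × (κ → ℝ) in 𝓝 (y, 0), ∀ j, -1 < q.2 j := by
    refine eventually_all.2 fun j => ?_
    have hcont : ContinuousAt (fun q : E × (κ → ℝ) => q.2 j) (y, 0) := by fun_prop
    exact hcont.eventually (lt_mem_nhds (by simp))
  filter_upwards [hfst, hsnd] with q hqU hq h
  obtain ⟨z, t⟩ := q
  obtain rfl : t = 0 := eq_zero_of_beta_rescale_eq HP hr (hF z hqU) hq h
  exact ⟨z, hqU, (rescale_zero z).symm⟩

variable [NormedAddCommGroup E] [NormedSpace ℝ E]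

variable (F P) in
/-- The derivative of `rescale F P` at `(y, 0)`. -/
def rescaleDeriv (y : E) : E × (κ → ℝ) →L[ℝ] L :=
  (fderiv ℝ F y).coprod (∑ j, (ContinuousLinearMap.proj j).smulRight (P j (F y)))

theorem rescaleDeriv_apply (u : E) (t : κ → ℝ) :
    rescaleDeriv F P y (u, t) = fderiv ℝ F y u + ∑ j, t j • P j (F y) := by
  simp [rescaleDeriv]

theorem hasStrictFDerivAt_rescale (hF : HasStrictFDerivAt F (fderiv ℝ F y) y) :
    HasStrictFDerivAt (rescale F P) (rescaleDeriv F P y) (y, 0) := by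
  have hfst : HasStrictFDerivAt (fun q : E × (κ → ℝ) => F q.1)
      ((fderiv ℝ F y).comp (ContinuousLinearMap.fst ℝ E (κ → ℝ))) (y, 0) :=
    HasStrictFDerivAt.comp (y, (0 : κ → ℝ)) hF hasStrictFDerivAt_fst
  have hsnd (j) : HasStrictFDerivAt (fun q : E × (κ → ℝ) => q.2 j)
      ((ContinuousLinearMap.proj j).comp (ContinuousLinearMap.snd ℝ E (κ → ℝ))) (y, 0) :=
    ((ContinuousLinearMap.proj (R := ℝ) (φ := fun _ : κ => ℝ) j).comp
      (ContinuousLinearMap.snd ℝ E (κ → ℝ))).hasStrictFDerivAt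
  refine (hfst.add (HasStrictFDerivAt.fun_sum (u := Finset.univ) fun j _ => (hsnd j).smul
    ((P j).hasStrictFDerivAt.comp (y, (0 : κ → ℝ)) hfst))).congr_fderiv ?_
  ext <;> simp [rescaleDeriv]

namespace HyperbolicKaehler

variable [FiniteDimensional ℝ E] {J : E → E →L[ℝ] E}

theorem injective_rescaleDeriv (H : HyperbolicKaehler β U F J) (hy : y ∈ U)
    (HP : OrthogonalSplitting β P) (hP : ∀ j, Commute (P j) (tangentProj β F y))
    (hne : ∀ j, P j (F y) ≠ 0) : Function.Injective (rescaleDeriv F P y) := by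
  refine (injective_iff_map_eq_zero _).2 ?_
  rintro ⟨u, t⟩ hut
  rw [rescaleDeriv_apply] at hut
  have hnormal (j) : tangentProj β F y (P j (F y)) = 0 := by
    rw [← clm_mul_apply, ← (hP j).eq, clm_mul_apply, H.tangentProj_self hy, map_zero]
  have hu : fderiv ℝ F y u = 0 := by
    have h := congr(tangentProj β F y $hut)
    simpa only [map_add, map_sum, map_smul, hnormal, smul_zero, Finset.sum_const_zero, add_zero,
      H.tangentProj_apply hy, map_zero] using h
  rw [hu, zero_add] at hut
  refine Prod.ext (H.injective_fderiv hy (hu.trans (map_zero _).symm)) (funext fun j => ?_)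
  have hj := HP.apply_sum_smul j t (F y)
  rw [hut, map_zero] at hj
  exact (smul_eq_zero.1 hj.symm).resolve_right (hne j)

theorem eventually_mem_image [FiniteDimensional ℝ L] (H : HyperbolicKaehler β U F J) (hy : y ∈ U)
    (HP : OrthogonalSplitting β P) (hdim : finrank ℝ L = finrank ℝ E + Fintype.card κ)
    (hP : ∀ j, Commute (P j) (tangentProj β F y)) (hr : ∀ j, r j ≠ 0)
    (hF : ∀ z ∈ U, ∀ j, β (P j (F z)) (F z) = r j) :
    ∀ᶠ w in 𝓝 (F y), (∀ j, β (P j w) w = r j) → w ∈ F '' U := by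
  have hne (j) : P j (F y) ≠ 0 := fun h => hr j <| by rw [← hF y hy j, h, map_zero, zero_apply]
  have hstrict : HasStrictFDerivAt F (fderiv ℝ F y) y :=
    (H.smooth.contDiffAt (H.isOpen.mem_nhds hy)).hasStrictFDerivAt (by simp)
  have hsurj : (rescaleDeriv F P y).range = ⊤ := by
    refine LinearMap.range_eq_top.2 ((LinearMap.injective_iff_surjective_of_finrank_eq_finrank ?_).1
      (H.injective_rescaleDeriv hy HP hP hne))
    rw [finrank_prod, finrank_fintype_fun_eq_card, hdim]
  rw [← rescale_zero (F := F) (P := P) y,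
    ← (hasStrictFDerivAt_rescale hstrict).map_nhds_eq_of_surj hsurj]
  exact eventually_rescale_mem_image HP (H.isOpen.mem_nhds hy) hr hF

end HyperbolicKaehler

end Rescaling

section LorentzFrame

open Module

variable {L : Type*} [NormedAddCommGroup L] [NormedSpace ℝ L] {β : L →L[ℝ] L →L[ℝ] ℝ}

namespace LorentzFrame

variable {ι : Type*} [DecidableEq ι] {o : ι} {b : ι → L}

theorem self_ne_zero (hb : LorentzFrame β o b) (a : ι) : β (b a) (b a) ≠ 0 := by
  rw [hb.norm_eq]
  split_ifs <;> norm_num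

theorem self_neg (hb : LorentzFrame β o b) : β (b o) (b o) < 0 := by
  rw [hb.norm_eq, if_pos rfl]
  exact neg_one_lt_zero

theorem orthogonalSplitting {κ : Type*} [Fintype κ] [DecidableEq κ] [FiniteDimensional ℝ L]
    {o : κ × Fin 3} {b : κ × Fin 3 → L} (hb : LorentzFrame β o b) (hsymm : ∀ x z, β x z = β z x)
    (hcard : Fintype.card (κ × Fin 3) = finrank ℝ L) : OrthogonalSplitting β (blockProj β b) :=
  orthogonalSplitting_blockProj hsymm hb.orthogonal hb.self_ne_zero
    (span_eq_top_of_orthogonal hb.orthogonal hb.self_ne_zero hcard)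

variable [Fintype ι] [FiniteDimensional ℝ L]

/-- The linear isomorphism to `L` given by a Lorentzian frame. -/
def equiv (hb : LorentzFrame β o b) (hcard : Fintype.card ι = finrank ℝ L) : (ι → ℝ) ≃ₗ[ℝ] L :=
  (basisOfLinearIndependentOfCardEqFinrank' b
    (LinearMap.linearIndependent_of_isOrthoᵢ (B := β.toLinearMap₁₂)
      (fun a a' haa' => hb.orthogonal a a' haa') hb.self_ne_zero) hcard).equivFun.symm

theorem equiv_apply (hb : LorentzFrame β o b) (hcard : Fintype.card ι = finrank ℝ L) (x : ι → ℝ) :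
    hb.equiv hcard x = ∑ a, x a • b a := by
  simp [equiv, Basis.equivFun_symm_apply]

theorem equiv_single (hb : LorentzFrame β o b) (hcard : Fintype.card ι = finrank ℝ L) (a : ι) :
    hb.equiv hcard (Pi.single a 1) = b a := by
  simp [equiv_apply, Pi.single_apply]

theorem beta_equiv (hb : LorentzFrame β o b) (hcard : Fintype.card ι = finrank ℝ L) (x : ι → ℝ)
    (a : ι) : β (hb.equiv hcard x) (b a) = (if a = o then -1 else 1) * x a := by
  have hzero (a') (ha' : a' ≠ a) : β (x a' • b a') (b a) = 0 := by
    rw [map_smul, smul_apply, hb.orthogonal a' a ha', smul_zero]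
  rw [equiv_apply, map_sum, sum_apply, Finset.sum_eq_single a (fun a' _ => hzero a') (by simp),
    map_smul, smul_apply, hb.norm_eq, smul_eq_mul, mul_comm]

theorem beta_equiv_equiv (hb : LorentzFrame β o b) (hcard : Fintype.card ι = finrank ℝ L)
    (x z : ι → ℝ) : β (hb.equiv hcard x) (hb.equiv hcard z) = lorentz o x z := by
  rw [hb.equiv_apply hcard z, map_sum, lorentz]
  refine Finset.sum_congr rfl fun a _ => ?_
  rw [map_smul, beta_equiv, smul_eq_mul]
  ring

end LorentzFrame

section Product

variable [FiniteDimensional ℝ L] {p : ℕ} {b : Fin (p + 1) × Fin 3 → L}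

theorem LorentzFrame.beta_blockProj_equiv (hb : LorentzFrame β (0, 0) b)
    (hsymm : ∀ x z, β x z = β z x) (hcard : Fintype.card (Fin (p + 1) × Fin 3) = finrank ℝ L)
    (x : Fin (p + 1) × Fin 3 → ℝ) (j : Fin (p + 1)) :
    β (blockProj β b j (hb.equiv hcard x)) (hb.equiv hcard x) =
      ∑ k, (if (j, k) = ((0, 0) : Fin (p + 1) × Fin 3) then -1 else 1) * x (j, k) ^ 2 := by
  rw [blockProj_apply, map_sum, sum_apply]
  refine Finset.sum_congr rfl fun k _ => ?_
  rw [map_smul, smul_apply, hsymm (b (j, k)) (hb.equiv hcard x), hb.beta_equiv, hb.norm_eq,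
    smul_eq_mul]
  split_ifs <;> ring

theorem LorentzFrame.mem_image_extrinsicProduct_iff (hb : LorentzFrame β (0, 0) b)
    (hsymm : ∀ x z, β x z = β z x) (hcard : Fintype.card (Fin (p + 1) × Fin 3) = finrank ℝ L)
    {c : Fin (p + 1) → ℝ} {w : L} :
    w ∈ hb.equiv hcard '' extrinsicProduct p c ↔
      (∀ j, β (blockProj β b j w) w = 1 / c j) ∧ β w (b (0, 0)) < 0 := by
  obtain ⟨x, rfl⟩ := (hb.equiv hcard).surjective w
  have hzero : β (blockProj β b 0 (hb.equiv hcard x)) (hb.equiv hcard x) =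
      lorentz 0 (fun i => x (0, i)) fun i => x (0, i) := by
    simp [hb.beta_blockProj_equiv hsymm, lorentz, sq]
  have hne (j) (hj : j ≠ 0) : β (blockProj β b j (hb.equiv hcard x)) (hb.equiv hcard x) =
      ∑ i, x (j, i) ^ 2 := by
    simp [hb.beta_blockProj_equiv hsymm, hj]
  have hpos : β (hb.equiv hcard x) (b (0, 0)) < 0 ↔ 0 < x (0, 0) := by
    rw [hb.beta_equiv, if_pos rfl, neg_one_mul, neg_lt_zero]
  rw [(hb.equiv hcard).injective.mem_set_image, hpos]
  constructor
  · rintro ⟨⟨hx, hxpos⟩, hsphere⟩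
    refine ⟨fun j => ?_, hxpos⟩
    obtain rfl | hj := eq_or_ne j 0
    · exact hzero.trans hx
    · exact (hne j hj).trans (hsphere j hj)
  · rintro ⟨hx, hxpos⟩
    exact ⟨⟨hzero.symm.trans (hx 0), hxpos⟩, fun j hj => (hne j hj).symm.trans (hx j)⟩

end Product

namespace AdaptedFrame

variable {E : Type*} [NormedAddCommGroup E] [NormedSpace ℝ E] {F : E → L} {J : E → E →L[ℝ] E}
  {y : E} {p : ℕ} {b : Fin (p + 1) × Fin 3 → L}

theorem beta_blockProj_self (hb : AdaptedFrame β F J y b) (hsymm : ∀ x z, β x z = β z x)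
    (j : Fin (p + 1)) :
    β (blockProj β b j (F y)) (F y) = (if j = 0 then -1 else 1) * β (b (j, 0)) (F y) ^ 2 := by
  have hzero (k) (hk : k ≠ 0) :
      β ((β (F y) (b (j, k)) / β (b (j, k)) (b (j, k))) • b (j, k)) (F y) = 0 := by
    rw [map_smul, smul_apply, hb.beta_self_eq_zero j k hk, smul_zero]
  rw [blockProj_apply, map_sum, sum_apply, Finset.sum_eq_single 0 (fun k _ => hzero k) (by simp),
    map_smul, smul_apply, hsymm (F y), hb.norm_eq, smul_eq_mul]
  obtain rfl | hj := eq_or_ne j 0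
  · rw [if_pos rfl, if_pos rfl]
    ring
  · rw [if_neg (by simp [hj]), if_neg hj]
    ring

theorem beta_blockProj_zero_neg (hb : AdaptedFrame β F J y b) (hsymm : ∀ x z, β x z = β z x) :
    β (blockProj β b 0 (F y)) (F y) < 0 := by
  rw [hb.beta_blockProj_self hsymm, if_pos rfl, neg_one_mul, neg_lt_zero]
  exact sq_pos_of_neg (hb.beta_self_neg 0)

theorem beta_blockProj_pos (hb : AdaptedFrame β F J y b) (hsymm : ∀ x z, β x z = β z x)
    {j : Fin (p + 1)} (hj : j ≠ 0) : 0 < β (blockProj β b j (F y)) (F y) := by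
  rw [hb.beta_blockProj_self hsymm, if_neg hj, one_mul]
  exact sq_pos_of_neg (hb.beta_self_neg j)

end AdaptedFrame

end LorentzFrame

section Range

open Module Filter Topology IsManifold

theorem exists_isOpen_inter_eq {X : Type*} [TopologicalSpace X] {S T : Set X} (hST : S ⊆ T)
    (hS : ∀ x ∈ S, ∀ᶠ w in 𝓝 x, w ∈ T → w ∈ S) : ∃ O, IsOpen O ∧ S = O ∩ T := by
  refine ⟨interior {w | w ∈ T → w ∈ S}, isOpen_interior, Set.Subset.antisymm ?_ ?_⟩
  · exact fun x hx => ⟨mem_interior_iff_mem_nhds.2 (hS x hx), hST hx⟩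
  · exact fun x hx => interior_subset hx.1 hx.2

variable {d N : ℕ} {M : Type*} [TopologicalSpace M] [ChartedSpace (EuclideanSpace ℝ (Fin d)) M]
  [IsManifold (𝓡 d) ∞ M] {K : KaehlerStructure d M} {f : M → HyperbolicSpace N} {κ : Type*}
  [Fintype κ] {P : κ → (Fin (N + 1) → ℝ) →L[ℝ] (Fin (N + 1) → ℝ)} {r : κ → ℝ}

theorem eventually_mem_range_of_splitsAt (hf : IsIsometricImmersion K.metric f)
    (HP : OrthogonalSplitting (lorentzForm 0) P) (hdim : N + 1 = d + Fintype.card κ)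
    (hr : ∀ j, r j ≠ 0) (h : ∀ x, SplitsAt K f P r x) (x : M) :
    ∀ᶠ w in 𝓝 (f x : Fin (N + 1) → ℝ), (∀ j, lorentzForm 0 (P j w) w = r j) →
      w ∈ Set.range fun x => (f x : Fin (N + 1) → ℝ) := by
  let e := chartAt (EuclideanSpace ℝ (Fin d)) x
  have he : e ∈ maximalAtlas (𝓡 d) ∞ M := chart_mem_maximalAtlas x
  have hx : x ∈ e.source := mem_chart_source _ x
  have hsplit (y) (hy : y ∈ e.target) := (splitsAt_symm_iff hf he HP hy).1 (h (e.symm y))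
  have hmem := (hf.hyperbolicKaehler he).eventually_mem_image (e.map_source hx) HP
    (by rwa [finrank_euclideanSpace_fin, finrank_fin_fun])
    (fun j => (hsplit _ (e.map_source hx) j).1.1) hr fun y hy j => (hsplit y hy j).2
  rw [chartMap_apply hx] at hmem
  filter_upwards [hmem] with w hw hwr
  obtain ⟨y, -, rfl⟩ := hw hwr
  exact ⟨e.symm y, rfl⟩

theorem IsIsometricImmersion.exists_adaptedFrame (hf : IsIsometricImmersion K.metric f) {p : ℕ}
    (hN : N = d + p) (hd : 2 * (p + 1) ≤ d) (x : M) (V : Submodule ℝ (TangentSpace (𝓡 d) x))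
    (hVJ : ∀ S ∈ V, K.J x S ∈ V) (hV : 2 * p ≤ finrank ℝ V)
    (hK : ∀ S ∈ V, S ≠ 0 → 0 < sectionalCurvature K.metric x S (K.J x S)) :
    let e := chartAt (EuclideanSpace ℝ (Fin d)) x
    d = 2 * (p + 1) ∧ ∃ b : Fin (p + 1) × Fin 3 → Fin (N + 1) → ℝ,
      AdaptedFrame (lorentzForm 0) (chartMap f e) (chartEndo K.J e) (e x) b := by
  intro e
  have he : e ∈ maximalAtlas (𝓡 d) ∞ M := chart_mem_maximalAtlas x
  obtain ⟨Z, hZ⟩ := hf.exists_isRegularAt x V hVJ (by omega) hK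
  have hframe := (hf.hyperbolicKaehler he).exists_adaptedFrame (p := p)
    (e.map_source (mem_chart_source _ x))
  rw [finrank_euclideanSpace_fin, finrank_fin_fun] at hframe
  exact hframe (by rw [hN, add_assoc]) hd hZ

variable {e : OpenPartialHomeomorph M (EuclideanSpace ℝ (Fin d))} {x₀ : M} {p : ℕ}
  {b : Fin (p + 1) × Fin 3 → Fin (N + 1) → ℝ}

theorem AdaptedFrame.pos (hx₀ : x₀ ∈ e.source)
    (hb : AdaptedFrame (lorentzForm 0) (chartMap f e) (chartEndo K.J e) (e x₀) b) :
    0 < b (0, 0) 0 := by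
  have hneg : lorentz 0 (b (0, 0)) (b (0, 0)) < 0 := hb.self_neg
  have hfx := lorentz_self_neg_of_mem_hyperboloid neg_one_lt_zero (f x₀).2
  have hbf := hb.beta_self_neg 0
  rw [chartMap_apply hx₀] at hbf
  exact (pos_iff_lorentz_neg hneg hfx (f x₀).2.2).2 hbf

theorem AdaptedFrame.splitsAt [ConnectedSpace M] (hf : IsIsometricImmersion K.metric f)
    (he : e ∈ maximalAtlas (𝓡 d) ∞ M) (hx₀ : x₀ ∈ e.source)
    (hb : AdaptedFrame (lorentzForm 0) (chartMap f e) (chartEndo K.J e) (e x₀) b)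
    (hcard : Fintype.card (Fin (p + 1) × Fin 3) = finrank ℝ (Fin (N + 1) → ℝ))
    (hdim : 2 * (N + 1) ≤ 3 * d) (x : M) :
    SplitsAt K f (blockProj (lorentzForm 0) b)
      (fun j => lorentzForm 0 (blockProj (lorentzForm 0) b j (f x₀)) (f x₀)) x :=
  have HP := hb.orthogonalSplitting (lorentz_comm 0) hcard
  splitsAt_of_eventually hf HP hdim
    (eventually_splitsAt hf he HP hdim hx₀ hb.commutesAt fun _ => rfl) x

theorem exists_isOpen_range_eq (hf : IsIsometricImmersion K.metric f)
    (hb : LorentzFrame (lorentzForm 0) (0, 0) b) (hpos : 0 < b (0, 0) 0)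
    (hcard : Fintype.card (Fin (p + 1) × Fin 3) = finrank ℝ (Fin (N + 1) → ℝ))
    (hdim : N = d + p) {c : Fin (p + 1) → ℝ} (hc : ∀ j, c j ≠ 0)
    (h : ∀ x, SplitsAt K f (blockProj (lorentzForm 0) b) (fun j => 1 / c j) x) :
    ∃ O : Set (Fin (N + 1) → ℝ), IsOpen O ∧
      Set.range (fun x => (f x : Fin (N + 1) → ℝ)) =
        O ∩ hb.equiv hcard '' extrinsicProduct p c := by
  have hmem {w : Fin (N + 1) → ℝ} :=
    hb.mem_image_extrinsicProduct_iff (lorentz_comm 0) hcard (c := c) (w := w)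
  refine exists_isOpen_inter_eq ?_ ?_
  · rintro _ ⟨x, rfl⟩
    exact hmem.2 ⟨fun j => (h x j).2, (pos_iff_lorentz_neg
      (lorentz_self_neg_of_mem_hyperboloid neg_one_lt_zero (f x).2) hb.self_neg hpos).1 (f x).2.2⟩
  · rintro _ ⟨x, rfl⟩
    filter_upwards [eventually_mem_range_of_splitsAt hf
      (hb.orthogonalSplitting (lorentz_comm 0) hcard) (by rw [hdim, Fintype.card_fin, add_assoc])
      (fun j => one_div_ne_zero (hc j)) h x] with w hw hwT
    exact hw (hmem.1 hwT).1

end Range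

end KaehlerHyperbolic

end

open KaehlerHyperbolic in
theorem theorem1_general {n p : ℕ} (hp : p + 1 ≤ n)
    {M : Type*} [TopologicalSpace M] [ConnectedSpace M]
    [ChartedSpace (EuclideanSpace ℝ (Fin (2 * n))) M] [IsManifold (𝓡 (2 * n)) ∞ M]
    (K : KaehlerStructure (2 * n) M) (f : M → HyperbolicSpace (2 * n + p))
    (hf : IsIsometricImmersion K.metric f)
    (x₀ : M) (V : Submodule ℝ (TangentSpace (𝓡 (2 * n)) x₀))
    (hVJ : ∀ S ∈ V, K.J x₀ S ∈ V) (hV : 2 * p ≤ Module.finrank ℝ V)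
    (hK : ∀ S ∈ V, S ≠ 0 → 0 < sectionalCurvature K.metric x₀ S (K.J x₀ S)) :
    n = p + 1 ∧
    ∃ c : Fin (p + 1) → ℝ, c 0 < 0 ∧ (∀ j, j ≠ 0 → 0 < c j) ∧ ∑ j, 1 / c j = -1 ∧
      ∃ Φ : (Fin (p + 1) × Fin 3 → ℝ) ≃ₗ[ℝ] (Fin (2 * n + p + 1) → ℝ),
        (∀ x y, lorentz 0 (Φ x) (Φ y) = lorentz (0, 0) x y) ∧
        Φ '' hyperboloid (0, 0) (-1) = HyperbolicSpace (2 * n + p) ∧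
        ∃ O : Set (Fin (2 * n + p + 1) → ℝ), IsOpen O ∧
          Set.range (fun x => (f x : Fin (2 * n + p + 1) → ℝ)) = O ∩ Φ '' extrinsicProduct p c := by
  obtain ⟨hn, b, hb⟩ := hf.exists_adaptedFrame rfl (by omega) x₀ V hVJ hV hK
  have hx₀ := mem_chart_source (EuclideanSpace ℝ (Fin (2 * n))) x₀
  have hcard : Fintype.card (Fin (p + 1) × Fin 3) =
      Module.finrank ℝ (Fin (2 * n + p + 1) → ℝ) := by
    rw [Fintype.card_prod, Fintype.card_fin, Fintype.card_fin, Module.finrank_fin_fun]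
    omega
  have hsplit := hb.splitsAt hf (IsManifold.chart_mem_maximalAtlas x₀) hx₀ hcard (by omega)
  have hpos := hb.pos hx₀
  let r (j) := lorentzForm 0 (blockProj (lorentzForm 0) b j (f x₀)) (f x₀)
  have hr_zero : r 0 < 0 := by
    simpa only [chartMap_apply hx₀] using hb.beta_blockProj_zero_neg (lorentz_comm 0)
  have hr_pos (j) (hj : j ≠ 0) : 0 < r j := by
    simpa only [chartMap_apply hx₀] using hb.beta_blockProj_pos (lorentz_comm 0) hj
  have hr_ne (j) : r j ≠ 0 :=
    (eq_or_ne j 0).elim (fun hj => hj ▸ hr_zero.ne) fun hj => (hr_pos j hj).ne'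
  have hr_sum : ∑ j, r j = -1 := by
    rw [(hb.orthogonalSplitting (lorentz_comm 0) hcard).sum_beta_apply, lorentzForm_apply,
      (f x₀).2.1, one_div_neg_one_eq_neg_one]
  refine ⟨by omega, fun j => 1 / r j, one_div_neg.2 hr_zero,
    fun j hj => one_div_pos.2 (hr_pos j hj), by simpa only [one_div_one_div] using hr_sum,
    hb.equiv hcard, hb.beta_equiv_equiv hcard,
    image_hyperboloid _ (hb.beta_equiv_equiv hcard) (by rwa [hb.equiv_single]) neg_one_lt_zero,
    exists_isOpen_range_eq hf hb.toLorentzFrame hpos hcard rfl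
      (fun j => one_div_ne_zero (hr_ne j)) (by simpa only [one_div_one_div] using hsplit)⟩

theorem theorem1 {n p m : ℕ} (hp : p + 1 ≤ n)
    {M : Type*} [TopologicalSpace M] [T2Space M] [SecondCountableTopology M] [ConnectedSpace M]
    [ChartedSpace (EuclideanSpace ℝ (Fin (2 * n))) M] [IsManifold (𝓡 (2 * n)) ∞ M]
    (K : KaehlerHyperbolic.KaehlerStructure (2 * n) M)
    (f : M → KaehlerHyperbolic.HyperbolicSpace (2 * n + p))
    (hf : KaehlerHyperbolic.IsIsometricImmersion K.metric f)
    (x₀ : M) (V : Submodule ℝ (TangentSpace (𝓡 (2 * n)) x₀))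
    (hVJ : ∀ S ∈ V, K.J x₀ S ∈ V) (hVm : Module.finrank ℝ V = 2 * m) (hm : p ≤ m)
    (hK : ∀ S ∈ V, S ≠ 0 →
      0 < KaehlerHyperbolic.sectionalCurvature K.metric x₀ S (K.J x₀ S)) :
    n = p + 1 ∧
    ∃ c : Fin (p + 1) → ℝ, c 0 < 0 ∧ (∀ j, j ≠ 0 → 0 < c j) ∧ ∑ j, 1 / c j = -1 ∧
      -- the identification of `𝕃³ × ℝ³ × ⋯ × ℝ³` with `𝕃^{2n+p+1} = 𝕃^{3n}`
      ∃ Φ : (Fin (p + 1) × Fin 3 → ℝ) ≃ₗ[ℝ] (Fin (2 * n + p + 1) → ℝ),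
        (∀ x y, KaehlerHyperbolic.lorentz 0 (Φ x) (Φ y)
          = KaehlerHyperbolic.lorentz (0, 0) x y) ∧
        Φ '' KaehlerHyperbolic.hyperboloid (0, 0) (-1)
          = KaehlerHyperbolic.HyperbolicSpace (2 * n + p) ∧
        ∃ O : Set (Fin (2 * n + p + 1) → ℝ), IsOpen O ∧
          Set.range (fun x => (f x : Fin (2 * n + p + 1) → ℝ))
            = O ∩ Φ '' KaehlerHyperbolic.extrinsicProduct p c :=
  theorem1_general hp K f hf x₀ V hVJ (by omega) hK
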